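/- A \emph{finite 2-complex} is the underlying space of a finite connected 2-dimensional CW-complex in which each point has a neighborhood homeomorphic to the cone over a finite graph. Its interior $\operatorname{Int}X$ is the set of points having a neighborhood homeomorphic to $\mathbb R^2$, and its boundary $\partial X$ is the closure of the set of points of $X\setminus\operatorname{Int}X$ that have an open neighborhood homeomorphic to $\mathbb R$ or to $\mathbb R\times\mathbb R_{\ge 0}$. Let $Y$ be a finite 2-complex with $\partial Y=\emptyset$. A finite graph $\Gamma\subset Y$ (possibly empty or disconnected) is \emph{regular} if it has a closed neighborhood homeomorphic to $\Gamma\times[-1,1]$ with $\Gamma=\Gamma\times 0$; a \emph{coorientation} is a choice of one side of each component of $\Gamma$. A cooriented regular graph $\Gamma$ defines a class $\phi_\Gamma\in H^1(Y;\mathbb Z)=\operatorname{Hom}(\pi_1(Y),\mathbb Z)$, the pull-back of the generator of $H^1(S^1;\mathbb Z)$ under the map $Y\to S^1=\mathbb R/\mathbb Z$ that collapses the complement of $\Gamma\times(-1,1)$ to a point and wraps the intervals $p\times[-1,1]$ once around the circle in the direction given by the coorientation. If $\Gamma_1,\dots,\Gamma_k$ are the components of $\Gamma$, put $\chi_-(\Gamma)=\sum_i\max\{-\chi(\Gamma_i),0\}$.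 The \emph{Turaev norm} of $\psi\in H^1(Y;\mathbb Z)$ is $$t_Y(\psi)=\min\{\chi_-(\Gamma)\mid \Gamma\subset Y\text{ a cooriented regular graph with }\phi_\Gamma=\psi\},$$ and $t_Y$ is extended to $H^1(Y;\mathbb Q)$ by homogeneity: $t_Y(\psi)=t_Y(n\psi)/n$ for $n\ge 1$ with $n\psi$ integral. For a finite 2-complex $X$ with $\partial X=\emptyset$ and $\phi\in H^1(X;\mathbb Q)=\operatorname{Hom}(\pi_1(X),\mathbb Q)$, the \emph{Turaev complexity function} is $$\overline t_X(\phi)=\inf\{t_Y(\phi\circ f)\mid Y\text{ a finite 2-complex with }\partial Y=\emptyset,\ f\colon\pi_1(Y)\to\pi_1(X)\text{ an isomorphism}\}.$$ For a finite presentation $P=\langle x_1,\dots,x_m\mid r_1,\dots,r_n\rangle$ (the relators being words that need not be reduced) let $\sharp(x_i)$ be the number of appearances of $x_i^{\pm1}$ in $r_1,\dots,r_n$; $P$ is \emph{good} if $\sharp(x_i)\ge 2$ for all $i$. For a good presentation $P$ of a group $\pi$ and $\phi\in\operatorname{Hom}(\pi,\mathbb Q)$ put $t_P(\phi)=\sum_i(\sharp(x_i)/2-1)\,|\phi(x_i)|$,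 and let $\overline t_\pi(\phi)$ be the minimum of $t_P(\phi)$ over all good presentations $P$ of $\pi$. \textbf{Lemma.} Let $X$ be a finite 2-complex with $\partial X=\emptyset$, let $\pi=\pi_1(X)$ and let $\phi\in H^1(X;\mathbb Q)$. Then $$\overline t_X(\phi)\le\overline t_\pi(\phi).$$ -/

import Mathlib

open Topology Set
open scoped unitInterval ENNReal

noncomputable section

namespace TuraevComplexity

/-! ### Finite graphs and finite 2-complexes -/

/-- A structure of finite graph on the subset `C` of a space: a finite CW decomposition of `C`
all of whose cells have dimension at most one. -/
structure FiniteGraphStructure.{u} {X : Type u} [TopologicalSpace X] (C : Set X) where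
  cw : CWComplex C
  finite : CWComplex.Finite C
  isEmpty_cell : ∀ n, 2 ≤ n → IsEmpty (RelCWComplex.cell C n)

/-- A space which is homeomorphic to a finite graph. -/
def IsFiniteGraph (L : Type*) [TopologicalSpace L] : Prop :=
  T2Space L ∧ Nonempty (FiniteGraphStructure (univ : Set L))

/-- The cone over a space: the quotient of `L × [0,1]` that collapses `L × {0}` to a point. -/
def Cone (L : Type*) [TopologicalSpace L] : Type _ :=
  Quot fun a b : L × I => a.2 = 0 ∧ b.2 = 0

instance instTopologicalSpaceCone (L : Type*) [TopologicalSpace L] : TopologicalSpace (Cone L) :=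
  inferInstanceAs (TopologicalSpace (Quot _))

/-- `X` is a finite 2-complex: the underlying space of a finite connected (Hausdorff)
CW complex of dimension two, in which every point has a neighbourhood that is homeomorphic to the
cone over a finite graph. (Every finite graph is homeomorphic to one that lives in `Type`.) -/
structure IsFiniteTwoComplex (X : Type*) [TopologicalSpace X] : Prop where
  t2 : T2Space X
  connected : ConnectedSpace X
  exists_cw : ∃ _ : CWComplex (univ : Set X), CWComplex.Finite (univ : Set X) ∧
    Nonempty (RelCWComplex.cell (univ : Set X) 2) ∧
    ∀ n, 2 < n → IsEmpty (RelCWComplex.cell (univ : Set X) n)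
  exists_cone_nhd : ∀ x : X, ∃ N ∈ 𝓝 x, ∃ (L : Type) (_ : TopologicalSpace L),
    IsFiniteGraph L ∧ Nonempty (N ≃ₜ Cone L)

/-- The points of `X` that have a neighbourhood homeomorphic to the plane. -/
def twoInterior (X : Type*) [TopologicalSpace X] : Set X :=
  {x | ∃ N ∈ 𝓝 x, Nonempty (N ≃ₜ ℝ × ℝ)}

/-- The boundary `∂X`: the closure of the set of points outside the interior of `X` that have an
open neighbourhood homeomorphic to the line or to the closed half-plane. -/
def twoBoundary (X : Type*) [TopologicalSpace X] : Set X :=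
  closure {x | x ∉ twoInterior X ∧ ∃ U : Set X, IsOpen U ∧ x ∈ U ∧
    (Nonempty (U ≃ₜ ℝ) ∨ Nonempty (U ≃ₜ ℝ × Ici (0 : ℝ)))}

/-! ### The complexity `χ₋` of a finite graph -/

section Graph

variable {X : Type*} [TopologicalSpace X] {C : Set X}

/-- The Euler characteristic of (the subgraph carried by) a connected component `K` of a finite
graph: the number of vertices minus the number of edges in `K`. Since open cells are connected, an
open cell lies in `K` as soon as its centre does. -/
def FiniteGraphStructure.eulerChar (G : FiniteGraphStructure C) (K : Set X) : ℤ :=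
  letI := G.cw
  (Nat.card {v : RelCWComplex.cell C 0 // RelCWComplex.map 0 v 0 ∈ K} : ℤ) -
    (Nat.card {e : RelCWComplex.cell C 1 // RelCWComplex.map 1 e 0 ∈ K} : ℤ)

/-- `χ₋(C) = ∑ max (-χ(K)) 0`, the sum over the (finitely many) connected components `K` of `C`.
Here `Int.toNat z` is `max z 0`. -/
def FiniteGraphStructure.complexity (G : FiniteGraphStructure C) : ℕ :=
  ∑ᶠ K ∈ connectedComponentIn C '' C, (-G.eulerChar K).toNat

end Graph

/-! ### Cooriented regular graphs and the classes they define -/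

/-- A cooriented regular graph in `X`: a finite graph `carrier` in `X ∖ ∂X` with a closed
neighbourhood in `X ∖ ∂X` that is parametrised by `carrier × [-1,1]`, the graph itself being
`carrier × 0`. The coorientation, i.e. the chosen side of each component of the graph, is the side
on which the parameter is positive. After shrinking the neighbourhood, its part
`carrier × (-1,1)` is open in `X`. The graph may be empty or disconnected. -/
structure CoorientedRegularGraph (X : Type*) [TopologicalSpace X] where
  carrier : Set X
  graph : FiniteGraphStructure carrier
  collar : carrier × Icc (-1 : ℝ) 1 → X
  isClosedEmbedding_collar : IsClosedEmbedding collar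
  collar_zero : ∀ p : carrier, collar (p, ⟨0, by norm_num⟩) = p
  isOpen_collar : IsOpen (collar '' {q | -1 < (q.2 : ℝ) ∧ (q.2 : ℝ) < 1})
  collar_notMem_boundary : ∀ q, collar q ∉ twoBoundary X

/-- The collapse map `X → ℝ/ℤ` of a cooriented regular graph `Γ`: the point with parameter `s` in
the collar `Γ × [-1,1]` goes to the class of `(s + 1) / 2`, and the complement of the collar
goes to `0`. -/
def CoorientedRegularGraph.collapse {X : Type*} [TopologicalSpace X]
    (Γ : CoorientedRegularGraph X) : X → AddCircle (1 : ℝ) :=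
  Function.extend Γ.collar (fun q => ((((q.2 : ℝ) + 1) / 2 : ℝ) : AddCircle (1 : ℝ)))
    (fun _ => 0)

/-- `H¹(X; ℤ) = Hom(π₁(X), ℤ)`. -/
abbrev IntegralClass (X : Type*) [TopologicalSpace X] (x₀ : X) : Type _ :=
  FundamentalGroup X x₀ →* Multiplicative ℤ

/-- `H¹(X; ℚ) = Hom(π₁(X), ℚ)`. -/
abbrev RationalClass (X : Type*) [TopologicalSpace X] (x₀ : X) : Type _ :=
  FundamentalGroup X x₀ →* Multiplicative ℚ

/-- `φ_Γ = ψ`: the class defined by `Γ` is the pull-back of the generator of `H¹(ℝ/ℤ; ℤ)` under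
the collapse map. That is, for each loop `γ` the value of `ψ` on `[γ]` is the degree of
`collapse ∘ γ`, i.e. the increment along `γ` of a lift of `collapse ∘ γ` to `ℝ`. -/
def CoorientedRegularGraph.Represents {X : Type*} [TopologicalSpace X] {x₀ : X}
    (Γ : CoorientedRegularGraph X) (ψ : IntegralClass X x₀) : Prop :=
  ∀ γ : Path x₀ x₀, ∃ g : C(I, ℝ),
    (∀ t, ((g t : ℝ) : AddCircle (1 : ℝ)) = Γ.collapse (γ t)) ∧
    g 1 - g 0 = ((Multiplicative.toAdd
      (ψ (FundamentalGroup.fromPath (Path.Homotopic.Quotient.mk γ))) : ℤ) : ℝ)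

/-! ### The Turaev norm and the Turaev complexity function

All minima and infima are taken in `[0, ∞]`; the infimum of the empty set is `∞`. -/

section Norm

variable {X : Type*} [TopologicalSpace X] {x₀ : X}

/-- The Turaev norm `t_X(ψ)` of an integral class: the minimum of `χ₋(Γ)` over all cooriented
regular graphs `Γ` with `φ_Γ = ψ`. -/
def turaevNormInt (ψ : IntegralClass X x₀) : ℝ≥0∞ :=
  ⨅ (Γ : CoorientedRegularGraph X) (_ : Γ.Represents ψ), (Γ.graph.complexity : ℝ≥0∞)

/-- `n • φ = ψ`, for a rational class `φ` and an integral class `ψ`. -/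
def IsIntegralMultiple (n : ℕ) (φ : RationalClass X x₀) (ψ : IntegralClass X x₀) : Prop :=
  ∀ g, (n : ℚ) * Multiplicative.toAdd (φ g) = ((Multiplicative.toAdd (ψ g) : ℤ) : ℚ)

/-- The Turaev norm `t_X(φ)` of a rational class, i.e. the homogeneous extension of the Turaev
norm on integral classes: `t_X(φ) = t_X(n • φ) / n`, where `n` is the least positive integer such
that `n • φ` is integral. (On integral classes `n = 1`.) -/
def turaevNorm (φ : RationalClass X x₀) : ℝ≥0∞ :=
  ⨅ (n : ℕ) (_ : IsLeast {k : ℕ | 0 < k ∧ ∃ ψ : IntegralClass X x₀, IsIntegralMultiple k φ ψ} n)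
    (ψ : IntegralClass X x₀) (_ : IsIntegralMultiple n φ ψ), turaevNormInt ψ / n

/-- The Turaev complexity function: the infimum of `t_Y(φ ∘ f)` over all finite 2-complexes
`Y` with `∂Y = ∅` and all isomorphisms `f : π₁(Y) → π₁(X)`. (Finite 2-complexes are compact and
metrizable, so each of them is homeomorphic to one that lives in `Type`.) -/
def turaevComplexity (φ : RationalClass X x₀) : ℝ≥0∞ :=
  ⨅ (Y : Type) (_ : TopologicalSpace Y) (_ : IsFiniteTwoComplex Y) (_ : twoBoundary Y = ∅)
    (y₀ : Y) (f : FundamentalGroup Y y₀ ≃* FundamentalGroup X x₀),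
    turaevNorm (φ.comp f.toMonoidHom)

end Norm

/-! ### Presentations and the presentation complexity of a group -/

/-- A finite presentation `⟨x_1, …, x_m ∣ r_1, …, r_n⟩`. The relators are words in the letters
`x_i^{±1}`, not necessarily reduced; the letter `(i, true)` is `x_i` and `(i, false)` is
`x_i⁻¹`. -/
structure FinitePresentation where
  numGenerators : ℕ
  numRelators : ℕ
  relator : Fin numRelators → List (Fin numGenerators × Bool)

namespace FinitePresentation

/-- The group with presentation `P`. -/
abbrev Group (P : FinitePresentation) : Type :=
  PresentedGroup (range fun j => FreeGroup.mk (P.relator j))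

/-- `♯(x_i)`: the number of appearances of `x_i^{±1}` in the relators. -/
def occurrences (P : FinitePresentation) (i : Fin P.numGenerators) : ℕ :=
  ∑ j, (P.relator j).countP fun l => decide (l.1 = i)

/-- `P` is good if each generator appears at least twice in the relators. -/
def IsGood (P : FinitePresentation) : Prop :=
  ∀ i, 2 ≤ P.occurrences i

/-- `t_P(φ) = ∑ (♯(x_i) / 2 - 1) * |φ(x_i)|`, where `P` is regarded as a presentation of `π`
by means of the isomorphism `e`. -/
def complexity {π : Type*} [_root_.Group π] (P : FinitePresentation) (e : P.Group ≃* π)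
    (φ : π →* Multiplicative ℚ) : ℚ :=
  ∑ i, ((P.occurrences i : ℚ) / 2 - 1) * |Multiplicative.toAdd (φ (e (PresentedGroup.of i)))|

end FinitePresentation

/-- The minimum of `t_P(φ)` over all good presentations `P` of `π`. (The values `t_P(φ)` of good
presentations are nonnegative.) -/
def presentationComplexity {π : Type*} [Group π] (φ : π →* Multiplicative ℚ) : ℝ≥0∞ :=
  ⨅ (P : FinitePresentation) (_ : P.IsGood) (e : P.Group ≃* π),
    ENNReal.ofReal (P.complexity e φ : ℝ)

end TuraevComplexity

end

noncomputable section

namespace TuraevComplexity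

/-! ### Finite CW structures from characteristic maps -/

section CWOfMaps

open Metric

universe u

variable {X : Type u} [TopologicalSpace X]

/-! Let `P` be a good presentation, and let `ψ = nφ` be integral with `n` least. The complex `Y` is
a triangulated presentation complex: a bouquet of subdivided circles, one for each generator, with a
disc made of concentric rings and a centre attached along each relator. A generator that occurs
`♯(x_i)` times puts each edge of its circle in `♯(x_i)` triangles. Goodness therefore says that
every edge lies in at least two triangles, so every point that is not a vertex has a neighbourhood
retracting to a disc. Such a point is no boundary point of a half-plane and has no neighbourhood
that is a line, and `∂Y = ∅` follows (`twoBoundary_space_eq_empty`).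

The class `ψ` is realised by integer heights, given as an additive cocycle of height differences in
`{-1, 0, 1}` on the edges. Along the circle of `x_i` the height moves monotonically by `ψ(x_i)` in
total, and on the rings of a disc the boundary heights are clamped to shrinking intervals until they
vanish. The points halfway between consecutive heights form a graph with a collar, with one vertex
on each sloped edge and one arc across each sloped triangle. The collapse map measures the height
modulo 1, so the graph represents `ψ` (`represents_regularGraph`).

Each vertex of this graph is on at least two arcs and each arc has two ends. No component then has
positive Euler characteristic, and `χ₋` is bounded by arcs minus vertices
(`complexity_midGraph_add_le`). A sloped triangle has two sloped edges. Counting pairs of a sloped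
triangle and a sloped edge, an edge inside a disc counts twice and an edge on the circle of `x_i`
counts `♯(x_i)` times. Hence twice (arcs minus vertices) is at most `∑ (♯(x_i) - 2) |ψ(x_i)| = 2 n
t_P(φ)` (`WalkSystem.IsTame.two_mul_card_le`, `WordSystem.two_mul_complexity_le`).

The fundamental group is computed with cocycles (`exists_fundamentalGroup_mulEquiv`). A cocycle with
values in `G` defines a covering, so the gain of an edge path is a homotopy invariant. If the
cocycle is universal, comparison with the tautological cocycle in the fundamental group identifies
the latter with `G`.

To give all attaching words one length, relators are padded by an extra generator that two further
relators make trivial. Its class is zero, so it adds nothing to the bound. -/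

/-- A finite family of cells in a space, given by maps on closed cubes that are injective on open
cubes. -/
structure CellFamily (C : Set X) where
  cell : ℕ → Type u
  map : ∀ n, cell n → (Fin n → ℝ) → X
  eventually_isEmpty : ∀ᶠ n in Filter.atTop, IsEmpty (cell n)
  finite_cell : ∀ n, Finite (cell n)
  continuous_map : ∀ n i, Continuous (map n i)
  eq_of_map_eq : ∀ n i, ∀ x ∈ ball (0 : Fin n → ℝ) 1, ∀ y ∈ closedBall (0 : Fin n → ℝ) 1,
    map n i x = map n i y → x = y
  disjoint_cells : ∀ n i m j, (map n i '' ball 0 1 ∩ map m j '' ball 0 1).Nonempty →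
    (⟨n, i⟩ : Σ n, cell n) = ⟨m, j⟩
  mapsTo_sphere : ∀ n i, MapsTo (map n i) (sphere 0 1)
    (⋃ (m < n) (j : cell m), map m j '' closedBall 0 1)
  iUnion_eq : ⋃ (n : ℕ) (j : cell n), map n j '' closedBall 0 1 = C

namespace CellFamily

variable {C : Set X} (F : CellFamily C)

lemma injOn_ball (n : ℕ) (i : F.cell n) : InjOn (F.map n i) (ball 0 1) :=
  fun x hx y hy h => F.eq_of_map_eq n i x hx y (ball_subset_closedBall hy) h

/-- The characteristic map as a partial equivalence. -/
def partialEquiv (n : ℕ) (i : F.cell n) : PartialEquiv (Fin n → ℝ) X :=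
  (F.injOn_ball n i).bijOn_image.toPartialEquiv _ _ _

/-- A compactness argument: images of closed subsets of the closed cube are closed, and
`eq_of_map_eq` keeps the sphere from reaching the open cell, so intersecting with the open cell sees
only interior preimages. -/
lemma continuousOn_symm [T2Space X] (n : ℕ) (i : F.cell n) :
    ContinuousOn (F.partialEquiv n i).symm (F.partialEquiv n i).target := by
  set e := F.partialEquiv n i
  have hsrc : e.source = ball 0 1 := rfl
  have htgt : e.target = F.map n i '' ball 0 1 := rfl
  have hmap : ∀ x, e x = F.map n i x := fun _ => rfl
  rw [continuousOn_iff_isClosed]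
  intro t ht
  refine ⟨F.map n i '' (t ∩ closedBall 0 1), ?_, ?_⟩
  · exact (((isCompact_closedBall _ _).inter_left ht).image (F.continuous_map n i)).isClosed
  · ext y
    constructor
    · rintro ⟨hy, hyt⟩
      exact ⟨⟨e.symm y, ⟨hy, ball_subset_closedBall (e.map_target hyt)⟩, e.right_inv hyt⟩, hyt⟩
    · rintro ⟨⟨z, ⟨hz, hzb⟩, rfl⟩, hyt⟩
      refine ⟨?_, hyt⟩
      have h1 : e.symm (F.map n i z) ∈ ball 0 1 := e.map_target hyt
      have h2 : F.map n i (e.symm (F.map n i z)) = F.map n i z := e.right_inv hyt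
      have := F.eq_of_map_eq n i _ h1 _ hzb h2
      simpa only [mem_preimage, this] using hz

/-- The CW structure defined by a finite family of cells. -/
@[reducible]
def cw [T2Space X] : CWComplex C :=
  CWComplex.mkFinite C F.cell F.partialEquiv F.eventually_isEmpty F.finite_cell
    (fun _ _ => rfl) (fun n i => (F.continuous_map n i).continuousOn) F.continuousOn_symm
    (by
      rintro ⟨n, i⟩ - ⟨m, j⟩ - hne
      rw [Function.onFun, Set.disjoint_iff_inter_eq_empty]
      by_contra h
      exact hne (F.disjoint_cells n i m j (nonempty_iff_ne_empty.2 h)))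
    F.mapsTo_sphere F.iUnion_eq

lemma finite_cw [T2Space X] : letI := F.cw; CWComplex.Finite C :=
  CWComplex.finite_mkFinite C F.cell F.partialEquiv F.eventually_isEmpty F.finite_cell
    (fun _ _ => rfl) (fun n i => (F.continuous_map n i).continuousOn) F.continuousOn_symm
    (by
      rintro ⟨n, i⟩ - ⟨m, j⟩ - hne
      rw [Function.onFun, Set.disjoint_iff_inter_eq_empty]
      by_contra h
      exact hne (F.disjoint_cells n i m j (nonempty_iff_ne_empty.2 h)))
    F.mapsTo_sphere F.iUnion_eq

/-- The finite graph defined by a family of cells of dimension at most one. -/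
def graph [T2Space X] (h : ∀ n, 2 ≤ n → IsEmpty (F.cell n)) : FiniteGraphStructure C where
  cw := F.cw
  finite := F.finite_cw
  isEmpty_cell := h

end CellFamily

end CWOfMaps

/-! ### A map from the cube onto the simplex -/

section Stick

open Metric

/-- The retraction of the line to `[0,1]` that identifies `[-1,1]` with `[0,1]`. -/
def unitCoord (x : ℝ) : ℝ := max 0 (min 1 ((x + 1) / 2))

lemma unitCoord_nonneg (x : ℝ) : 0 ≤ unitCoord x := le_max_left _ _

lemma unitCoord_le_one (x : ℝ) : unitCoord x ≤ 1 := max_le zero_le_one (min_le_left _ _)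

lemma unitCoord_eq {x : ℝ} (h : |x| ≤ 1) : unitCoord x = (x + 1) / 2 := by
  rw [abs_le] at h
  rw [unitCoord, min_eq_right (by linarith), max_eq_right (by linarith)]

lemma continuous_unitCoord : Continuous unitCoord := by
  unfold unitCoord; fun_prop

/-- The stick-breaking map from the cube to the simplex. -/
def stick : (n : ℕ) → (Fin n → ℝ) → Fin (n + 1) → ℝ
  | 0, _ => fun _ => 1
  | n + 1, x => Fin.cons (1 - unitCoord (x 0)) (fun i => unitCoord (x 0) * stick n (Fin.tail x) i)

lemma continuous_stick (n : ℕ) (i : Fin (n + 1)) : Continuous fun x => stick n x i := by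
  induction n with
  | zero => exact continuous_const
  | succ n ih =>
    have h0 : Continuous fun x : Fin (n + 1) → ℝ => unitCoord (x 0) :=
      continuous_unitCoord.comp (continuous_apply 0)
    refine Fin.cases ?_ (fun i => ?_) i
    · simp only [stick, Fin.cons_zero]
      exact continuous_const.sub h0
    · simp only [stick, Fin.cons_succ]
      refine h0.mul ((ih i).comp ?_)
      exact continuous_pi fun j => continuous_apply j.succ

lemma sum_stick (n : ℕ) (x : Fin n → ℝ) : ∑ i, stick n x i = 1 := by
  induction n with
  | zero => simp [stick]
  | succ n ih => simp [stick, Fin.sum_univ_succ, ← Finset.mul_sum, ih]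

lemma stick_nonneg (n : ℕ) (x : Fin n → ℝ) (i : Fin (n + 1)) : 0 ≤ stick n x i := by
  induction n with
  | zero => simp [stick]
  | succ n ih =>
    refine Fin.cases ?_ (fun i => ?_) i
    · simpa [stick] using unitCoord_le_one _
    · simpa [stick] using mul_nonneg (unitCoord_nonneg _) (ih _ i)

lemma abs_lt_one_iff_unitCoord {x : ℝ} : |x| < 1 ↔ 0 < unitCoord x ∧ unitCoord x < 1 := by
  rw [unitCoord, abs_lt]
  simp only [lt_max_iff, lt_min_iff, max_lt_iff, min_lt_iff, lt_irrefl, false_or, zero_lt_one,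
    true_and]
  constructor <;> rintro ⟨h1, h2⟩ <;> constructor <;> linarith

/-- Writing `u_i = unitCoord (x i)`, the weights are `1 - u_0`, `u_0 (1 - u_1)`, and so on, up to
the product of all `u_i`. All are positive exactly when each `u_i` lies strictly between 0 and 1. -/
lemma mem_ball_iff_stick_pos (n : ℕ) (x : Fin n → ℝ) :
    x ∈ ball (0 : Fin n → ℝ) 1 ↔ ∀ i, 0 < stick n x i := by
  rw [mem_ball_zero_iff, pi_norm_lt_iff one_pos]
  simp only [Real.norm_eq_abs]
  induction n with
  | zero => simp [stick]
  | succ n ih =>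
    rw [Fin.forall_fin_succ, Fin.forall_fin_succ]
    simp only [stick, Fin.cons_zero, Fin.cons_succ, abs_lt_one_iff_unitCoord (x := x 0), sub_pos]
    have := ih (Fin.tail x)
    simp only [Fin.tail] at this
    rw [this]
    constructor
    · rintro ⟨⟨h0, h1⟩, h⟩
      exact ⟨h1, fun i => mul_pos h0 (h i)⟩
    · rintro ⟨h1, h⟩
      have h0 : 0 < unitCoord (x 0) := by
        rcases (unitCoord_nonneg (x 0)).eq_or_lt with h0 | h0
        · simpa [← h0] using h 0
        · exact h0
      exact ⟨⟨h0, h1⟩, fun i => pos_of_mul_pos_right (h i) h0.le⟩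

/-- The coordinates are recovered one after another by cancelling positive factors. Only `x` has to
be interior; this asymmetric form is what `CellFamily.eq_of_map_eq` asks for. -/
lemma eq_of_stick_eq (n : ℕ) (x : Fin n → ℝ) (hx : x ∈ ball (0 : Fin n → ℝ) 1) (y : Fin n → ℝ)
    (hy : y ∈ closedBall (0 : Fin n → ℝ) 1) (h : stick n x = stick n y) : x = y := by
  rw [mem_ball_zero_iff, pi_norm_lt_iff one_pos] at hx
  rw [mem_closedBall_zero_iff, pi_norm_le_iff_of_nonneg zero_le_one] at hy
  simp only [Real.norm_eq_abs] at hx hy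
  induction n with
  | zero => exact Subsingleton.elim _ _
  | succ n ih =>
    have h0 : unitCoord (x 0) = unitCoord (y 0) := by simpa [stick] using congrFun h 0
    have hpos := (abs_lt_one_iff_unitCoord.1 (hx 0)).1
    have htail : Fin.tail x = Fin.tail y := by
      refine ih _ (fun i => hx i.succ) _ (fun i => hy i.succ) ?_
      funext i
      have := congrFun h i.succ
      simp only [stick, Fin.cons_succ, ← h0] at this
      exact mul_left_cancel₀ hpos.ne' this
    rw [unitCoord_eq (hx 0).le, unitCoord_eq (hy 0)] at h0
    funext i
    refine Fin.cases (by linarith) (fun i => congrFun htail i) i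

lemma exists_stick_eq (n : ℕ) (w : Fin (n + 1) → ℝ) (hw : ∀ i, 0 < w i) (hs : ∑ i, w i = 1) :
    ∃ x, stick n x = w := by
  induction n with
  | zero =>
    refine ⟨0, funext fun i => ?_⟩
    obtain rfl : i = 0 := by omega
    simpa [stick] using hs.symm
  | succ n ih =>
    rw [Fin.sum_univ_succ] at hs
    have hpos : 0 < ∑ i : Fin (n + 1), w i.succ :=
      Finset.sum_pos (fun i _ => hw _) Finset.univ_nonempty
    -- The remaining weights are rescaled to total 1; the stick left after the first piece has
    -- length `1 - w 0`.
    obtain ⟨y, hy⟩ := ih (fun i => w i.succ / (1 - w 0)) (fun i => div_pos (hw _) (by linarith))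
      (by rw [← Finset.sum_div, div_eq_one_iff_eq (by linarith)]; linarith)
    have hx : unitCoord (2 * (1 - w 0) - 1) = 1 - w 0 := by
      rw [unitCoord_eq]
      · ring
      · rw [abs_le]; constructor <;> linarith [hw 0]
    refine ⟨Fin.cons (2 * (1 - w 0) - 1) y, ?_⟩
    funext i
    refine Fin.cases ?_ (fun i => ?_) i
    · simp [stick, hx]
    · simp only [stick, Fin.cons_succ, Fin.cons_zero, hx, Fin.tail_cons, hy]
      rw [mul_div_cancel₀]
      linarith

end Stick

/-! ### Simplicial complexes and their geometric realizations -/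

/-- An abstract simplicial complex on the vertex set `V`. -/
structure VertexComplex (V : Type) where
  faces : Set (Finset V)
  nonempty_of_mem : ∀ s ∈ faces, s.Nonempty
  mem_of_subset : ∀ s ∈ faces, ∀ t ⊆ s, t.Nonempty → t ∈ faces

section Support

variable {V : Type} [Fintype V]

/-- The support of a function. -/
def supp (w : V → ℝ) : Finset V := by
  classical exact Finset.univ.filter fun v => w v ≠ 0

@[simp] lemma mem_supp {w : V → ℝ} {v : V} : v ∈ supp w ↔ w v ≠ 0 := by simp [supp]

lemma notMem_supp {w : V → ℝ} {v : V} : v ∉ supp w ↔ w v = 0 := by simp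

end Support

namespace VertexComplex

variable {V : Type} [Fintype V] (K : VertexComplex V)

/-- The set of points of the geometric realization, in barycentric coordinates. -/
def points : Set (V → ℝ) := {w | (∀ v, 0 ≤ w v) ∧ ∑ v, w v = 1 ∧ supp w ∈ K.faces}

/-- The geometric realization. -/
abbrev Space : Type := K.points

variable {K}

lemma Space.nonneg (x : K.Space) (v : V) : 0 ≤ x.1 v := x.2.1 v

lemma Space.sum_eq_one (x : K.Space) : ∑ v, x.1 v = 1 := x.2.2.1

lemma Space.supp_mem (x : K.Space) : supp x.1 ∈ K.faces := x.2.2.2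

lemma Space.pos_iff (x : K.Space) (v : V) : 0 < x.1 v ↔ v ∈ supp x.1 := by
  rw [mem_supp, (x.nonneg v).lt_iff_ne, ne_comm]

lemma Space.sum_subset (x : K.Space) {s : Finset V} (h : supp x.1 ⊆ s) : ∑ v ∈ s, x.1 v = 1 := by
  rw [← x.sum_eq_one]
  exact Finset.sum_subset (Finset.subset_univ _) fun v _ hv => notMem_supp.1 fun h' => hv (h h')

lemma Space.exists_mem_supp (x : K.Space) : ∃ v, v ∈ supp x.1 := K.nonempty_of_mem _ x.supp_mem

variable (K)

/-- The closed simplex spanned by `s`. -/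
def closedSimplex (s : Finset V) : Set (V → ℝ) :=
  {w | (∀ v, 0 ≤ w v) ∧ ∑ v, w v = 1 ∧ ∀ v, v ∉ s → w v = 0}

omit K in
lemma convex_closedSimplex (s : Finset V) : Convex ℝ (closedSimplex s) := by
  rintro x ⟨hx0, hx1, hxs⟩ y ⟨hy0, hy1, hys⟩ a b ha hb hab
  refine ⟨fun v => ?_, ?_, fun v hv => ?_⟩
  · have := mul_nonneg ha (hx0 v)
    have := mul_nonneg hb (hy0 v)
    simp only [Pi.add_apply, Pi.smul_apply, smul_eq_mul]
    positivity
  · simp [Finset.sum_add_distrib, ← Finset.mul_sum, hx1, hy1, hab]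
  · simp [hxs v hv, hys v hv]

omit K in
lemma mem_closedSimplex_supp {w : V → ℝ} {s : Finset V} (h : w ∈ closedSimplex s) : supp w ⊆ s := by
  intro v hv
  by_contra h'
  exact (mem_supp.1 hv) (h.2.2 v h')

variable {K}

lemma closedSimplex_subset {s : Finset V} (hs : s ∈ K.faces) : closedSimplex s ⊆ K.points := by
  intro w hw
  refine ⟨hw.1, hw.2.1, K.mem_of_subset s hs _ (mem_closedSimplex_supp hw) ?_⟩
  by_contra hne
  rw [Finset.not_nonempty_iff_eq_empty] at hne
  have h0 : ∀ v, w v = 0 := fun v => notMem_supp.1 (by simp [hne])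
  have := hw.2.1
  simp [h0] at this

lemma Space.mem_closedSimplex (x : K.Space) {s : Finset V} (h : supp x.1 ⊆ s) :
    x.1 ∈ closedSimplex s :=
  ⟨x.nonneg, x.sum_eq_one, fun _ hv => notMem_supp.1 fun h' => hv (h h')⟩

omit K in
lemma isClosed_closedSimplex (s : Finset V) : IsClosed (closedSimplex s) := by
  have : closedSimplex s = (⋂ v, {w : V → ℝ | 0 ≤ w v}) ∩ {w | ∑ v, w v = 1} ∩
      ⋂ v, ⋂ (_ : v ∉ s), {w | w v = 0} := by
    ext w
    simp [closedSimplex, and_assoc]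
  rw [this]
  refine ((isClosed_iInter fun v => isClosed_le continuous_const (continuous_apply v)).inter
    (isClosed_eq (by fun_prop) continuous_const)).inter
    (isClosed_iInter fun v => isClosed_iInter fun _ => isClosed_eq (continuous_apply v) continuous_const)

omit K in
lemma isCompact_closedSimplex (s : Finset V) : IsCompact (closedSimplex s) := by
  refine (isCompact_Icc (a := (0 : V → ℝ)) (b := 1)).of_isClosed_subset (isClosed_closedSimplex s) ?_
  rintro w ⟨h0, h1, -⟩
  exact ⟨h0, fun v => le_of_le_of_eq (Finset.single_le_sum (f := w) (fun i _ => h0 i) (Finset.mem_univ v)) h1⟩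

variable (K)

lemma points_eq : K.points = ⋃ s ∈ K.faces, closedSimplex s := by
  ext w
  simp only [mem_iUnion]
  constructor
  · rintro h
    exact ⟨_, h.2.2, Space.mem_closedSimplex (⟨w, h⟩ : K.Space) subset_rfl⟩
  · rintro ⟨s, hs, hw⟩
    exact closedSimplex_subset hs hw

lemma isCompact_points : IsCompact K.points := by
  rw [points_eq]
  exact (toFinite K.faces).isCompact_biUnion fun s _ => isCompact_closedSimplex s

instance : CompactSpace K.Space := isCompact_iff_compactSpace.1 K.isCompact_points

/-! #### The CW structure -/

/-- The faces with `n + 1` vertices. -/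
def Face (n : ℕ) : Type := {s : Finset V // s ∈ K.faces ∧ s.card = n + 1}

variable {K}

/-- An enumeration of the vertices of a face. -/
def Face.equiv {n : ℕ} (s : K.Face n) : s.1 ≃ Fin (n + 1) := s.1.equivFinOfCardEq s.2.2

/-- The barycentric coordinates of the image of a point under the characteristic map. -/
def Face.coord {n : ℕ} (s : K.Face n) (x : Fin n → ℝ) : V → ℝ := by
  classical exact fun v => if h : v ∈ s.1 then stick n x (s.equiv ⟨v, h⟩) else 0

omit [Fintype V] in
lemma Face.coord_of_mem {n : ℕ} (s : K.Face n) (x : Fin n → ℝ) {v : V} (h : v ∈ s.1) :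
    s.coord x v = stick n x (s.equiv ⟨v, h⟩) := by simp [coord, h]

omit [Fintype V] in
lemma Face.coord_of_notMem {n : ℕ} (s : K.Face n) (x : Fin n → ℝ) {v : V} (h : v ∉ s.1) :
    s.coord x v = 0 := by simp [coord, h]

lemma Face.coord_mem {n : ℕ} (s : K.Face n) (x : Fin n → ℝ) : s.coord x ∈ closedSimplex s.1 := by
  refine ⟨fun v => ?_, ?_, fun v hv => s.coord_of_notMem x hv⟩
  · by_cases h : v ∈ s.1
    · rw [s.coord_of_mem x h]; exact stick_nonneg _ _ _
    · rw [s.coord_of_notMem x h]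
  · rw [← Finset.sum_subset (Finset.subset_univ s.1) fun v _ hv => s.coord_of_notMem x hv,
      ← Finset.sum_coe_sort, ← sum_stick n x, ← s.equiv.sum_comp]
    exact Finset.sum_congr rfl fun v _ => s.coord_of_mem x v.2

/-- The characteristic map of a face. -/
def Face.map {n : ℕ} (s : K.Face n) (x : Fin n → ℝ) : K.Space :=
  ⟨s.coord x, closedSimplex_subset s.2.1 (s.coord_mem x)⟩

lemma Face.continuous_map {n : ℕ} (s : K.Face n) : Continuous s.map := by
  refine Continuous.subtype_mk (continuous_pi fun v => ?_) _
  by_cases h : v ∈ s.1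
  · simp only [s.coord_of_mem _ h]; exact continuous_stick _ _
  · simp only [s.coord_of_notMem _ h]; exact continuous_const

lemma Face.supp_map_subset {n : ℕ} (s : K.Face n) (x : Fin n → ℝ) : supp (s.map x).1 ⊆ s.1 :=
  mem_closedSimplex_supp (s.coord_mem x)

open Metric in
lemma Face.mem_ball_iff {n : ℕ} (s : K.Face n) (x : Fin n → ℝ) :
    x ∈ ball (0 : Fin n → ℝ) 1 ↔ supp (s.map x).1 = s.1 := by
  rw [mem_ball_iff_stick_pos]
  constructor
  · intro h
    refine (s.supp_map_subset x).antisymm fun v hv => ?_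
    rw [mem_supp]
    change s.coord x v ≠ 0
    rw [s.coord_of_mem x hv]
    exact (h _).ne'
  · intro h i
    have hv := (s.equiv.symm i).2
    have hv : 0 < (s.map x).1 (s.equiv.symm i) := (Space.pos_iff _ _).2 (h.symm ▸ hv)
    change 0 < s.coord x _ at hv
    rw [s.coord_of_mem x (s.equiv.symm i).2] at hv
    simpa using hv

open Metric in
lemma Face.exists_map_eq {n : ℕ} (s : K.Face n) (y : K.Space) (h : supp y.1 = s.1) :
    ∃ x ∈ ball (0 : Fin n → ℝ) 1, s.map x = y := by
  obtain ⟨x, hx⟩ := exists_stick_eq n (fun i => y.1 (s.equiv.symm i))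
    (fun i => (y.pos_iff _).2 (by rw [h]; exact (s.equiv.symm i).2))
    (by rw [s.equiv.symm.sum_comp (fun v => y.1 v), Finset.sum_coe_sort s.1 y.1]
        exact y.sum_subset h.subset)
  have hxy : s.map x = y := by
    refine Subtype.ext (funext fun v => ?_)
    change s.coord x v = _
    by_cases hv : v ∈ s.1
    · rw [s.coord_of_mem x hv, hx]; simp
    · rw [s.coord_of_notMem x hv]
      exact (notMem_supp.1 (h ▸ hv)).symm
  exact ⟨x, (s.mem_ball_iff x).2 (hxy ▸ h), hxy⟩

open Metric in
lemma Face.eq_of_map_eq {n : ℕ} (s : K.Face n) (x : Fin n → ℝ) (hx : x ∈ ball (0 : Fin n → ℝ) 1)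
    (y : Fin n → ℝ) (hy : y ∈ closedBall (0 : Fin n → ℝ) 1) (h : s.map x = s.map y) : x = y := by
  refine eq_of_stick_eq n x hx y hy (funext fun i => ?_)
  have := congrFun (congrArg Subtype.val h) (s.equiv.symm i)
  change s.coord x _ = s.coord y _ at this
  rw [s.coord_of_mem x (s.equiv.symm i).2, s.coord_of_mem y (s.equiv.symm i).2] at this
  simpa using this

/-- The face that contains a point in its interior. -/
def Space.face (y : K.Space) : K.Face ((supp y.1).card - 1) :=
  ⟨supp y.1, y.supp_mem,
    (Nat.sub_add_cancel (Finset.card_pos.2 (K.nonempty_of_mem _ y.supp_mem))).symm⟩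

variable (K)

instance (n : ℕ) : Finite (K.Face n) := Subtype.finite

omit [Fintype V] in
lemma face_ext {n m : ℕ} (s : K.Face n) (t : K.Face m) (h : s.1 = t.1) :
    (⟨n, s⟩ : Σ n, K.Face n) = ⟨m, t⟩ := by
  obtain rfl : n = m := by have := s.2.2; have := t.2.2; rw [h] at *; omega
  rw [Subtype.ext h]

open Metric in
/-- The cells of the geometric realization are the faces. -/
def cellFamily : CellFamily (univ : Set K.Space) where
  cell := K.Face
  map _ s := s.map
  eventually_isEmpty := by
    refine Filter.eventually_atTop.2 ⟨Fintype.card V, fun n hn => ⟨fun s => ?_⟩⟩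
    have := s.2.2 ▸ Finset.card_le_univ s.1
    omega
  finite_cell _ := inferInstance
  continuous_map _ s := s.continuous_map
  eq_of_map_eq _ s := s.eq_of_map_eq
  disjoint_cells := by
    rintro n s m t ⟨y, ⟨x, hx, rfl⟩, ⟨x', hx', h⟩⟩
    refine K.face_ext s t ?_
    rw [← (s.mem_ball_iff x).1 hx, ← (t.mem_ball_iff x').1 hx', h]
  mapsTo_sphere := by
    intro n s x hx
    -- On the sphere some barycentric coordinate vanishes, so the image lies in the open cell of a
    -- proper face.
    have hne : supp (s.map x).1 ≠ s.1 := fun h => by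
      have := (s.mem_ball_iff x).2 h
      rw [mem_sphere_zero_iff_norm] at hx
      rw [mem_ball_zero_iff] at this
      exact this.ne hx
    have hlt := Finset.card_lt_card ((s.supp_map_subset x).ssubset_of_ne hne)
    have h1 := (s.map x).face.2.2
    change (supp (s.map x).1).card = _ at h1
    obtain ⟨z, hz, hzx⟩ := (s.map x).face.exists_map_eq (s.map x) rfl
    simp only [mem_iUnion]
    exact ⟨_, by have := s.2.2; omega, _, z, ball_subset_closedBall hz, hzx⟩
  iUnion_eq := by
    refine eq_univ_of_forall fun y => ?_
    obtain ⟨z, hz, hzx⟩ := y.face.exists_map_eq y rfl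
    simp only [mem_iUnion]
    exact ⟨_, _, z, ball_subset_closedBall hz, hzx⟩

lemma isFiniteGraph_space (h : ∀ s ∈ K.faces, s.card ≤ 2) : IsFiniteGraph K.Space :=
  ⟨inferInstance, ⟨K.cellFamily.graph fun n hn => ⟨fun s : K.Face n => by
    have := h _ s.2.1; have := s.2.2; omega⟩⟩⟩

lemma exists_cw (h : ∀ s ∈ K.faces, s.card ≤ 3) (h' : ∃ s ∈ K.faces, s.card = 3) :
    ∃ _ : CWComplex (univ : Set K.Space), CWComplex.Finite (univ : Set K.Space) ∧
    Nonempty (RelCWComplex.cell (univ : Set K.Space) 2) ∧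
    ∀ n, 2 < n → IsEmpty (RelCWComplex.cell (univ : Set K.Space) n) := by
  obtain ⟨s, hs, hc⟩ := h'
  refine ⟨K.cellFamily.cw, K.cellFamily.finite_cw, ⟨(⟨s, hs, hc⟩ : K.Face 2)⟩, fun n hn => ?_⟩
  exact ⟨fun s : K.Face n => by have := h _ s.2.1; have := s.2.2; omega⟩

end VertexComplex

namespace VertexComplex

variable {V : Type} [Fintype V] {K : VertexComplex V}

/-! #### Segments -/

lemma lineMap_mem_points {s : Finset V} (hs : s ∈ K.faces) {x y : K.Space} (hx : supp x.1 ⊆ s)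
    (hy : supp y.1 ⊆ s) (t : I) : (1 - (t : ℝ)) • x.1 + (t : ℝ) • y.1 ∈ K.points :=
  closedSimplex_subset hs (convex_closedSimplex s (x.mem_closedSimplex hx) (y.mem_closedSimplex hy)
    (by linarith [t.2.2]) t.2.1 (by ring))

/-! #### Cone neighbourhoods -/

variable (K) in
/-- The boundary of the closed star of `s₀`. -/
def starBoundary (s₀ : Finset V) : VertexComplex V where
  faces := {ρ | ρ ∈ K.faces ∧ (∃ τ ∈ K.faces, s₀ ⊆ τ ∧ ρ ⊆ τ) ∧ ¬ s₀ ⊆ ρ}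
  nonempty_of_mem s hs := K.nonempty_of_mem s hs.1
  mem_of_subset := by
    rintro s ⟨hs, ⟨τ, hτ, h1, h2⟩, h3⟩ t ht hne
    exact ⟨K.mem_of_subset s hs t ht hne, ⟨τ, hτ, h1, ht.trans h2⟩, fun h => h3 (h.trans ht)⟩

/-- The closed star of a point. -/
def star (x : K.Space) : Set K.Space := {y | ∃ τ ∈ K.faces, supp x.1 ⊆ τ ∧ supp y.1 ⊆ τ}

/-- The open star of a point. -/
def openStar (x : K.Space) : Set K.Space := {y | supp x.1 ⊆ supp y.1}

lemma isOpen_openStar (x : K.Space) : IsOpen (openStar x) := by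
  have : openStar x = ⋂ v ∈ supp x.1, {y : K.Space | 0 < y.1 v} := by
    ext y
    simp only [mem_iInter, mem_ofPred_eq, y.pos_iff]
    rfl
  rw [this]
  refine isOpen_biInter_finset fun v _ => isOpen_lt continuous_const ?_
  exact (continuous_apply v).comp continuous_subtype_val

lemma mem_openStar_self (x : K.Space) : x ∈ openStar x := Finset.Subset.refl _

lemma star_mem_nhds (x : K.Space) : star x ∈ 𝓝 x :=
  Filter.mem_of_superset ((isOpen_openStar x).mem_nhds (mem_openStar_self x))
    fun y hy => ⟨supp y.1, y.supp_mem, hy, subset_rfl⟩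

/-- The points of the cone on the boundary of the star as points of the star. -/
def coneMapAux (x : K.Space) (p : (K.starBoundary (supp x.1)).Space × I) : star x := by
  refine ⟨⟨(1 - (p.2 : ℝ)) • x.1 + (p.2 : ℝ) • p.1.1, ?_⟩, ?_⟩
  · obtain ⟨τ, hτ, h1, h2⟩ := p.1.supp_mem.2.1
    exact lineMap_mem_points hτ (y := ⟨p.1.1, p.1.nonneg, p.1.sum_eq_one, p.1.supp_mem.1⟩) h1 h2 p.2
  · obtain ⟨τ, hτ, h1, h2⟩ := p.1.supp_mem.2.1
    refine ⟨τ, hτ, h1, fun v hv => ?_⟩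
    by_contra h
    refine mem_supp.1 hv ?_
    have e1 : x.1 v = 0 := notMem_supp.1 fun h' => h (h1 h')
    have e2 : p.1.1 v = 0 := notMem_supp.1 fun h' => h (h2 h')
    simp [e1, e2]

lemma coneMapAux_apply (x : K.Space) (p : (K.starBoundary (supp x.1)).Space × I) (v : V) :
    (coneMapAux x p).1.1 v = (1 - (p.2 : ℝ)) * x.1 v + p.2 * p.1.1 v := rfl

lemma continuous_coneMapAux (x : K.Space) : Continuous (coneMapAux x) := by
  refine Continuous.subtype_mk (Continuous.subtype_mk ?_ _) _
  fun_prop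

/-- The cone on the boundary of the star maps to the star. -/
def coneMap (x : K.Space) : Cone (K.starBoundary (supp x.1)).Space → star x :=
  Quot.lift (coneMapAux x) fun a b h => by
    refine Subtype.ext (Subtype.ext (funext fun v => ?_))
    rw [coneMapAux_apply, coneMapAux_apply, h.1, h.2]
    simp

lemma continuous_coneMap (x : K.Space) : Continuous (coneMap x) :=
  continuous_quot_lift _ (continuous_coneMapAux x)

/-- Some vertex `v` of `supp x` is missing from the base point of `q`. There the image of `q` has
weight `(1 - q.2) * x v`, while that of `p` has at least `(1 - p.2) * x v`. -/
lemma param_le_of_coneMapAux_eq (x : K.Space) (p q : (K.starBoundary (supp x.1)).Space × I)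
    (h : coneMapAux x p = coneMapAux x q) : (q.2 : ℝ) ≤ p.2 := by
  obtain ⟨v, hv, hq⟩ := Finset.not_subset.1 q.1.supp_mem.2.2
  rw [notMem_supp] at hq
  have hx := (x.pos_iff v).2 hv
  have h1 := coneMapAux_apply x p v
  rw [h, coneMapAux_apply, hq] at h1
  have h2 := mul_nonneg p.2.2.1 (p.1.nonneg v)
  by_contra hlt
  nlinarith

lemma coneMap_injective (x : K.Space) : Function.Injective (coneMap x) := by
  rintro ⟨p⟩ ⟨q⟩ h
  change coneMapAux x p = coneMapAux x q at h
  have hpq : (p.2 : ℝ) = q.2 :=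
    (param_le_of_coneMapAux_eq x q p h.symm).antisymm (param_le_of_coneMapAux_eq x p q h)
  by_cases h0 : (p.2 : ℝ) = 0
  · exact Quot.sound ⟨Subtype.ext h0, Subtype.ext (hpq ▸ h0)⟩
  · refine congrArg _ (Prod.ext (Subtype.ext (funext fun v => ?_)) (Subtype.ext hpq))
    have h1 := coneMapAux_apply x p v
    rw [h, coneMapAux_apply, hpq] at h1
    rw [hpq] at h0
    exact (mul_left_cancel₀ h0 (by linarith)).symm

/-- The ray from `x` through `y` leaves the star where a coordinate in `supp x` first vanishes. That
exit point is the base coordinate in the cone. -/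
lemma coneMap_surjective (x : K.Space) (hne : Nonempty (K.starBoundary (supp x.1)).Space) :
    Function.Surjective (coneMap x) := by
  rintro ⟨y, τ, hτ, h1, h2⟩
  by_cases hxy : y = x
  -- The apex is the class of a pair, so it exists only when the base is nonempty.
  · obtain ⟨l⟩ := hne
    refine ⟨Quot.mk _ (l, 0), Subtype.ext (Subtype.ext (funext fun v => ?_))⟩
    change (coneMapAux x (l, 0)).1.1 v = y.1 v
    rw [coneMapAux_apply, hxy]
    simp
  -- The least ratio `t` is the largest multiple of `x` that can be subtracted from `y` with
  -- nonnegative result; the difference vanishes at `u`, which puts it in the boundary of the star.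
  obtain ⟨u, hu, hmin⟩ := Finset.exists_min_image (supp x.1) (fun v => y.1 v / x.1 v)
    x.exists_mem_supp
  have hxpos : ∀ v ∈ supp x.1, 0 < x.1 v := fun v hv => (x.pos_iff v).2 hv
  set t := y.1 u / x.1 u with ht
  have ht0 : 0 ≤ t := div_nonneg (y.nonneg u) (x.nonneg u)
  have hle : ∀ v, t * x.1 v ≤ y.1 v := fun v => by
    by_cases hv : v ∈ supp x.1
    · exact (le_div_iff₀ (hxpos v hv)).1 (hmin v hv)
    · rw [notMem_supp.1 hv, mul_zero]; exact y.nonneg v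
  -- If `t ≥ 1`, then `x ≤ y` coordinatewise with equal sums, forcing `x = y`.
  have ht1 : t < 1 := by
    by_contra hge
    push Not at hge
    have hall : ∀ v ∈ Finset.univ, x.1 v ≤ y.1 v := fun v _ => by
      have := hle v; nlinarith [x.nonneg v]
    have := (Finset.sum_eq_sum_iff_of_le hall).1 (x.sum_eq_one.trans y.sum_eq_one.symm)
    exact hxy (Subtype.ext (funext fun v => (this v (Finset.mem_univ v)).symm))
  have h1t : 0 < 1 - t := by linarith
  let l : V → ℝ := fun v => (y.1 v - t * x.1 v) / (1 - t)
  have hlu : l u = 0 := by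
    simp only [l, ht, div_mul_cancel₀ _ (hxpos u hu).ne', sub_self, zero_div]
  have hl : l ∈ closedSimplex τ := by
    refine ⟨fun v => div_nonneg (by linarith [hle v]) h1t.le, ?_, fun v hv => ?_⟩
    · rw [← Finset.sum_div, Finset.sum_sub_distrib, ← Finset.mul_sum, y.sum_eq_one, x.sum_eq_one,
        mul_one, div_self h1t.ne']
    · simp only [l]
      rw [notMem_supp.1 fun h => hv (h1 h), notMem_supp.1 fun h => hv (h2 h)]
      simp
  have hlK := closedSimplex_subset hτ hl
  refine ⟨Quot.mk _ (⟨l, hlK.1, hlK.2.1, hlK.2.2, ⟨τ, hτ, h1, mem_closedSimplex_supp hl⟩,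
    fun h => (mem_supp.1 (h hu)) hlu⟩, ⟨1 - t, h1t.le, by linarith⟩),
    Subtype.ext (Subtype.ext (funext fun v => ?_))⟩
  refine (coneMapAux_apply x _ v).trans ?_
  simp only [l]
  field_simp
  ring

instance (L : Type) [TopologicalSpace L] [CompactSpace L] : CompactSpace (Cone L) :=
  inferInstanceAs (CompactSpace (Quot _))

/-- The closed star of a point is a cone. -/
lemma nonempty_star_homeomorph (x : K.Space) (hne : Nonempty (K.starBoundary (supp x.1)).Space) :
    Nonempty (star x ≃ₜ Cone (K.starBoundary (supp x.1)).Space) :=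
  ⟨((continuous_coneMap x).homeoOfEquivCompactToT2 (f := Equiv.ofBijective _
    ⟨coneMap_injective x, coneMap_surjective x hne⟩)).symm⟩

/-- The realization of a vertex. -/
def vertex (v : V) (hv : {v} ∈ K.faces) : K.Space := by
  classical
  refine ⟨Pi.single v 1, closedSimplex_subset hv ⟨fun u => ?_, by simp, fun u hu => ?_⟩⟩
  · by_cases h : u = v
    · subst h; simp
    · simp [h]
  · simp only [Finset.mem_singleton] at hu
    simp [hu]

lemma vertex_apply_self (v : V) (hv : {v} ∈ K.faces) : (vertex v hv).1 v = 1 := by simp [vertex]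

lemma vertex_apply_of_ne (v : V) (hv : {v} ∈ K.faces) {u : V} (h : u ≠ v) :
    (vertex v hv).1 u = 0 := by simp [vertex, h]

lemma supp_vertex (v : V) (hv : {v} ∈ K.faces) : supp (vertex v hv).1 = {v} := by
  ext u
  by_cases h : u = v
  · subst h; simp [vertex_apply_self]
  · simp [vertex_apply_of_ne v hv h, h]

omit [Fintype V] in
lemma singleton_mem_faces {s : Finset V} (hs : s ∈ K.faces) {v : V} (hv : v ∈ s) :
    {v} ∈ K.faces :=
  K.mem_of_subset s hs _ (Finset.singleton_subset_iff.2 hv) (Finset.singleton_nonempty v)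

/-- Faces in the boundary of the star are proper faces of faces with at most three vertices, so this
boundary is a graph. Purity is used to make it nonempty, since the cone over the empty space is
empty. -/
lemma exists_cone_nhd (hcard : ∀ s ∈ K.faces, s.card ≤ 3)
    (hpure : ∀ s ∈ K.faces, ∃ t ∈ K.faces, s ⊆ t ∧ t.card = 3) (x : K.Space) :
    ∃ N ∈ 𝓝 x, ∃ (L : Type) (_ : TopologicalSpace L), IsFiniteGraph L ∧ Nonempty (N ≃ₜ Cone L) := by
  classical
  refine ⟨star x, star_mem_nhds x, (K.starBoundary (supp x.1)).Space, inferInstance,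
    isFiniteGraph_space _ ?_, nonempty_star_homeomorph x ?_⟩
  · rintro ρ ⟨-, ⟨τ, hτ, h1, h2⟩, h3⟩
    have hne : ρ ≠ τ := fun h => h3 (h ▸ h1)
    have := Finset.card_lt_card (h2.ssubset_of_ne hne)
    have := hcard τ hτ
    omega
  · obtain ⟨τ, hτ, h1, h2⟩ := hpure _ x.supp_mem
    obtain ⟨u, hu⟩ := x.exists_mem_supp
    obtain ⟨v, hv, huv⟩ : ∃ v ∈ τ, v ≠ u := by
      by_contra! h
      have : τ ⊆ {u} := fun v hv => Finset.mem_singleton.2 (h v hv)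
      have := Finset.card_le_card this
      rw [Finset.card_singleton] at this
      omega
    exact ⟨vertex v ⟨singleton_mem_faces hτ hv,
      ⟨τ, hτ, h1, Finset.singleton_subset_iff.2 hv⟩,
      fun h => huv (Finset.mem_singleton.1 (h hu)).symm⟩⟩

end VertexComplex

/-! ### Points that are not on the boundary of a half-plane -/

/-- The point with angle `2πt` on the circle of radius `ε`. -/
def circlePoint (ε t : ℝ) : ℂ :=
  ε * (Real.cos (2 * Real.pi * t) + Real.sin (2 * Real.pi * t) * Complex.I)

lemma continuous_circlePoint : Continuous fun p : ℝ × ℝ => circlePoint p.1 p.2 := by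
  unfold circlePoint; fun_prop

lemma norm_circlePoint {ε : ℝ} (hε : 0 ≤ ε) (t : ℝ) : ‖circlePoint ε t‖ = ε := by
  rw [circlePoint, norm_mul, Complex.norm_real, Real.norm_of_nonneg hε, Complex.ofReal_cos,
    Complex.ofReal_sin, ← Complex.exp_mul_I,
    Complex.norm_exp_ofReal_mul_I, mul_one]

lemma circlePoint_zero (ε : ℝ) : circlePoint ε 0 = ε := by simp [circlePoint]

lemma circlePoint_one (ε : ℝ) : circlePoint ε 1 = ε := by simp [circlePoint]

lemma circlePoint_add_half (ε t : ℝ) : circlePoint ε (t + 1 / 2) = -circlePoint ε t := by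
  have : 2 * Real.pi * (t + 1 / 2) = 2 * Real.pi * t + Real.pi := by ring
  rw [circlePoint, this, Real.cos_add_pi, Real.sin_add_pi, circlePoint]
  push_cast
  ring

lemma arg_circlePoint {ε : ℝ} (hε : 0 < ε) (t : ℝ) :
    (Complex.arg (circlePoint ε t) : Real.Angle) = ((2 * Real.pi * t : ℝ) : Real.Angle) := by
  have := Complex.arg_mul_cos_add_sin_mul_I_coe_angle hε ((2 * Real.pi * t : ℝ) : Real.Angle)
  rwa [Real.Angle.cos_coe, Real.Angle.sin_coe] at this

/-- A circle around the origin is not null-homotopic in the punctured plane. -/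
lemma not_nullhomotopic_circlePoint {ε : ℝ} (hε : 0 < ε) (F : C(I × I, ℂ)) (hF : ∀ p, F p ≠ 0)
    (h0 : ∀ t : I, F (0, t) = circlePoint ε t) (h1 : ∀ t, F (1, t) = F (1, 0))
    (hloop : ∀ s, F (s, 0) = F (s, 1)) : False := by
  let cov : IsCoveringMap ((↑) : ℝ → Real.Angle) := AddCircle.isCoveringMap_coe (2 * Real.pi)
  -- The argument of `F` is lifted to the line. The two ends of the lifted loop differ by `2π` at
  -- time 0, hence at all times, whereas a constant loop has equal ends.
  let H : C(I × I, Real.Angle) := ⟨fun p => (Complex.arg (F p) : Real.Angle),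
    continuous_iff_continuousAt.2 fun p =>
      (Complex.continuousAt_arg_coe_angle (hF p)).comp F.continuous.continuousAt⟩
  let f : C(I, ℝ) := ⟨fun t => 2 * Real.pi * t, by fun_prop⟩
  have H0 : ∀ t, H (0, t) = ((f t : ℝ) : Real.Angle) := fun t => by
    change (Complex.arg (F (0, t)) : Real.Angle) = _
    rw [h0, arg_circlePoint hε]; rfl
  let L := cov.liftHomotopy H f H0
  have hL : ∀ p, ((L p : ℝ) : Real.Angle) = H p := fun p =>
    congrFun (cov.liftHomotopy_lifts H f H0) p
  have hL0 : ∀ t, L (0, t) = f t := cov.liftHomotopy_zero H f H0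
  have e1 : L (1, 1) = L (1, 0) := by
    refine cov.const_of_comp (g := fun t : I => L (1, t)) (by fun_prop) (fun a a' => ?_) 1 0
    rw [hL, hL]
    change (Complex.arg (F (1, a)) : Real.Angle) = (Complex.arg (F (1, a')) : Real.Angle)
    rw [h1 a, h1 a']
  have e2 : (fun s : I => L (s, 1)) = fun s : I => L (s, 0) + 2 * Real.pi := by
    refine cov.eq_of_comp_eq (by fun_prop) (by fun_prop) ?_ 0 ?_
    · funext s
      simp only [Function.comp_apply, Real.Angle.coe_add, Real.Angle.coe_two_pi, add_zero, hL]
      change (Complex.arg (F (s, 1)) : Real.Angle) = (Complex.arg (F (s, 0)) : Real.Angle)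
      rw [hloop]
    · rw [hL0, hL0]
      change 2 * Real.pi * ((1 : I) : ℝ) = 2 * Real.pi * ((0 : I) : ℝ) + _
      simp
  have e3 := congrFun e2 1
  simp only [e1] at e3
  linarith [Real.pi_pos]

/-- There is a neighbourhood of `z` that retracts to a disc around `z`. -/
structure DiscRetract {Y : Type*} [TopologicalSpace Y] (z : Y) where
  nhd : Set Y
  isOpen_nhd : IsOpen nhd
  mem_nhd : z ∈ nhd
  retract : Y → ℂ
  continuous_retract : Continuous retract
  eq_of_retract_eq_zero : ∀ y ∈ nhd, retract y = 0 → y = z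
  disc : ℂ → Y
  continuous_disc : Continuous disc
  disc_zero : disc 0 = z
  radius : ℝ
  radius_pos : 0 < radius
  retract_disc : ∀ c, ‖c‖ ≤ radius → retract (disc c) = c

namespace DiscRetract

variable {Y : Type*} [TopologicalSpace Y] {z : Y} (D : DiscRetract z)

include D in
/-- A point with a neighbourhood that retracts to a disc around it is not a boundary point of an
open half-plane. -/
lemma snd_ne_zero {U : Set Y} (hU : IsOpen U) (hz : z ∈ U) (e : U ≃ₜ ℝ × Ici (0 : ℝ)) :
    ((e ⟨z, hz⟩).2 : ℝ) ≠ 0 := by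
  intro hez
  set q₀ := e ⟨z, hz⟩ with hq₀
  -- Replacing the second coordinate by its maximum with 0 extends the inverse chart to the whole
  -- plane, so no half-plane conditions appear in the homotopy below.
  let E : ℝ × ℝ → Y := fun q => (e.symm (q.1, ⟨max q.2 0, mem_Ici.2 (le_max_right _ _)⟩) : U)
  have hE : Continuous E := by
    refine continuous_subtype_val.comp (e.symm.continuous.comp ?_)
    exact continuous_fst.prodMk (Continuous.subtype_mk (by fun_prop) _)
  have hEz : E (q₀.1, 0) = z := by
    have : (q₀.1, (⟨max 0 0, mem_Ici.2 (le_max_right _ _)⟩ : Ici (0 : ℝ))) = q₀ :=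
      Prod.ext rfl (Subtype.ext (by simp [hez]))
    simp only [E, this]
    rw [hq₀, e.symm_apply_apply]
  have hinj : ∀ a b : ℝ, 0 ≤ b → E (a, b) = z → b = 0 := by
    intro a b hb h
    have h1 : e.symm (a, ⟨max b 0, mem_Ici.2 (le_max_right _ _)⟩) = ⟨z, hz⟩ := Subtype.ext h
    have h2 := congrArg (fun u => ((e u).2 : ℝ)) h1
    simp only [e.apply_symm_apply] at h2
    rw [max_eq_left hb] at h2
    rw [h2]; exact hez
  obtain ⟨δ, hδ, hball⟩ := Metric.isOpen_iff.1 (D.isOpen_nhd.preimage hE) (q₀.1, 0)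
    (by rw [mem_preimage, hEz]; exact D.mem_nhd)
  let e' : Y → ℝ × ℝ := by
    classical exact fun y => if h : y ∈ U then ((e ⟨y, h⟩).1, ((e ⟨y, h⟩).2 : ℝ)) else 0
  have he'_of : ∀ y (h : y ∈ U), e' y = ((e ⟨y, h⟩).1, ((e ⟨y, h⟩).2 : ℝ)) := fun y h => by
    simp [e', h]
  have he' : ContinuousOn e' U := by
    rw [continuousOn_iff_continuous_domRestrict]
    have : U.domRestrict e' = fun y => ((e y).1, ((e y).2 : ℝ)) := funext fun y => he'_of y y.2
    rw [this]
    fun_prop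
  have hEe' : ∀ y ∈ U, E (e' y) = y := fun y hy => by
    rw [he'_of y hy]
    have : (((e ⟨y, hy⟩).1, ⟨max ((e ⟨y, hy⟩).2 : ℝ) 0,
      mem_Ici.2 (le_max_right _ _)⟩) : ℝ × Ici (0 : ℝ)) =
      e ⟨y, hy⟩ := Prod.ext rfl (Subtype.ext (max_eq_left (e ⟨y, hy⟩).2.2))
    simp only [E, this, e.symm_apply_apply]
  have he'z : e' z = (q₀.1, 0) := by rw [he'_of z hz, ← hq₀, hez]
  have hcont : ContinuousAt (fun c => e' (D.disc c)) 0 :=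
    ContinuousAt.comp (g := e') (f := D.disc) (by rw [D.disc_zero]; exact he'.continuousAt (hU.mem_nhds hz))
      D.continuous_disc.continuousAt
  have hev : ∀ᶠ c in 𝓝 (0 : ℂ), D.disc c ∈ U ∧ e' (D.disc c) ∈ Metric.ball (q₀.1, (0 : ℝ)) δ := by
    refine Filter.Eventually.and ?_ ?_
    · exact D.continuous_disc.continuousAt.eventually_mem (by rw [D.disc_zero]; exact hU.mem_nhds hz)
    · exact hcont.eventually_mem (by rw [D.disc_zero, he'z]; exact Metric.ball_mem_nhds _ hδ)
  obtain ⟨η, hη, hsmall⟩ := Metric.eventually_nhds_iff_ball.1 hev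
  set ε := min (η / 2) D.radius
  have hε : 0 < ε := lt_min (half_pos hη) D.radius_pos
  have hcirc : ∀ t, circlePoint ε t ∈ Metric.ball (0 : ℂ) η := fun t => by
    rw [mem_ball_zero_iff, norm_circlePoint hε.le]
    exact (min_le_left _ _).trans_lt (half_lt_self hη)
  let ℓ : I → ℝ × ℝ := fun t => e' (D.disc (circlePoint ε t))
  have hℓ : Continuous ℓ := by
    refine he'.comp_continuous (D.continuous_disc.comp ?_) fun t => (hsmall _ (hcirc t)).1
    exact continuous_circlePoint.comp (f := fun t : I => (ε, (t : ℝ))) (by fun_prop)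
  -- A small circle around `z` is read in the half-plane chart and contracted linearly to a point
  -- off the boundary line, inside a ball whose image stays in `D.nhd`.
  let H : I × I → ℝ × ℝ := fun p => (1 - (p.1 : ℝ)) • ℓ p.2 + (p.1 : ℝ) • (q₀.1, δ / 2)
  have hH : Continuous H := by fun_prop
  have hmid : ((q₀.1, δ / 2) : ℝ × ℝ) ∈ Metric.ball (q₀.1, (0 : ℝ)) δ := by
    rw [Metric.mem_ball, Prod.dist_eq]
    simp [abs_of_pos hδ, hδ]
  have hHball : ∀ p, H p ∈ Metric.ball (q₀.1, (0 : ℝ)) δ := fun p =>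
    convex_ball _ _ (hsmall _ (hcirc _)).2 hmid (by linarith [p.1.2.2]) p.1.2.1 (by ring)
  have hnonneg : ∀ t, 0 ≤ (ℓ t).2 := fun t => by
    simp only [ℓ]
    rw [he'_of _ (hsmall _ (hcirc t)).1]
    exact (e ⟨_, _⟩).2.2
  have hH2 : ∀ p, (H p).2 = (1 - (p.1 : ℝ)) * (ℓ p.2).2 + p.1 * (δ / 2) := fun p => rfl
  have hℓret : ∀ t : I, D.retract (E (ℓ t)) = circlePoint ε t := fun t => by
    simp only [ℓ]
    rw [hEe' _ (hsmall _ (hcirc t)).1]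
    exact D.retract_disc _ ((norm_circlePoint hε.le _).le.trans (min_le_right _ _))
  have hℓ10 : ℓ 0 = ℓ 1 := by simp [ℓ, circlePoint_zero, circlePoint_one]
  refine not_nullhomotopic_circlePoint hε ⟨fun p => D.retract (E (H p)),
    D.continuous_retract.comp (hE.comp hH)⟩ ?_ ?_ ?_ ?_
  -- The contraction meets `z` at no positive time, because the second coordinate is then positive;
  -- at time 0 the retraction gives a point of the circle, which is not 0.
  · rintro p h
    have h1 : E (H p) = z := D.eq_of_retract_eq_zero _ (hball (hHball p)) h
    have h2 : 0 ≤ (1 - (p.1 : ℝ)) * (ℓ p.2).2 := mul_nonneg (by linarith [p.1.2.2]) (hnonneg _)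
    have h3 : 0 ≤ (p.1 : ℝ) * (δ / 2) := mul_nonneg p.1.2.1 (by linarith)
    have h4 := hinj (H p).1 (H p).2 (by rw [hH2]; linarith) h1
    rw [hH2] at h4
    have h5 : (p.1 : ℝ) = 0 := by
      have : (p.1 : ℝ) * (δ / 2) = 0 := by linarith
      rcases mul_eq_zero.1 this with h | h
      · exact h
      · linarith
    have h6 : H p = ℓ p.2 := by simp [H, h5]
    have h7 := hℓret p.2
    rw [← h6] at h7
    change D.retract (E (H p)) = 0 at h
    rw [h7] at h
    have := norm_circlePoint hε.le (p.2 : ℝ)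
    rw [h, norm_zero] at this
    exact hε.ne this
  · intro t
    have : H (0, t) = ℓ t := by simp [H]
    change D.retract (E (H (0, t))) = _
    rw [this, hℓret]
  · intro t
    have : ∀ t, H (1, t) = (q₀.1, δ / 2) := fun t => by simp [H]
    change D.retract (E (H (1, t))) = D.retract (E (H (1, 0)))
    rw [this, this]
  · intro s
    change D.retract (E (H (s, 0))) = D.retract (E (H (s, 1)))
    simp only [H, hℓ10]

include D in
/-- A point with a neighbourhood that retracts to a disc around it has no open neighbourhood
homeomorphic to the line. -/
lemma not_homeomorph_real {U : Set Y} (hU : IsOpen U) (hz : z ∈ U) (e : U ≃ₜ ℝ) : False := by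
  let e' : Y → ℝ := by
    classical exact fun y => if h : y ∈ U then e ⟨y, h⟩ else 0
  have he'_of : ∀ y (h : y ∈ U), e' y = e ⟨y, h⟩ := fun y h => by simp [e', h]
  have he' : ContinuousOn e' U := by
    rw [continuousOn_iff_continuous_domRestrict]
    have : U.domRestrict e' = fun y => e y := funext fun y => he'_of y y.2
    rw [this]
    fun_prop
  have hev : ∀ᶠ c in 𝓝 (0 : ℂ), D.disc c ∈ U :=
    D.continuous_disc.continuousAt.eventually_mem (by rw [D.disc_zero]; exact hU.mem_nhds hz)
  obtain ⟨η, hη, hsmall⟩ := Metric.eventually_nhds_iff_ball.1 hev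
  set ε := min (η / 2) D.radius
  have hε : 0 < ε := lt_min (half_pos hη) D.radius_pos
  have hcirc : ∀ t, D.disc (circlePoint ε t) ∈ U := fun t => hsmall _ <| by
    rw [mem_ball_zero_iff, norm_circlePoint hε.le]
    exact (min_le_left _ _).trans_lt (half_lt_self hη)
  let f : ℝ → ℝ := fun t => e' (D.disc (circlePoint ε t))
  have hf : Continuous f := by
    refine he'.comp_continuous (D.continuous_disc.comp ?_) hcirc
    exact continuous_circlePoint.comp (f := fun t : ℝ => (ε, t)) (by fun_prop)
  -- One-dimensional Borsuk-Ulam: `g` changes sign over half a turn, so two antipodal points of a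
  -- small circle would have the same image on the line, although the disc is embedded.
  let g : ℝ → ℝ := fun t => f (t + 1 / 2) - f t
  have hg : Continuous g := by fun_prop
  have h1 : f (0 + 1 / 2 + 1 / 2) = f 0 := by
    simp only [f, circlePoint_add_half, neg_neg]
  have hsum : g (0 + 1 / 2) = - g 0 := by simp only [g, h1]; ring
  obtain ⟨t, ht⟩ : ∃ t, g t = 0 := by
    rcases le_total (g 0) 0 with h | h
    · obtain ⟨t, -, ht⟩ := intermediate_value_uIcc (a := (0 : ℝ)) (b := 0 + 1 / 2) hg.continuousOn
        (Set.mem_uIcc.2 (Or.inl ⟨h, by linarith⟩))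
      exact ⟨t, ht⟩
    · obtain ⟨t, -, ht⟩ := intermediate_value_uIcc (a := (0 : ℝ)) (b := 0 + 1 / 2) hg.continuousOn
        (Set.mem_uIcc.2 (Or.inr ⟨by linarith, h⟩))
      exact ⟨t, ht⟩
  have h2 : f (t + 1 / 2) = f t := sub_eq_zero.1 ht
  simp only [f] at h2
  rw [he'_of _ (hcirc _), he'_of _ (hcirc _)] at h2
  have h3 := congrArg (fun y : U => D.retract y) (e.injective h2)
  simp only at h3
  rw [D.retract_disc _ ((norm_circlePoint hε.le _).le.trans (min_le_right _ _)),
    D.retract_disc _ ((norm_circlePoint hε.le _).le.trans (min_le_right _ _)),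
    circlePoint_add_half] at h3
  have h4 : circlePoint ε t = 0 := by
    have : (2 : ℂ) * circlePoint ε t = 0 := by linear_combination -h3
    simpa using this
  have := norm_circlePoint hε.le t
  rw [h4, norm_zero] at this
  exact hε.ne this

end DiscRetract

/-- A space has no boundary if, up to finitely many exceptions, every point has a neighbourhood
that retracts to a disc. -/
lemma twoBoundary_eq_empty {Y : Type*} [TopologicalSpace Y]
    (h : {z : Y | IsEmpty (DiscRetract z)}.Finite) : twoBoundary Y = ∅ := by
  rw [twoBoundary, closure_empty_iff, eq_empty_iff_forall_notMem]
  rintro x ⟨hx, U, hU, hxU, ⟨⟨e⟩⟩ | ⟨⟨e⟩⟩⟩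
  -- A line, and likewise the boundary line of a half-plane below, has infinitely many points, so
  -- one of them avoids the finite exceptional set and carries a `DiscRetract`.
  · have hinf : (range fun t : ℝ => (e.symm t : Y)).Infinite :=
      infinite_range_of_injective (Subtype.val_injective.comp e.symm.injective)
    obtain ⟨_, ⟨t, rfl⟩, ht⟩ := (hinf.sdiff h).nonempty
    obtain ⟨D⟩ := not_isEmpty_iff.1 ht
    exact D.not_homeomorph_real hU (e.symm t).2 e
  · by_cases h0 : ((e ⟨x, hxU⟩).2 : ℝ) = 0
    · have hinf : (range fun t : ℝ => (e.symm (t, ⟨0, self_mem_Ici⟩) : Y)).Infinite := by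
        refine infinite_range_of_injective (Subtype.val_injective.comp (e.symm.injective.comp ?_))
        intro a b hab
        exact congrArg Prod.fst hab
      obtain ⟨_, ⟨t, rfl⟩, ht⟩ := (hinf.sdiff h).nonempty
      obtain ⟨D⟩ := not_isEmpty_iff.1 ht
      refine D.snd_ne_zero hU (e.symm (t, ⟨0, self_mem_Ici⟩)).2 e ?_
      simp
    -- Here `x` is off the boundary line; the open half-plane is a plane via the logarithm, so `x`
    -- would be an interior point.
    · refine hx ?_
      have hpos : 0 < ((e ⟨x, hxU⟩).2 : ℝ) := lt_of_le_of_ne (e ⟨x, hxU⟩).2.2 (Ne.symm h0)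
      let W : Set U := {y | 0 < ((e y).2 : ℝ)}
      have hW : IsOpen W := isOpen_lt continuous_const (by fun_prop)
      refine ⟨Subtype.val '' W, (hU.isOpenMap_subtype_val _ hW).mem_nhds ⟨⟨x, hxU⟩, hpos, rfl⟩,
        ⟨?_⟩⟩
      have e1 : (Subtype.val '' W : Set Y) ≃ₜ W :=
        (Homeomorph.symm (IsEmbedding.subtypeVal.homeomorphImage W))
      have hmem : ∀ q : ℝ × Ioi (0 : ℝ),
          e.symm (q.1, ⟨q.2, mem_Ici.2 (mem_Ioi.1 q.2.2).le⟩) ∈ W := fun q => by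
        change 0 < ((e (e.symm _)).2 : ℝ)
        rw [e.apply_symm_apply]; exact q.2.2
      let e2 : W ≃ₜ ℝ × Ioi (0 : ℝ) :=
        { toFun := fun y => ((e y.1).1, ⟨(e y.1).2, y.2⟩)
          invFun := fun q => ⟨_, hmem q⟩
          left_inv := fun y => by simp
          right_inv := fun q => by simp
          continuous_toFun := by fun_prop
          continuous_invFun := Continuous.subtype_mk (e.symm.continuous.comp
            (continuous_fst.prodMk (Continuous.subtype_mk (by fun_prop) _))) hmem }
      exact (e1.trans e2).trans ((Homeomorph.refl ℝ).prodCongr Real.expOrderIso.toHomeomorph.symm)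

/-! ### Disc neighbourhoods of points in a two-dimensional simplicial complex -/

namespace VertexComplex

variable {V : Type} [Fintype V] {K : VertexComplex V}

lemma Space.apply_eq_zero (z : K.Space) {v : V} (h : v ∉ supp z.1) : z.1 v = 0 := notMem_supp.1 h

lemma Space.continuous_apply (v : V) : Continuous fun z : K.Space => z.1 v :=
  (_root_.continuous_apply v).comp continuous_subtype_val

/-- The retraction of the line to `[-ε, ε]`. -/
def clip (ε x : ℝ) : ℝ := max (-ε) (min ε x)

lemma continuous_clip (ε : ℝ) : Continuous (clip ε) := by unfold clip; fun_prop

lemma abs_clip_le {ε : ℝ} (hε : 0 ≤ ε) (x : ℝ) : |clip ε x| ≤ ε :=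
  abs_le.2 ⟨le_max_left _ _, max_le (by linarith) (min_le_left _ _)⟩

lemma clip_eq {ε x : ℝ} (h : |x| ≤ ε) : clip ε x = x := by
  rw [abs_le] at h
  rw [clip, min_eq_right h.2, max_eq_right h.1]

lemma clip_zero {ε : ℝ} (hε : 0 ≤ ε) : clip ε 0 = 0 := clip_eq (by simpa using hε)

/-- A point in the interior of a triangle has a neighbourhood that is a disc. -/
lemma nonempty_discRetract_of_triangle (z : K.Space) (hcard : ∀ s ∈ K.faces, s.card ≤ 3)
    {u v a : V} (huv : u ≠ v) (hua : u ≠ a) (hva : v ≠ a)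
    (hz : ∀ w, w ∈ supp z.1 ↔ w = u ∨ w = v ∨ w = a) : Nonempty (DiscRetract z) := by
  classical
  have hs : supp z.1 = {u, v, a} := by ext w; simp [hz]
  have hpos : ∀ w, w = u ∨ w = v ∨ w = a → 0 < z.1 w := fun w hw => (z.pos_iff w).2 ((hz w).2 hw)
  have hsum3 : ∀ y : V → ℝ, ∑ w ∈ ({u, v, a} : Finset V), y w = y u + y v + y a := fun y => by
    rw [Finset.sum_insert (by simp [huv, hua]), Finset.sum_pair hva, add_assoc]
  have hzu := hpos u (by simp); have hzv := hpos v (by simp); have hza := hpos a (by simp)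
  -- The weights of `u`, `v`, `a` are shifted by `x`, `y` and `-x - y`; the third can lose twice
  -- `ε`, hence the half.
  set ε := min (min (z.1 u) (z.1 v)) (z.1 a / 2) with hεdef
  have hεu : ε ≤ z.1 u := (min_le_left _ _).trans (min_le_left _ _)
  have hεv : ε ≤ z.1 v := (min_le_left _ _).trans (min_le_right _ _)
  have hεa : ε ≤ z.1 a / 2 := min_le_right _ _
  have hε : 0 < ε := lt_min (lt_min hzu hzv) (half_pos hza)
  let d : ℝ → ℝ → V → ℝ := fun x y => Function.update (Function.update (Function.update 0
    u (z.1 u + x)) v (z.1 v + y)) a (z.1 a - x - y)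
  have hdu : ∀ x y, d x y u = z.1 u + x := fun x y => by simp [d, huv, hua]
  have hdv : ∀ x y, d x y v = z.1 v + y := fun x y => by simp [d, hva]
  have hda : ∀ x y, d x y a = z.1 a - x - y := fun x y => by simp [d]
  have hdo : ∀ x y w, ¬ (w = u ∨ w = v ∨ w = a) → d x y w = 0 := fun x y w h => by
    push Not at h; simp [d, h]
  have hz1 := z.sum_subset hs.subset
  rw [hsum3] at hz1
  have hmem : ∀ x y, |x| ≤ ε → |y| ≤ ε → d x y ∈ closedSimplex (supp z.1) := by
    intro x y hx hy
    rw [abs_le] at hx hy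
    refine ⟨fun w => ?_, ?_, fun w hw => hdo x y w fun h => hw ((hz w).2 h)⟩
    · by_cases h : w = u ∨ w = v ∨ w = a
      · rcases h with rfl | rfl | rfl
        · rw [hdu]; linarith
        · rw [hdv]; linarith
        · rw [hda]; linarith
      · rw [hdo _ _ _ h]
    · rw [← Finset.sum_subset (Finset.subset_univ {u, v, a}) fun w _ hw => hdo x y w (by simpa using hw),
        hsum3, hdu, hdv, hda]
      linarith
  have hclip : ∀ x, |clip ε x| ≤ ε := abs_clip_le hε.le
  refine ⟨{
    nhd := openStar z
    isOpen_nhd := isOpen_openStar z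
    mem_nhd := mem_openStar_self z
    retract := fun y => ((y.1 u - z.1 u : ℝ) : ℂ) + ((y.1 v - z.1 v : ℝ) : ℂ) * Complex.I
    continuous_retract := by
      have := Space.continuous_apply (K := K)
      exact (Complex.continuous_ofReal.comp ((this u).sub continuous_const)).add
        ((Complex.continuous_ofReal.comp ((this v).sub continuous_const)).mul continuous_const)
    eq_of_retract_eq_zero := ?_
    disc := fun c => ⟨d (clip ε c.re) (clip ε c.im),
      closedSimplex_subset z.supp_mem (hmem _ _ (hclip _) (hclip _))⟩
    continuous_disc := ?_
    disc_zero := ?_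
    radius := ε
    radius_pos := hε
    retract_disc := ?_ }⟩
  · intro y hy h
    have h1 : y.1 u - z.1 u = 0 := by simpa using congrArg Complex.re h
    have h2 : y.1 v - z.1 v = 0 := by simpa using congrArg Complex.im h
    -- No face properly contains a triangle, so the open star of `z` is the open triangle.
    have hsy : supp y.1 = {u, v, a} := by
      rw [← hs]
      refine (Finset.eq_of_subset_of_card_le hy ?_).symm
      have : (supp z.1).card = 3 := by rw [hs]; exact Finset.card_eq_three.2 ⟨u, v, a, huv, hua,
        hva, rfl⟩
      rw [this]; exact hcard _ y.supp_mem
    have hy1 := y.sum_subset hsy.subset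
    rw [hsum3] at hy1
    refine Subtype.ext (funext fun w => ?_)
    by_cases hw : w = u ∨ w = v ∨ w = a
    · rcases hw with rfl | rfl | rfl <;> linarith
    · have e1 : w ∉ supp y.1 := by rw [hsy]; simpa using hw
      have e2 : w ∉ supp z.1 := by rw [hs]; simpa using hw
      rw [notMem_supp.1 e1, notMem_supp.1 e2]
  · refine Continuous.subtype_mk (continuous_pi fun w => ?_) _
    have hcr : Continuous fun c : ℂ => clip ε c.re := (continuous_clip ε).comp Complex.continuous_re
    have hci : Continuous fun c : ℂ => clip ε c.im := (continuous_clip ε).comp Complex.continuous_im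
    by_cases hw : w = u ∨ w = v ∨ w = a
    · rcases hw with rfl | rfl | rfl
      · simp only [hdu]; fun_prop
      · simp only [hdv]; fun_prop
      · simp only [hda]; fun_prop
    · simp only [hdo _ _ _ hw]; fun_prop
  · refine Subtype.ext (funext fun w => ?_)
    simp only [Complex.zero_re, Complex.zero_im, clip_zero hε.le]
    by_cases hw : w = u ∨ w = v ∨ w = a
    · rcases hw with rfl | rfl | rfl
      · rw [hdu]; ring
      · rw [hdv]; ring
      · rw [hda]; ring
    · rw [hdo _ _ _ hw]
      exact (notMem_supp.1 (by rw [hs]; simpa using hw)).symm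
  · intro c hc
    simp only [clip_eq ((Complex.abs_re_le_norm c).trans hc),
      clip_eq ((Complex.abs_im_le_norm c).trans hc), hdu, hdv]
    apply Complex.ext <;> simp

/-- A point in the interior of an edge that lies in two triangles has a neighbourhood that
retracts to the union of these triangles. -/
lemma nonempty_discRetract_of_edge (z : K.Space) (hcard : ∀ s ∈ K.faces, s.card ≤ 3)
    {u v a b : V} (huv : u ≠ v) (hua : u ≠ a) (hva : v ≠ a) (hub : u ≠ b) (hvb : v ≠ b)
    (hab : a ≠ b) (hz : ∀ w, w ∈ supp z.1 ↔ w = u ∨ w = v)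
    {s t : Finset V} (hs : s ∈ K.faces) (ht : t ∈ K.faces) (hus : u ∈ s) (hvs : v ∈ s) (has : a ∈ s)
    (hut : u ∈ t) (hvt : v ∈ t) (hbt : b ∈ t) : Nonempty (DiscRetract z) := by
  classical
  have hzs : supp z.1 = {u, v} := by ext w; simp [hz]
  have hzu := (z.pos_iff u).2 ((hz u).2 (by simp))
  have hzv := (z.pos_iff v).2 ((hz v).2 (by simp))
  have hz1 := z.sum_subset hzs.subset
  rw [Finset.sum_pair huv] at hz1
  have hsum4 : ∀ y : V → ℝ, ∑ w ∈ ({u, v, a, b} : Finset V), y w = y u + y v + y a + y b :=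
    fun y => by
      rw [Finset.sum_insert (by simp [huv, hua, hub]), Finset.sum_insert (by simp [hva, hvb]),
        Finset.sum_pair hab]
      ring
  -- Half of each weight pays for the shift `x` along the edge, and the other half is more than
  -- enough for the proportional loss `|y|`.
  set ε := min (z.1 u) (z.1 v) / 2 with hεdef
  have hεu : 2 * ε ≤ z.1 u := by rw [hεdef]; linarith [min_le_left (z.1 u) (z.1 v)]
  have hεv : 2 * ε ≤ z.1 v := by rw [hεdef]; linarith [min_le_right (z.1 u) (z.1 v)]
  have hε : 0 < ε := half_pos (lt_min hzu hzv)
  -- The coordinate `x` moves along the edge, and `y` moves towards `a` if positive and towards `b`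
  -- if negative. The mass `|y|` is taken from `u` and `v` in the ratio of their weights in `z`, so
  -- it does not affect the real part of the retraction.
  let d : ℝ → ℝ → V → ℝ := fun x y => Function.update (Function.update (Function.update
    (Function.update 0 u (z.1 u + x - |y| * z.1 u)) v (z.1 v - x - |y| * z.1 v)) a (max y 0))
    b (max (-y) 0)
  have hdu : ∀ x y, d x y u = z.1 u + x - |y| * z.1 u := fun x y => by simp [d, huv, hua, hub]
  have hdv : ∀ x y, d x y v = z.1 v - x - |y| * z.1 v := fun x y => by simp [d, hva, hvb]
  have hda : ∀ x y, d x y a = max y 0 := fun x y => by simp [d, hab]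
  have hdb : ∀ x y, d x y b = max (-y) 0 := fun x y => by simp [d]
  have hdo : ∀ x y w, ¬ (w = u ∨ w = v ∨ w = a ∨ w = b) → d x y w = 0 := fun x y w h => by
    push Not at h; simp [d, h]
  have hcases : ∀ y : ℝ, (0 ≤ y ∧ |y| = y ∧ max y 0 = y ∧ max (-y) 0 = 0) ∨
      (y ≤ 0 ∧ |y| = -y ∧ max y 0 = 0 ∧ max (-y) 0 = -y) := fun y => by
    rcases le_total 0 y with h | h
    · exact Or.inl ⟨h, abs_of_nonneg h, max_eq_left h, max_eq_right (by linarith)⟩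
    · exact Or.inr ⟨h, abs_of_nonpos h, max_eq_right h, max_eq_left (by linarith)⟩
  have hmem : ∀ x y, |x| ≤ ε → |y| ≤ ε → d x y ∈ K.points := by
    intro x y hx hy
    rw [abs_le] at hx
    have h1 : |y| * z.1 u ≤ 1 / 2 * z.1 u :=
      mul_le_mul_of_nonneg_right (by linarith) hzu.le
    have h2 : |y| * z.1 v ≤ 1 / 2 * z.1 v :=
      mul_le_mul_of_nonneg_right (by linarith) hzv.le
    have hnn : ∀ w, 0 ≤ d x y w := fun w => by
      by_cases h : w = u ∨ w = v ∨ w = a ∨ w = b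
      · rcases h with rfl | rfl | rfl | rfl
        · rw [hdu]; linarith
        · rw [hdv]; linarith
        · rw [hda]; exact le_max_right _ _
        · rw [hdb]; exact le_max_right _ _
      · rw [hdo _ _ _ h]
    have hsum : ∑ w, d x y w = 1 := by
      rw [← Finset.sum_subset (Finset.subset_univ {u, v, a, b})
        fun w _ hw => hdo x y w (by simpa using hw), hsum4, hdu, hdv, hda, hdb]
      rcases hcases y with ⟨-, h1, h2, h3⟩ | ⟨-, h1, h2, h3⟩ <;> rw [h1, h2, h3]
      · linear_combination (1 - y) * hz1
      · linear_combination (1 + y) * hz1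
    rcases hcases y with ⟨-, -, -, h⟩ | ⟨-, -, h, -⟩
    · refine closedSimplex_subset hs ⟨hnn, hsum, fun w hw => ?_⟩
      by_cases hwb : w = b
      · rw [hwb, hdb, h]
      · refine hdo _ _ _ ?_
        rintro (rfl | rfl | rfl | rfl)
        exacts [hw hus, hw hvs, hw has, hwb rfl]
    · refine closedSimplex_subset ht ⟨hnn, hsum, fun w hw => ?_⟩
      by_cases hwa : w = a
      · rw [hwa, hda, h]
      · refine hdo _ _ _ ?_
        rintro (rfl | rfl | rfl | rfl)
        exacts [hw hut, hw hvt, hwa rfl, hw hbt]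
  have hclip : ∀ x, |clip ε x| ≤ ε := abs_clip_le hε.le
  refine ⟨{
    nhd := openStar z
    isOpen_nhd := isOpen_openStar z
    mem_nhd := mem_openStar_self z
    -- All triangles at the edge other than the one with `a` are folded onto a single sheet: their
    -- third vertices count negatively in the imaginary part. The real part vanishes when `u` and
    -- `v` have weights in the same ratio as in `z`.
    retract := fun y => ((y.1 u * z.1 v - y.1 v * z.1 u : ℝ) : ℂ) +
      ((y.1 a - ∑ w ∈ Finset.univ \ {u, v, a}, y.1 w : ℝ) : ℂ) * Complex.I
    continuous_retract := by
      have := Space.continuous_apply (K := K)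
      exact (Complex.continuous_ofReal.comp (((this u).mul continuous_const).sub
          ((this v).mul continuous_const))).add
        ((Complex.continuous_ofReal.comp ((this a).sub
          (continuous_finsetSum _ fun w _ => this w))).mul continuous_const)
    eq_of_retract_eq_zero := ?_
    disc := fun c => ⟨d (clip ε c.re) (clip ε c.im), hmem _ _ (hclip _) (hclip _)⟩
    continuous_disc := ?_
    disc_zero := ?_
    radius := ε
    radius_pos := hε
    retract_disc := ?_ }⟩
  · intro y hy h
    have h1 : y.1 u * z.1 v - y.1 v * z.1 u = 0 := by
      have := congrArg Complex.re h
      simpa [-Complex.ofReal_sub] using this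
    have h2 : y.1 a - ∑ w ∈ Finset.univ \ {u, v, a}, y.1 w = 0 := by
      have := congrArg Complex.im h
      simpa [-Complex.ofReal_sub] using this
    have hyu : u ∈ supp y.1 := hy ((hz u).2 (by simp))
    have hyv : v ∈ supp y.1 := hy ((hz v).2 (by simp))
    -- If `a` had weight, the support would be the triangle `{u, v, a}`, so the subtracted sum would
    -- vanish and the imaginary part would be the weight of `a`.
    have hya : y.1 a = 0 := by
      by_contra h0
      have hsub : {u, v, a} ⊆ supp y.1 := by
        intro w hw
        simp only [Finset.mem_insert, Finset.mem_singleton] at hw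
        rcases hw with rfl | rfl | rfl
        exacts [hyu, hyv, mem_supp.2 h0]
      have heq : {u, v, a} = supp y.1 := Finset.eq_of_subset_of_card_le hsub (by
        rw [Finset.card_eq_three.2 ⟨u, v, a, huv, hua, hva, rfl⟩]; exact hcard _ y.supp_mem)
      refine h0 ?_
      rw [sub_eq_zero.1 h2]
      refine Finset.sum_eq_zero fun w hw => ?_
      rw [Finset.mem_sdiff, heq] at hw
      exact notMem_supp.1 hw.2
    rw [hya, zero_sub, neg_eq_zero, Finset.sum_eq_zero_iff_of_nonneg fun w _ => y.nonneg w] at h2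
    have hother : ∀ w, ¬ (w = u ∨ w = v) → y.1 w = 0 := fun w hw => by
      by_cases hwa : w = a
      · rw [hwa, hya]
      · refine h2 w ?_
        push Not at hw
        simp [hw, hwa]
    have hy1 := y.sum_eq_one
    rw [← Finset.sum_subset (Finset.subset_univ {u, v}) fun w _ hw => hother w (by simpa using hw),
      Finset.sum_pair huv] at hy1
    have hu : y.1 u = z.1 u := by linear_combination h1 + z.1 u * hy1 - y.1 u * hz1
    refine Subtype.ext (funext fun w => ?_)
    by_cases hw : w = u ∨ w = v
    · rcases hw with rfl | rfl <;> linarith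
    · rw [hother w hw, z.apply_eq_zero (by rw [hz]; exact hw)]
  · refine Continuous.subtype_mk (continuous_pi fun w => ?_) _
    have hcr : Continuous fun c : ℂ => clip ε c.re := (continuous_clip ε).comp Complex.continuous_re
    have hci : Continuous fun c : ℂ => clip ε c.im := (continuous_clip ε).comp Complex.continuous_im
    by_cases hw : w = u ∨ w = v ∨ w = a ∨ w = b
    · rcases hw with rfl | rfl | rfl | rfl
      · simp only [hdu]; fun_prop
      · simp only [hdv]; fun_prop
      · simp only [hda]; fun_prop
      · simp only [hdb]; fun_prop
    · simp only [hdo _ _ _ hw]; fun_prop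
  · refine Subtype.ext (funext fun w => ?_)
    simp only [Complex.zero_re, Complex.zero_im, clip_zero hε.le]
    by_cases hw : w = u ∨ w = v ∨ w = a ∨ w = b
    · rcases hw with rfl | rfl | rfl | rfl
      · rw [hdu]; simp
      · rw [hdv]; simp
      · rw [hda, z.apply_eq_zero (by rw [hz]; simp [hua.symm, hva.symm])]; simp
      · rw [hdb, z.apply_eq_zero (by rw [hz]; simp [hub.symm, hvb.symm])]; simp
    · rw [hdo _ _ _ hw]
      refine (notMem_supp.1 ?_).symm
      rw [hz]; tauto
  · intro c hc
    have hb : b ∈ Finset.univ \ {u, v, a} := by simp [hub.symm, hvb.symm, hab.symm]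
    simp only [clip_eq ((Complex.abs_re_le_norm c).trans hc),
      clip_eq ((Complex.abs_im_le_norm c).trans hc), hdu, hdv, hda]
    rw [Finset.sum_eq_single_of_mem b hb fun w hw hwb => hdo _ _ _ (by
      simp only [Finset.mem_sdiff, Finset.mem_univ, Finset.mem_insert, Finset.mem_singleton,
        true_and] at hw; tauto), hdb]
    have e1 : (z.1 u + c.re - |c.im| * z.1 u) * z.1 v - (z.1 v - c.re - |c.im| * z.1 v) * z.1 u =
        c.re := by linear_combination c.re * hz1
    have e2 : max c.im 0 - max (-c.im) 0 = c.im := by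
      rcases hcases c.im with ⟨-, -, h2, h3⟩ | ⟨-, -, h2, h3⟩ <;> rw [h2, h3] <;> ring
    rw [e1, e2, Complex.re_add_im]

/-- A two-dimensional complex all of whose edges lie in at least two triangles has no boundary. -/
lemma twoBoundary_space_eq_empty (hcard : ∀ s ∈ K.faces, s.card ≤ 3)
    (hedge : ∀ u v, u ≠ v → (∃ s ∈ K.faces, u ∈ s ∧ v ∈ s) → ∃ a b, a ≠ b ∧ a ≠ u ∧ a ≠ v ∧ b ≠ u ∧
      b ≠ v ∧ (∃ s ∈ K.faces, u ∈ s ∧ v ∈ s ∧ a ∈ s) ∧ ∃ s ∈ K.faces, u ∈ s ∧ v ∈ s ∧ b ∈ s) :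
    twoBoundary K.Space = ∅ := by
  classical
  refine twoBoundary_eq_empty ?_
  -- Only the finitely many vertices can be exceptional points.
  refine (finite_range fun v : {v : V // {v} ∈ K.faces} => vertex v.1 v.2).subset ?_
  intro z hz
  have hne : ¬ Nonempty (DiscRetract z) := not_nonempty_iff.2 hz
  have hc := hcard _ z.supp_mem
  have hc0 := Finset.card_pos.2 (K.nonempty_of_mem _ z.supp_mem)
  obtain h | h | h : (supp z.1).card = 1 ∨ (supp z.1).card = 2 ∨ (supp z.1).card = 3 := by omega
  · obtain ⟨v, hv⟩ := Finset.card_eq_one.1 h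
    refine ⟨⟨v, hv ▸ z.supp_mem⟩, Subtype.ext (funext fun w => ?_)⟩
    have h1 := z.sum_subset hv.subset
    rw [Finset.sum_singleton] at h1
    by_cases hw : w = v
    · rw [hw, h1, vertex_apply_self]
    · rw [vertex_apply_of_ne _ _ hw, z.apply_eq_zero (by simp [hv, hw])]
  · obtain ⟨u, v, huv, hs⟩ := Finset.card_eq_two.1 h
    obtain ⟨a, b, hab, hau, hav, hbu, hbv, ⟨s, hs1, hs2, hs3, hs4⟩, ⟨t, ht1, ht2, ht3, ht4⟩⟩ :=
      hedge u v huv ⟨_, z.supp_mem, by simp [hs], by simp [hs]⟩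
    exact (hne (nonempty_discRetract_of_edge z hcard huv hau.symm hav.symm hbu.symm hbv.symm hab
      (by simp [hs]) hs1 ht1 hs2 hs3 hs4 ht2 ht3 ht4)).elim
  · obtain ⟨u, v, a, huv, hua, hva, hs⟩ := Finset.card_eq_three.1 h
    exact (hne (nonempty_discRetract_of_triangle z hcard huv hua hva (by simp [hs]))).elim

end VertexComplex

namespace VertexComplex

variable {V : Type} [Fintype V] {K : VertexComplex V}

/-! ### Paths in a simplicial complex -/

/-- Paths with the same endpoints in a star-convex subset of the realization are homotopic. -/
lemma homotopic_of_starConvex {S : Set (V → ℝ)} {c : V → ℝ} (hS : StarConvex ℝ c S)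
    (hSK : S ⊆ K.points) {x y : K.Space} (p q : Path x y) (hp : ∀ t, (p t).1 ∈ S)
    (hq : ∀ t, (q t).1 ∈ S) : Path.Homotopic.Quotient.mk p = Path.Homotopic.Quotient.mk q := by
  have hne : S.Nonempty := ⟨_, hp 0⟩
  have := hS.contractibleSpace hne
  let j : C(S, K.Space) := ⟨fun z => ⟨z.1, hSK z.2⟩, by fun_prop⟩
  have hx : x.1 ∈ S := by simpa using hp 0
  have hy : y.1 ∈ S := by simpa using hp 1
  let lift (r : Path x y) (hr : ∀ t, (r t).1 ∈ S) : Path (⟨x.1, hx⟩ : S) ⟨y.1, hy⟩ :=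
    { toFun := fun t => ⟨(r t).1, hr t⟩
      continuous_toFun := Continuous.subtype_mk (continuous_subtype_val.comp r.continuous) _
      source' := Subtype.ext (by simp)
      target' := Subtype.ext (by simp) }
  have h := (SimplyConnectedSpace.paths_homotopic (lift p hp) (lift q hq)).map j
  exact Path.Homotopic.Quotient.eq.2 h

/-- Two points lie in a common closed simplex. -/
def Near (x y : K.Space) : Prop := ∃ s ∈ K.faces, supp x.1 ⊆ s ∧ supp y.1 ⊆ s

/-- The straight path between two points of a closed simplex. -/
def line {x y : K.Space} (h : Near x y) : Path x y where
  toFun t := ⟨(1 - (t : ℝ)) • x.1 + (t : ℝ) • y.1,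
    lineMap_mem_points h.choose_spec.1 h.choose_spec.2.1 h.choose_spec.2.2 t⟩
  continuous_toFun := Continuous.subtype_mk (by fun_prop) _
  source' := Subtype.ext (by simp)
  target' := Subtype.ext (by simp)

lemma line_apply {x y : K.Space} (h : Near x y) (t : I) :
    (line h t).1 = (1 - (t : ℝ)) • x.1 + (t : ℝ) • y.1 := rfl

lemma line_mem {x y : K.Space} (h : Near x y) {S : Set (V → ℝ)} (hS : Convex ℝ S) (hx : x.1 ∈ S)
    (hy : y.1 ∈ S) (t : I) : (line h t).1 ∈ S :=
  hS hx hy (by linarith [t.2.2]) t.2.1 (by ring)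

/-- The homotopy class of the straight path between two points of a closed simplex. -/
def seg {x y : K.Space} (h : Near x y) : Path.Homotopic.Quotient x y := .mk (line h)

lemma seg_self {x : K.Space} (h : Near x x) : seg h = .refl x := by
  rw [seg, ← Path.Homotopic.Quotient.mk_refl]
  congr 1
  refine Path.ext (funext fun t => Subtype.ext ?_)
  rw [line_apply, ← add_smul]
  simp

/-- Both paths stay in one closed simplex, which is convex. This is the relation contributed by a
triangle to the edge-path group. -/
lemma seg_trans_seg {x y z : K.Space} {s : Finset V} (hs : s ∈ K.faces) (hx : supp x.1 ⊆ s)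
    (hy : supp y.1 ⊆ s) (hz : supp z.1 ⊆ s) (hxy : Near x y) (hyz : Near y z) (hxz : Near x z) :
    (seg hxy).trans (seg hyz) = seg hxz := by
  have hc := convex_closedSimplex s
  have hx' := x.mem_closedSimplex hx
  have hy' := y.mem_closedSimplex hy
  have hz' := z.mem_closedSimplex hz
  rw [seg, seg, seg, ← Path.Homotopic.Quotient.mk_trans]
  refine homotopic_of_starConvex (hc hx') (closedSimplex_subset hs) _ _ (fun t => ?_)
    (line_mem _ hc hx' hz')
  rw [Path.trans_apply]
  split_ifs
  · exact line_mem _ hc hx' hy' _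
  · exact line_mem _ hc hy' hz' _

variable (hV : ∀ v, {v} ∈ K.faces)

include hV in
lemma near_vertex {x : K.Space} {v : V} (h : v ∈ supp x.1) : Near x (vertex v (hV v)) :=
  ⟨_, x.supp_mem, subset_rfl, by rw [supp_vertex]; exact Finset.singleton_subset_iff.2 h⟩

lemma Near.symm {x y : K.Space} (h : Near x y) : Near y x := by
  obtain ⟨s, hs, h1, h2⟩ := h
  exact ⟨s, hs, h2, h1⟩

/-- A path in the open star of a vertex is homotopic to a path through this vertex. -/
lemma mk_eq_seg_trans_seg {v : V} {x y : K.Space} (p : Path x y) (hp : ∀ t, 0 < (p t).1 v)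
    (hx : Near x (vertex v (hV v))) (hy : Near (vertex v (hV v)) y) :
    Path.Homotopic.Quotient.mk p = (seg hx).trans (seg hy) := by
  rw [seg, seg, ← Path.Homotopic.Quotient.mk_trans]
  have hvv : (vertex v (hV v)).1 v = 1 := vertex_apply_self v _
  have hx0 : 0 < x.1 v := by simpa using hp 0
  have hy0 : 0 < y.1 v := by simpa using hp 1
  have hpos : ∀ a b : ℝ, ∀ z w : V → ℝ, 0 < z v → 0 < w v → 0 ≤ a → 0 ≤ b → a + b = 1 →
      0 < (a • z + b • w) v := fun a b z w hz hw ha hb hab => by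
    simp only [Pi.add_apply, Pi.smul_apply, smul_eq_mul]
    rcases ha.eq_or_lt with rfl | ha
    · have : b = 1 := by linarith
      simp [this, hw]
    · have := mul_nonneg hb hw.le
      have := mul_pos ha hz
      linarith
  -- The points with positive weight at `v` are star-convex about `v`: the segment from such a point
  -- to `v` stays in its closed supporting face.
  refine homotopic_of_starConvex (c := (vertex v (hV v)).1) (S := K.points ∩ {w | 0 < w v}) ?_
    inter_subset_left _ _ (fun t => ⟨(p t).2, hp t⟩) fun t => ⟨Subtype.mem _, ?_⟩
  · rintro w ⟨hw, hwv⟩ a b ha hb hab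
    let w' : K.Space := ⟨w, hw⟩
    refine ⟨closedSimplex_subset w'.supp_mem (convex_closedSimplex _
      (Space.mem_closedSimplex _ ?_) (w'.mem_closedSimplex subset_rfl) ha hb hab), ?_⟩
    · rw [supp_vertex]
      exact Finset.singleton_subset_iff.2 ((w'.pos_iff v).1 hwv)
    · exact hpos a b _ _ (by rw [hvv]; exact one_pos) hwv ha hb hab
  · rw [Path.trans_apply]
    split_ifs
    · exact hpos _ _ _ _ hx0 (by rw [hvv]; exact one_pos) (by simp only [sub_nonneg]; linarith)
        (by have := unitInterval.nonneg t; simp only; linarith) (by ring)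
    · refine hpos _ _ _ _ (by rw [hvv]; exact one_pos) hy0 ?_ ?_ (by ring)
      · have := unitInterval.le_one t
        simp only [sub_nonneg]; linarith
      · simp only; linarith

lemma cast_trans {X : Type*} [TopologicalSpace X] {x x' y z : X} (h : x' = x)
    (q : Path.Homotopic.Quotient x y) (r : Path.Homotopic.Quotient y z) :
    (q.cast h rfl).trans r = (q.trans r).cast h rfl := by
  subst h; simp

lemma cast_trans_seg {x y z : K.Space} (q : Path.Homotopic.Quotient x y) (h : z = y)
    (hn : Near z y) : (q.cast rfl h).trans (seg hn) = q := by
  subst h; rw [seg_self]; simp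

/-! #### Edge paths -/

variable (K) in
/-- Two vertices lie in a common face. -/
def Adj (u v : V) : Prop := ∃ s ∈ K.faces, u ∈ s ∧ v ∈ s

lemma Adj.near {u v : V} (h : K.Adj u v) : Near (vertex u (hV u)) (vertex v (hV v)) := by
  obtain ⟨s, hs, hu, hv⟩ := h
  exact ⟨s, hs, by simpa [supp_vertex] using hu, by simpa [supp_vertex] using hv⟩

/-- The class `q` is represented by an edge path with gain `a`. -/
inductive IsEdgeWalk {G : Type} [Group G] (g : V → V → G) (v₀ : V) : ∀ v,
    Path.Homotopic.Quotient (vertex v₀ (hV v₀)) (vertex v (hV v)) → G → Prop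
  | nil : IsEdgeWalk g v₀ v₀ (.refl _) 1
  | cons {u v : V} {q : Path.Homotopic.Quotient (vertex v₀ (hV v₀)) (vertex u (hV u))} {a : G} :
      IsEdgeWalk g v₀ u q a → ∀ h : K.Adj u v,
        IsEdgeWalk g v₀ v (q.trans (seg (h.near hV))) (a * g u v)

/-- Every path between vertices is homotopic to an edge path. -/
lemma exists_isEdgeWalk {G : Type} [Group G] (g : V → V → G) (v₀ v₁ : V)
    (q : Path.Homotopic.Quotient (vertex v₀ (hV v₀)) (vertex v₁ (hV v₁))) :
    ∃ a, IsEdgeWalk hV g v₀ v₁ q a := by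
  obtain ⟨γ, rfl⟩ := Path.Homotopic.Quotient.mk_surjective q
  -- A Lebesgue subdivision for the cover by open stars of vertices. The induction connects `γ (t
  -- n)` to every vertex of its supporting face, since the next star determines which vertex is
  -- needed.
  obtain ⟨t, ht0, hmono, ⟨N, hN⟩, hcov⟩ := exists_monotone_Icc_subset_open_cover_unitInterval
    (c := fun v : V => {s : I | 0 < (γ s).1 v})
    (fun v => isOpen_lt continuous_const ((Space.continuous_apply v).comp γ.continuous))
    (fun s _ => by
      obtain ⟨v, hv⟩ := (γ s).exists_mem_supp
      exact mem_iUnion.2 ⟨v, ((γ s).pos_iff v).2 hv⟩)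
  let δ (s : I) : Path.Homotopic.Quotient (vertex v₀ (hV v₀)) (γ s) :=
    (Path.Homotopic.Quotient.mk (γ.subpath 0 s)).cast γ.source.symm rfl
  have hδ : ∀ s s', (δ s).trans (.mk (γ.subpath s s')) = δ s' := fun s s' => by
    have h := Path.Homotopic.Quotient.eq.2 ⟨Path.Homotopy.subpathTransSubpath γ 0 s s'⟩
    simp only [δ]
    rw [← h, Path.Homotopic.Quotient.mk_trans, cast_trans]
  have key : ∀ n, ∀ v (hv : v ∈ supp (γ (t n)).1),
      ∃ a, IsEdgeWalk hV g v₀ v ((δ (t n)).trans (seg (near_vertex hV hv))) a := by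
    intro n
    induction n with
    | zero =>
      intro v hv
      have hv0 : v = v₀ := by
        rw [ht0, γ.source, supp_vertex] at hv
        exact Finset.mem_singleton.1 hv
      subst hv0
      refine ⟨1, ?_⟩
      have hpt : γ (t 0) = vertex v (hV v) := by rw [ht0, γ.source]
      have h1 : δ (t 0) = (Path.Homotopic.Quotient.refl _).cast rfl hpt := by
        simp only [δ]
        rw [← Path.Homotopic.Quotient.mk_cast, ← Path.Homotopic.Quotient.mk_refl,
          ← Path.Homotopic.Quotient.mk_cast]
        congr 1
        refine Path.ext (funext fun s => ?_)
        simp [Path.subpath, ht0]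
      rw [h1, cast_trans_seg]
      exact .nil
    | succ n ih =>
      intro v hv
      -- The subpath stays in the star of `u`, so it may be routed through `u`; the step from `u` to
      -- `v` then runs inside the face that supports its end point.
      obtain ⟨u, hu⟩ := hcov n
      have hsub : ∀ s, 0 < ((γ.subpath (t n) (t (n + 1))) s).1 u := fun s => by
        have := mem_range_self (f := γ.subpath (t n) (t (n + 1))) s
        rw [Path.range_subpath_of_le _ _ _ (hmono n.le_succ)] at this
        obtain ⟨r, hr, hrs⟩ := this
        rw [← hrs]
        exact hu hr
      have hu1 : u ∈ supp (γ (t n)).1 :=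
        ((γ (t n)).pos_iff u).1 (hu ⟨le_rfl, hmono n.le_succ⟩)
      have hu2 : u ∈ supp (γ (t (n + 1))).1 :=
        ((γ (t (n + 1))).pos_iff u).1 (hu ⟨hmono n.le_succ, le_rfl⟩)
      obtain ⟨a, ha⟩ := ih u hu1
      have hadj : K.Adj u v := ⟨_, (γ (t (n + 1))).supp_mem, hu2, hv⟩
      refine ⟨a * g u v, ?_⟩
      convert! ha.cons hadj using 1
      rw [← hδ (t n) (t (n + 1)), mk_eq_seg_trans_seg hV _ hsub (near_vertex hV hu1)
        (near_vertex hV hu2).symm]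
      simp only [Path.Homotopic.Quotient.trans_assoc]
      rw [seg_trans_seg (γ (t (n + 1))).supp_mem (by simpa [supp_vertex] using hu2)
        subset_rfl (by simpa [supp_vertex] using hv) _ _ (hadj.near hV)]
  have h1 : γ (t N) = vertex v₁ (hV v₁) := by rw [hN N le_rfl, γ.target]
  obtain ⟨a, ha⟩ := key N v₁ (by rw [h1, supp_vertex]; simp)
  refine ⟨a, ?_⟩
  convert! ha using 1
  have h2 : δ (t N) = (Path.Homotopic.Quotient.mk γ).cast rfl h1 := by
    simp only [δ]
    rw [← Path.Homotopic.Quotient.mk_cast, ← Path.Homotopic.Quotient.mk_cast]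
    congr 1
    refine Path.ext (funext fun s => ?_)
    simp [Path.subpath, hN N le_rfl]
  rw [h2, cast_trans_seg]

end VertexComplex

namespace VertexComplex

variable {V : Type} [Fintype V] {K : VertexComplex V} (hV : ∀ v, {v} ∈ K.faces)

/-! ### The covering defined by a cocycle -/

variable (K) in
/-- A function on pairs of vertices is a cocycle if it is multiplicative on each face. -/
def IsCocycle {G : Type} [Group G] (g : V → V → G) : Prop :=
  ∀ s ∈ K.faces, ∀ u ∈ s, ∀ v ∈ s, ∀ w ∈ s, g u v * g v w = g u w

section Cover

variable {G : Type} [Group G] {g : V → V → G}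

omit [Fintype V] in
lemma IsCocycle.self (hg : K.IsCocycle g) {s : Finset V} (hs : s ∈ K.faces) {u : V} (hu : u ∈ s) :
    g u u = 1 := by
  have := hg s hs u hu u hu u hu
  simpa using this

variable [TopologicalSpace G] [DiscreteTopology G]

/-- The covering with fibre `G` defined by a cocycle. -/
def cover (hg : K.IsCocycle g) : FiberBundleCore V K.Space G where
  baseSet v := {x | 0 < x.1 v}
  isOpen_baseSet v := isOpen_lt continuous_const (Space.continuous_apply v)
  indexAt x := x.exists_mem_supp.choose
  mem_baseSet_at x := (x.pos_iff _).2 x.exists_mem_supp.choose_spec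
  coordChange u v _ a := a * g u v
  coordChange_self u x hx a := by
    rw [hg.self x.supp_mem ((x.pos_iff u).1 hx), mul_one]
  continuousOn_coordChange u v :=
    ((continuous_of_discreteTopology (f := fun a => a * g u v)).comp continuous_snd).continuousOn
  coordChange_comp u v w x hx a := by
    rw [mul_assoc, hg _ x.supp_mem u ((x.pos_iff u).1 hx.1.1) v ((x.pos_iff v).1 hx.1.2) w
      ((x.pos_iff w).1 hx.2)]

variable (hg : K.IsCocycle g)

lemma indexAt_mem_supp (x : K.Space) : (cover hg).indexAt x ∈ supp x.1 :=
  x.exists_mem_supp.choose_spec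

lemma indexAt_vertex (v : V) : (cover hg).indexAt (vertex v (hV v)) = v := by
  have := indexAt_mem_supp hg (vertex v (hV v))
  rwa [supp_vertex, Finset.mem_singleton] at this

lemma isCoveringMap_proj : IsCoveringMap (Bundle.TotalSpace.proj : (cover hg).TotalSpace → K.Space) :=
  FiberBundle.isCoveringMap (F := G)

/-- The straight path between adjacent vertices lifts to the covering. -/
lemma exists_lift_seg {u v : V} (h : K.Adj u v) (a : G) :
    ∃ Γ : Path.Homotopic.Quotient (⟨vertex u (hV u), a⟩ : (cover hg).TotalSpace)
      ⟨vertex v (hV v), a * g u v⟩,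
      Γ.map ⟨Bundle.TotalSpace.proj, (isCoveringMap_proj hg).continuous⟩ = seg (h.near hV) := by
  classical
  let Z := cover hg
  obtain ⟨s, hs, hu, hv⟩ := id h
  have hmem : ∀ t, (line (h.near hV) t).1 ∈ closedSimplex ({u, v} : Finset V) := by
    have h1 : {u} ⊆ ({u, v} : Finset V) := by simp
    have h2 : {v} ⊆ ({u, v} : Finset V) := by simp
    exact line_mem _ (convex_closedSimplex _)
      (Space.mem_closedSimplex _ (by rw [supp_vertex]; exact h1))
      (Space.mem_closedSimplex _ (by rw [supp_vertex]; exact h2))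
  have hidx : ∀ t, Z.indexAt (line (h.near hV) t) ∈ s := fun t => by
    have h1 := mem_closedSimplex_supp (hmem t) (indexAt_mem_supp hg (line (h.near hV) t))
    simp only [Finset.mem_insert, Finset.mem_singleton] at h1
    rcases h1 with h1 | h1
    · change (cover hg).indexAt _ ∈ s
      rw [h1]; exact hu
    · change (cover hg).indexAt _ ∈ s
      rw [h1]; exact hv
  -- In the chart of `u` the lift is constant with value `a`. A point of the total space is recorded
  -- in the chart chosen by `indexAt`, which explains the factor.
  let E : I → Z.TotalSpace := fun t => ⟨line (h.near hV) t,
    a * g u (Z.indexAt (line (h.near hV) t))⟩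
  -- By the cocycle relation the lift is constant in every chart of the face, so continuity can be
  -- checked near each parameter in a chart valid there, although `indexAt` jumps.
  have hchart : ∀ w ∈ s, ∀ t, E t = (Z.localTriv w).toOpenPartialHomeomorph.symm
      (line (h.near hV) t, a * g u w) := fun w hw t => by
    change _ = (⟨line (h.near hV) t,
      a * g u w * g w (Z.indexAt (line (h.near hV) t))⟩ : Z.TotalSpace)
    rw [mul_assoc, hg s hs u hu w hw _ (hidx t)]
  have hcont : Continuous E := by
    rw [continuous_iff_continuousAt]
    intro t
    obtain ⟨w, hw⟩ := (line (h.near hV) t).exists_mem_supp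
    have hws : w ∈ s := by
      have h1 := mem_closedSimplex_supp (hmem t) hw
      simp only [Finset.mem_insert, Finset.mem_singleton] at h1
      rcases h1 with rfl | rfl
      exacts [hu, hv]
    have hE : E = fun t => (Z.localTriv w).toOpenPartialHomeomorph.symm
      (line (h.near hV) t, a * g u w) := funext (hchart w hws)
    rw [hE]
    refine ContinuousAt.comp (g := (Z.localTriv w).toOpenPartialHomeomorph.symm)
      (f := fun t => (line (h.near hV) t, a * g u w)) ?_ (by fun_prop)
    refine (Z.localTriv w).toOpenPartialHomeomorph.symm.continuousAt ?_
    change _ ∈ (Z.localTriv w).target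
    rw [(Z.localTriv w).mem_target]
    exact ((line (h.near hV) t).pos_iff w).2 hw
  have hx0 : line (h.near hV) 0 = vertex u (hV u) := (line _).source
  have hx1 : line (h.near hV) 1 = vertex v (hV v) := (line _).target
  let P : Path (⟨vertex u (hV u), a⟩ : Z.TotalSpace) ⟨vertex v (hV v), a * g u v⟩ :=
    { toFun := E
      continuous_toFun := hcont
      source' := by
        change (⟨line (h.near hV) 0, a * g u (Z.indexAt (line (h.near hV) 0))⟩ : Z.TotalSpace) = _
        rw [hx0]
        change (⟨_, a * g u ((cover hg).indexAt _)⟩ : Z.TotalSpace) = _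
        rw [indexAt_vertex, hg.self hs hu, mul_one]
      target' := by
        change (⟨line (h.near hV) 1, a * g u (Z.indexAt (line (h.near hV) 1))⟩ : Z.TotalSpace) = _
        rw [hx1]
        change (⟨_, a * g u ((cover hg).indexAt _)⟩ : Z.TotalSpace) = _
        rw [indexAt_vertex] }
  refine ⟨.mk P, ?_⟩
  rw [← Path.Homotopic.Quotient.mk_map]
  rfl

/-- Each edge multiplies the fibre coordinate on the right by its gain. The gain of an edge path is
thus the end point of its lift starting at 1. -/
lemma exists_lift_walk {v₀ v : V} {q : Path.Homotopic.Quotient (vertex v₀ (hV v₀)) (vertex v (hV v))}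
    {a : G} (h : IsEdgeWalk hV g v₀ v q a) :
    ∃ Γ : Path.Homotopic.Quotient (⟨vertex v₀ (hV v₀), (1 : G)⟩ : (cover hg).TotalSpace)
      ⟨vertex v (hV v), a⟩,
      Γ.map ⟨Bundle.TotalSpace.proj, (isCoveringMap_proj hg).continuous⟩ = q := by
  induction h with
  | nil => exact ⟨.refl _, rfl⟩
  | @cons u v q a _ hadj ih =>
    obtain ⟨Γ, rfl⟩ := ih
    obtain ⟨Γ', hΓ'⟩ := exists_lift_seg hV hg hadj a
    refine ⟨Γ.trans Γ', ?_⟩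
    rw [← hΓ']
    obtain ⟨γ, rfl⟩ := Path.Homotopic.Quotient.mk_surjective Γ
    obtain ⟨γ', rfl⟩ := Path.Homotopic.Quotient.mk_surjective Γ'
    simp only [← Path.Homotopic.Quotient.mk_trans, ← Path.Homotopic.Quotient.mk_map]
    congr 1
    exact Path.map_trans _ _ _

end Cover

/-- The gain of an edge path only depends on its homotopy class. -/
lemma IsEdgeWalk.gain_eq {G : Type} [Group G] {g : V → V → G} (hg : K.IsCocycle g) {v₀ v : V}
    {q : Path.Homotopic.Quotient (vertex v₀ (hV v₀)) (vertex v (hV v))} {a a' : G}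
    (h : IsEdgeWalk hV g v₀ v q a) (h' : IsEdgeWalk hV g v₀ v q a') : a = a' := by
  let _ : TopologicalSpace G := ⊥
  have : DiscreteTopology G := ⟨rfl⟩
  obtain ⟨Γ, hΓ⟩ := exists_lift_walk hV hg h
  obtain ⟨Γ', hΓ'⟩ := exists_lift_walk hV hg h'
  -- Monodromy depends only on the homotopy class downstairs, so the two lifts end at the same point
  -- of the fibre.
  have h1 := (isCoveringMap_proj hg).monodromy_map Γ
  have h2 := (isCoveringMap_proj hg).monodromy_map Γ'
  rw [hΓ] at h1
  rw [hΓ'] at h2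
  have h3 := congrArg Subtype.val (h1.symm.trans h2)
  exact eq_of_heq (Bundle.TotalSpace.mk.inj h3).2

/-! ### The fundamental group of a simplicial complex -/

variable (K) in
/-- There is an edge path of gain `a` from `v₀` to `v`. -/
inductive HasGain {G : Type} [Group G] (g : V → V → G) (v₀ : V) : V → G → Prop
  | nil : HasGain g v₀ v₀ 1
  | cons {u v : V} {a : G} : HasGain g v₀ u a → K.Adj u v → HasGain g v₀ v (a * g u v)

lemma HasGain.exists_isEdgeWalk {G : Type} [Group G] {g : V → V → G} {v₀ v : V} {a : G}
    (h : K.HasGain g v₀ v a) : ∃ q, IsEdgeWalk hV g v₀ v q a := by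
  induction h with
  | nil => exact ⟨_, .nil⟩
  | cons _ hadj ih =>
    obtain ⟨q, hq⟩ := ih
    exact ⟨_, hq.cons hadj⟩

variable (K) in
/-- The gain function `g` is a universal cocycle: every cocycle is cohomologous to the image of `g`
under a homomorphism. -/
def IsUniversal {G : Type} [Group G] (g : V → V → G) (v₀ : V) : Prop :=
  ∀ (H : Type) [Group H] (θ : V → V → H), K.IsCocycle θ → ∃ (F : G →* H) (b : V → H), b v₀ = 1 ∧
    ∀ u v, K.Adj u v → θ u v = (b u)⁻¹ * F (g u v) * b v

/-- Universality is applied to the tautological cocycle that sends an edge to the loop obtained by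
joining its ends to the base point. The resulting map from `G` sends the gain of a closed edge path
to its class. It is onto because every loop is homotopic to an edge path, and injective because the
gain is a homotopy invariant. -/
theorem exists_fundamentalGroup_mulEquiv {G : Type} [Group G] {g : V → V → G} {v₀ : V}
    (hg : K.IsCocycle g) (hconn : ∀ v, ∃ a, K.HasGain g v₀ v a) (hgen : ∀ a, K.HasGain g v₀ v₀ a)
    (huniv : K.IsUniversal g v₀) :
    ∃ f : FundamentalGroup K.Space (vertex v₀ (hV v₀)) ≃* G,
      ∀ q a, IsEdgeWalk hV g v₀ v₀ q a → f (FundamentalGroup.fromPath q) = a⁻¹ := by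
  classical
  let x₀ := vertex v₀ (hV v₀)
  let H := (FundamentalGroup K.Space x₀)ᵐᵒᵖ
  have hq : ∀ v, Nonempty (Path.Homotopic.Quotient x₀ (vertex v (hV v))) := fun v => by
    obtain ⟨a, ha⟩ := hconn v
    obtain ⟨q, -⟩ := ha.exists_isEdgeWalk hV
    exact ⟨q⟩
  -- Composing with the inverse of the path chosen for `v₀` makes the connecting path at the base
  -- vertex trivial.
  let τ (v : V) : Path.Homotopic.Quotient x₀ (vertex v (hV v)) := (hq v₀).some.symm.trans (hq v).some
  have hτ0 : τ v₀ = .refl _ := Path.Homotopic.Quotient.symm_trans _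
  let op (q : Path.Homotopic.Quotient x₀ x₀) : H := MulOpposite.op (FundamentalGroup.fromPath q)
  have hop : ∀ q q', op q * op q' = op (q.trans q') := fun q q' => rfl
  let θ (u v : V) : H := if h : K.Adj u v then op (((τ u).trans (seg (h.near hV))).trans (τ v).symm)
    else 1
  have hθ : ∀ u v (h : K.Adj u v), θ u v = op (((τ u).trans (seg (h.near hV))).trans (τ v).symm) :=
    fun u v h => by simp only [θ, dif_pos h]
  have hθc : K.IsCocycle θ := by
    intro s hs u hu v hv w hw
    rw [hθ u v ⟨s, hs, hu, hv⟩, hθ v w ⟨s, hs, hv, hw⟩, hθ u w ⟨s, hs, hu, hw⟩, hop]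
    rw [← seg_trans_seg hs (by simpa [supp_vertex] using hu) (by simpa [supp_vertex] using hv)
      (by simpa [supp_vertex] using hw) (Adj.near hV ⟨s, hs, hu, hv⟩)
      (Adj.near hV ⟨s, hs, hv, hw⟩)]
    congr 1
    simp only [Path.Homotopic.Quotient.trans_assoc]
    rw [← Path.Homotopic.Quotient.trans_assoc (τ v).symm, Path.Homotopic.Quotient.symm_trans,
      Path.Homotopic.Quotient.refl_trans]
  obtain ⟨F, b, hb0, hFb⟩ := huniv H θ hθc
  -- The claim is stated for paths to any vertex, with the correction `b v`, to make induction along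
  -- the edge path possible; `b` disappears for closed paths.
  have key : ∀ v q a, IsEdgeWalk hV g v₀ v q a → op (q.trans (τ v).symm) = F a * b v := by
    intro v q a h
    induction h with
    | nil => 
      rw [hτ0, hb0, map_one, one_mul]
      have : (Path.Homotopic.Quotient.refl x₀).trans (Path.Homotopic.Quotient.refl x₀).symm = .refl _ := by
        simp
      rw [this]; rfl
    | @cons u v q a _ hadj ih =>
      have h1 : op ((q.trans (seg (hadj.near hV))).trans (τ v).symm) =
          op (q.trans (τ u).symm) * θ u v := by
        rw [hθ u v hadj, hop]
        congr 1
        simp only [Path.Homotopic.Quotient.trans_assoc]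
        rw [← Path.Homotopic.Quotient.trans_assoc (τ u).symm, Path.Homotopic.Quotient.symm_trans,
          Path.Homotopic.Quotient.refl_trans]
      rw [h1, ih, hFb u v hadj, map_mul]
      group
  have key' : ∀ q a, IsEdgeWalk hV g v₀ v₀ q a → op q = F a := by
    intro q a h
    have h1 := key _ _ _ h
    rw [hτ0, hb0, mul_one] at h1
    have h2 : q.trans (Path.Homotopic.Quotient.refl x₀).symm = q := by
      have : (Path.Homotopic.Quotient.refl x₀).symm = .refl _ := rfl
      rw [this]
      exact Path.Homotopic.Quotient.trans_refl q
    rw [← h1]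
    exact (congrArg op h2).symm
  have hbij : Function.Bijective F := by
    constructor
    · rw [injective_iff_map_eq_one]
      intro a ha
      obtain ⟨q, hq⟩ := (hgen a).exists_isEdgeWalk hV
      have h1 := key' q a hq
      rw [ha] at h1
      have h2 : q = .refl _ := MulOpposite.op_injective h1
      subst h2
      exact hq.gain_eq hV hg .nil
    · intro p
      obtain ⟨a, ha⟩ := exists_isEdgeWalk hV g v₀ v₀ (FundamentalGroup.toPath (MulOpposite.unop p))
      exact ⟨a, (key' _ _ ha).symm⟩
  -- The product of the fundamental group is opposite to concatenation of edge paths. Inversion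
  -- turns the anti-isomorphism into an isomorphism, at the price of `a⁻¹`.
  refine ⟨(MulEquiv.inv' _).trans (MulEquiv.ofBijective F hbij).symm, fun q a h => ?_⟩
  rw [MulEquiv.trans_apply, MulEquiv.symm_apply_eq, MulEquiv.ofBijective_apply, map_inv,
    ← key' q a h]
  rfl

end VertexComplex

namespace VertexComplex

variable {V : Type} [Fintype V] {K : VertexComplex V}

/-! ### The regular graph defined by a height difference -/

variable (K) in
/-- A height difference: an additive cocycle with values in `{-1, 0, 1}` on each face. -/
structure IsHeight (c : V → V → ℤ) : Prop where
  add : ∀ s ∈ K.faces, ∀ u ∈ s, ∀ v ∈ s, ∀ w ∈ s, c u v + c v w = c u w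
  le_one : ∀ s ∈ K.faces, ∀ u ∈ s, ∀ v ∈ s, c u v ≤ 1

/-- A vertex of a face is high if it lies above some vertex of the face. -/
def IsHigh (c : V → V → ℤ) (s : Finset V) (v : V) : Prop := ∃ u ∈ s, c u v = 1

namespace IsHeight

variable {c : V → V → ℤ} (hc : K.IsHeight c)
include hc

omit [Fintype V] in
lemma self {s : Finset V} (hs : s ∈ K.faces) {u : V} (hu : u ∈ s) : c u u = 0 := by
  have := hc.add s hs u hu u hu u hu
  omega

omit [Fintype V] in
lemma swap {s : Finset V} (hs : s ∈ K.faces) {u v : V} (hu : u ∈ s) (hv : v ∈ s) :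
    c v u = - c u v := by
  have := hc.add s hs u hu v hv u hu
  have := hc.self hs hu
  omega

-- Differences are at most 1, so a face has at most two heights. This lemma and the next two say
-- that `IsHigh` separates the upper level from the lower one, all vertices of a level face counting
-- as not high.
omit [Fintype V] in
lemma eq_of_isHigh {s : Finset V} (hs : s ∈ K.faces) {u v : V} (hu : u ∈ s) (hv : v ∈ s)
    (h : IsHigh c s v) (h' : IsHigh c s u) : c u v = 0 := by
  obtain ⟨a, ha, hav⟩ := h
  obtain ⟨b, hb, hbu⟩ := h'
  have h1 := hc.add s hs b hb u hu v hv
  have h2 := hc.le_one s hs b hb v hv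
  have h3 := hc.add s hs a ha v hv u hu
  have h4 := hc.le_one s hs a ha u hu
  have h5 := hc.swap hs hu hv
  omega

omit [Fintype V] in
lemma eq_of_isHigh_of_not {s : Finset V} (hs : s ∈ K.faces) {u v : V} (hu : u ∈ s) (hv : v ∈ s)
    (h : IsHigh c s v) (h' : ¬ IsHigh c s u) : c u v = 1 := by
  obtain ⟨a, ha, hav⟩ := h
  have h1 := hc.add s hs u hu a ha v hv
  have h2 := hc.le_one s hs u hu v hv
  have h3 : c a u ≠ 1 := fun h => h' ⟨a, ha, h⟩
  have h4 := hc.le_one s hs a ha u hu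
  have h5 := hc.swap hs hu ha
  omega

omit [Fintype V] in
lemma eq_of_not_of_not {s : Finset V} (hs : s ∈ K.faces) {u v : V} (hu : u ∈ s) (hv : v ∈ s)
    (h : ¬ IsHigh c s v) (h' : ¬ IsHigh c s u) : c u v = 0 := by
  have h1 : c u v ≠ 1 := fun h1 => h ⟨u, hu, h1⟩
  have h2 : c v u ≠ 1 := fun h1 => h' ⟨v, hv, h1⟩
  have h3 := hc.le_one s hs u hu v hv
  have h4 := hc.le_one s hs v hv u hu
  have h5 := hc.swap hs hu hv
  omega

end IsHeight

open Classical in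
/-- The total weight of the high vertices. -/
def topWeight (c : V → V → ℤ) (w : V → ℝ) : ℝ := ∑ v, if IsHigh c (supp w) v then w v else 0

/-- The mean of the height differences to the vertex `v`. -/
def drift (c : V → V → ℤ) (w : V → ℝ) (v : V) : ℝ := ∑ u, w u * c u v

/-- The variance of the height. -/
def spread (c : V → V → ℤ) (w : V → ℝ) : ℝ := ∑ v, w v * drift c w v ^ 2

lemma continuous_drift (c : V → V → ℤ) (v : V) : Continuous fun x : K.Space => drift c x.1 v :=
  continuous_finsetSum _ fun u _ => (Space.continuous_apply u).mul continuous_const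

lemma continuous_spread (c : V → V → ℤ) : Continuous fun x : K.Space => spread c x.1 :=
  continuous_finsetSum _ fun v _ => (Space.continuous_apply v).mul ((continuous_drift c v).pow 2)

section Weight

variable {c : V → V → ℤ} (x : K.Space)

lemma topWeight_nonneg : 0 ≤ topWeight c x.1 :=
  Finset.sum_nonneg fun v _ => by split_ifs <;> [exact x.nonneg v; exact le_rfl]

open Classical in
lemma sum_low : ∑ v, (if IsHigh c (supp x.1) v then 0 else x.1 v) = 1 - topWeight c x.1 := by
  rw [topWeight, ← x.sum_eq_one, ← Finset.sum_sub_distrib]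
  refine Finset.sum_congr rfl fun v _ => ?_
  split_ifs <;> ring

open Classical in
lemma topWeight_le_one : topWeight c x.1 ≤ 1 := by
  have : 0 ≤ ∑ v, (if IsHigh c (supp x.1) v then 0 else x.1 v) :=
    Finset.sum_nonneg fun v _ => by split_ifs <;> [exact le_rfl; exact x.nonneg v]
  rw [sum_low] at this
  linarith

variable (hc : K.IsHeight c)
include hc

lemma drift_of_isHigh {v : V} (hv : v ∈ supp x.1) (h : IsHigh c (supp x.1) v) :
    drift c x.1 v = 1 - topWeight c x.1 := by
  classical
  rw [← sum_low, drift]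
  refine Finset.sum_congr rfl fun u _ => ?_
  by_cases hu : u ∈ supp x.1
  · split_ifs with h'
    · simp [hc.eq_of_isHigh x.supp_mem hu hv h h']
    · simp [hc.eq_of_isHigh_of_not x.supp_mem hu hv h h']
  · simp [notMem_supp.1 hu]

lemma drift_of_not_isHigh {v : V} (hv : v ∈ supp x.1) (h : ¬ IsHigh c (supp x.1) v) :
    drift c x.1 v = - topWeight c x.1 := by
  classical
  rw [topWeight, drift, ← Finset.sum_neg_distrib]
  refine Finset.sum_congr rfl fun u _ => ?_
  by_cases hu : u ∈ supp x.1
  · split_ifs with h'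
    · rw [hc.swap x.supp_mem hv hu, hc.eq_of_isHigh_of_not x.supp_mem hv hu h' h]
      simp
    · simp [hc.eq_of_not_of_not x.supp_mem hu hv h h']
  · simp [notMem_supp.1 hu]

/-- The drift has only two values on the support, `1 - t` at high vertices and `-t` at the others,
where `t` is the top weight. -/
lemma sum_mul_drift (f : ℝ → ℝ) : ∑ v, x.1 v * f (drift c x.1 v) =
    topWeight c x.1 * f (1 - topWeight c x.1) + (1 - topWeight c x.1) * f (- topWeight c x.1) := by
  classical
  calc _ = ∑ v, ((if IsHigh c (supp x.1) v then x.1 v else 0) * f (1 - topWeight c x.1) +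
        (if IsHigh c (supp x.1) v then 0 else x.1 v) * f (- topWeight c x.1)) := ?_
    _ = _ := by rw [Finset.sum_add_distrib, ← Finset.sum_mul, ← Finset.sum_mul, sum_low]; rfl
  refine Finset.sum_congr rfl fun v _ => ?_
  by_cases hv : v ∈ supp x.1
  · split_ifs with h
    · rw [drift_of_isHigh x hc hv h]; ring
    · rw [drift_of_not_isHigh x hc hv h]; ring
  · simp [notMem_supp.1 hv]

/-- The top weight is not continuous: it drops from near 1 to 0 when a point reaches a face
consisting of high vertices only. The polynomial `spread` is continuous and is blind to this jump,
since `t * (1 - t)` agrees at 0 and 1. -/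
lemma spread_eq : spread c x.1 = topWeight c x.1 * (1 - topWeight c x.1) := by
  rw [spread, sum_mul_drift x hc (fun d => d ^ 2)]
  ring

lemma sum_mul_drift_eq_zero : ∑ v, x.1 v * drift c x.1 v = 0 := by
  rw [sum_mul_drift x hc (fun d => d)]
  ring

end Weight

/-! ### The midset and its collar -/

variable (K) in
/-- The set of points where the high and the low vertices have the same weight. -/
def midSet (c : V → V → ℤ) : Set K.Space := {x | spread c x.1 = 1 / 4}

section MidSet

variable {c : V → V → ℤ} (hc : K.IsHeight c)
include hc

lemma mem_midSet {x : K.Space} : x ∈ K.midSet c ↔ topWeight c x.1 = 1 / 2 := by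
  rw [midSet, mem_ofPred_eq, spread_eq x hc]
  constructor
  · intro h
    have : (topWeight c x.1 - 1 / 2) ^ 2 = 0 := by linarith
    have := pow_eq_zero_iff (two_ne_zero) |>.1 this
    linarith
  · intro h
    rw [h]; norm_num

lemma abs_drift_le {x : K.Space} (hx : x ∈ K.midSet c) {v : V} (hv : v ∈ supp x.1) :
    |drift c x.1 v| ≤ 1 / 2 := by
  rw [mem_midSet hc] at hx
  by_cases h : IsHigh c (supp x.1) v
  · rw [drift_of_isHigh x hc hv h, hx]; norm_num
  · rw [drift_of_not_isHigh x hc hv h, hx]; norm_num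

lemma collar_factor_pos {x : K.Space} (hx : x ∈ K.midSet c) {v : V} (hv : v ∈ supp x.1) {r : ℝ}
    (hr : r ∈ Icc (-1 : ℝ) 1) : 0 < 1 + r * drift c x.1 v := by
  have h1 := abs_le.1 (abs_drift_le hc hx hv)
  nlinarith [hr.1, hr.2]

lemma supp_collar {x : K.Space} (hx : x ∈ K.midSet c) {r : ℝ} (hr : r ∈ Icc (-1 : ℝ) 1) :
    supp (fun v => x.1 v * (1 + r * drift c x.1 v)) = supp x.1 := by
  ext v
  rw [mem_supp]
  by_cases hv : v ∈ supp x.1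
  · exact iff_of_true (mul_ne_zero (mem_supp.1 hv) (collar_factor_pos hc hx hv hr).ne') hv
  · exact iff_of_false (by simp [notMem_supp.1 hv]) hv

/-- The collar of the midset. -/
def collar (q : K.midSet c × Icc (-1 : ℝ) 1) : K.Space :=
  -- On the midset the drift is `1/2` at high and `-1/2` at low vertices, so weight moves between
  -- the levels while the proportions within each level are kept. The total stays 1 because the mean
  -- drift is zero.
  ⟨fun v => q.1.1.1 v * (1 + q.2.1 * drift c q.1.1.1 v), fun v => by
    by_cases hv : v ∈ supp q.1.1.1
    · exact mul_nonneg (q.1.1.nonneg v) (collar_factor_pos hc q.1.2 hv q.2.2).le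
    · simp [notMem_supp.1 hv], by
    have h1 := sum_mul_drift_eq_zero q.1.1 hc
    have h2 := q.1.1.sum_eq_one
    calc ∑ v, q.1.1.1 v * (1 + q.2.1 * drift c q.1.1.1 v)
        = ∑ v, q.1.1.1 v + q.2.1 * ∑ v, q.1.1.1 v * drift c q.1.1.1 v := by
          rw [Finset.mul_sum, ← Finset.sum_add_distrib]
          exact Finset.sum_congr rfl fun v _ => by ring
      _ = 1 := by rw [h1, h2]; ring, by
    rw [supp_collar hc q.1.2 q.2.2]
    exact q.1.1.supp_mem⟩

lemma collar_apply (q : K.midSet c × Icc (-1 : ℝ) 1) (v : V) :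
    (collar hc q).1 v = q.1.1.1 v * (1 + q.2.1 * drift c q.1.1.1 v) := rfl

lemma supp_collar_eq (q : K.midSet c × Icc (-1 : ℝ) 1) :
    supp (collar hc q).1 = supp q.1.1.1 := supp_collar hc q.1.2 q.2.2

lemma continuous_collar : Continuous (collar hc) := by
  refine Continuous.subtype_mk (continuous_pi fun v => ?_) _
  have h1 : Continuous fun q : K.midSet c × Icc (-1 : ℝ) 1 => q.1.1 :=
    continuous_subtype_val.comp continuous_fst
  have h2 : Continuous fun q : K.midSet c × Icc (-1 : ℝ) 1 => q.2.1 :=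
    continuous_subtype_val.comp continuous_snd
  exact ((Space.continuous_apply v).comp h1).mul
    (continuous_const.add (h2.mul ((continuous_drift c v).comp h1)))

lemma topWeight_collar (q : K.midSet c × Icc (-1 : ℝ) 1) :
    topWeight c (collar hc q).1 = 1 / 2 + q.2.1 / 4 := by
  classical
  have h1 := (mem_midSet hc).1 q.1.2
  rw [topWeight, supp_collar_eq]
  calc _ = ∑ v, (if IsHigh c (supp q.1.1.1) v then q.1.1.1 v else 0) * (1 + q.2.1 / 2) := by
        refine Finset.sum_congr rfl fun v _ => ?_
        by_cases hv : v ∈ supp q.1.1.1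
        · split_ifs with h
          · rw [collar_apply, drift_of_isHigh _ hc hv h, h1]; ring
          · ring
        · simp [collar_apply, notMem_supp.1 hv]
    _ = topWeight c q.1.1.1 * (1 + q.2.1 / 2) := by rw [topWeight, Finset.sum_mul]
    _ = _ := by rw [h1]; ring

lemma injective_collar : Function.Injective (collar hc) := by
  intro q q' h
  have h1 := topWeight_collar hc q
  rw [h, topWeight_collar hc q'] at h1
  have h2 : q.2.1 = q'.2.1 := by linarith
  have h3 : supp q.1.1.1 = supp q'.1.1.1 := by rw [← supp_collar_eq hc q, h, supp_collar_eq]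
  refine Prod.ext (Subtype.ext (Subtype.ext (funext fun v => ?_))) (Subtype.ext h2)
  by_cases hv : v ∈ supp q.1.1.1
  · have hv' := h3 ▸ hv
    have h4 : drift c q.1.1.1 v = drift c q'.1.1.1 v := by
      have e1 := (mem_midSet hc).1 q.1.2
      have e2 := (mem_midSet hc).1 q'.1.2
      by_cases hh : IsHigh c (supp q.1.1.1) v
      · rw [drift_of_isHigh _ hc hv hh, drift_of_isHigh _ hc hv' (h3 ▸ hh), e1, e2]
      · rw [drift_of_not_isHigh _ hc hv hh, drift_of_not_isHigh _ hc hv' (h3 ▸ hh), e1, e2]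
    have h5 : (collar hc q).1 v = (collar hc q').1 v := by rw [h]
    rw [collar_apply, collar_apply, h2, h4] at h5
    refine mul_right_cancel₀ ?_ h5
    exact (collar_factor_pos hc q'.1.2 hv' q'.2.2).ne'
  · rw [q.1.1.apply_eq_zero hv, q'.1.1.apply_eq_zero (h3 ▸ hv)]

omit hc in
lemma isClosed_midSet : IsClosed (K.midSet c) :=
  isClosed_eq (continuous_spread c) continuous_const

lemma isClosedEmbedding_collar : IsClosedEmbedding (collar hc) := by
  have : CompactSpace (K.midSet c) := isCompact_iff_compactSpace.1 isClosed_midSet.isCompact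
  exact (continuous_collar hc).isClosedEmbedding (injective_collar hc)

/-- The coordinate of the collar. -/
lemma exists_collar_eq {x : K.Space} (hx : topWeight c x.1 ∈ Icc (1 / 4 : ℝ) (3 / 4)) :
    ∃ q, collar hc q = x ∧ (q.2.1 : ℝ) = 4 * topWeight c x.1 - 2 := by
  classical
  obtain ⟨hx1, hx2⟩ := hx
  set t := topWeight c x.1 with ht
  -- Rescaling each of the two levels to total weight `1/2` projects `x` to the midset.
  let f (v : V) : ℝ := if IsHigh c (supp x.1) v then 1 / (2 * t) else 1 / (2 * (1 - t))
  have hf : ∀ v, 0 < f v := fun v => by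
    simp only [f]; split_ifs
    · exact div_pos one_pos (by linarith)
    · exact div_pos one_pos (by linarith)
  let w (v : V) : ℝ := x.1 v * f v
  have hsupp : supp w = supp x.1 := by
    ext v
    simp only [mem_supp, w]
    exact ⟨fun h h' => h (by simp [h']), fun h => mul_ne_zero h (hf v).ne'⟩
  have htop : topWeight c w = 1 / 2 := by
    rw [topWeight, hsupp]
    have : ∀ v, (if IsHigh c (supp x.1) v then w v else 0) =
        (if IsHigh c (supp x.1) v then x.1 v else 0) * (1 / (2 * t)) := fun v => by
      simp only [w, f]; split_ifs <;> ring
    simp only [this]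
    rw [← Finset.sum_mul]
    change t * _ = _
    field_simp
  have hsum : ∑ v, w v = 1 := by
    have : ∀ v, w v = (if IsHigh c (supp x.1) v then x.1 v else 0) * (1 / (2 * t)) +
        (if IsHigh c (supp x.1) v then 0 else x.1 v) * (1 / (2 * (1 - t))) := fun v => by
      simp only [w, f]; split_ifs <;> ring
    simp only [this]
    rw [Finset.sum_add_distrib, ← Finset.sum_mul, ← Finset.sum_mul, sum_low]
    change t * _ + (1 - t) * _ = _
    have : 1 - t ≠ 0 := by linarith
    field_simp
    norm_num
  let y : K.Space := ⟨w, fun v => mul_nonneg (x.nonneg v) (hf v).le, hsum, by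
    rw [hsupp]; exact x.supp_mem⟩
  have hy : y ∈ K.midSet c := (mem_midSet hc).2 htop
  refine ⟨(⟨y, hy⟩, ⟨4 * t - 2, by constructor <;> linarith⟩), ?_, rfl⟩
  refine Subtype.ext (funext fun v => ?_)
  rw [collar_apply]
  change w v * (1 + (4 * t - 2) * drift c y.1 v) = x.1 v
  by_cases hv : v ∈ supp x.1
  · have hv' : v ∈ supp y.1 := by change v ∈ supp w; rwa [hsupp]
    have hye : topWeight c y.1 = 1 / 2 := htop
    by_cases h : IsHigh c (supp x.1) v
    · have h' : IsHigh c (supp y.1) v := by change IsHigh c (supp w) v; rwa [hsupp]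
      rw [drift_of_isHigh y hc hv' h', hye]
      simp only [w, f, if_pos h]
      have : t ≠ 0 := by linarith
      field_simp
      ring
    · have h' : ¬ IsHigh c (supp y.1) v := by change ¬ IsHigh c (supp w) v; rwa [hsupp]
      rw [drift_of_not_isHigh y hc hv' h', hye]
      simp only [w, f, if_neg h]
      have : 1 - t ≠ 0 := by linarith
      field_simp
      ring
  · simp [w, notMem_supp.1 hv]

/-- The parameter range `(-1, 1)` corresponds to top weights between `1/4` and `3/4`, and `3/16 =
1/4 * 3/4`. Expressed through `spread`, the condition is visibly open. -/
lemma image_collar : collar hc '' {q | -1 < (q.2 : ℝ) ∧ (q.2 : ℝ) < 1} =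
    {x | 3 / 16 < spread c x.1} := by
  ext x
  constructor
  · rintro ⟨q, ⟨h1, h2⟩, rfl⟩
    rw [mem_ofPred_eq, spread_eq _ hc, topWeight_collar]
    nlinarith
  · intro hx
    rw [mem_ofPred_eq, spread_eq _ hc] at hx
    have h1 : 1 / 4 < topWeight c x.1 := by nlinarith
    have h2 : topWeight c x.1 < 3 / 4 := by nlinarith
    obtain ⟨q, hq, hq2⟩ := exists_collar_eq hc ⟨h1.le, h2.le⟩
    exact ⟨q, ⟨by linarith, by linarith⟩, hq⟩

end MidSet

end VertexComplex

namespace VertexComplex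

variable {V : Type} [Fintype V] {K : VertexComplex V} {c : V → V → ℤ}

/-! ### Cells of the midset -/

/-- If a vertex is separated from the remaining vertices, then the midset is given by its weight. -/
lemma mem_midSet_iff_of_split (hc : K.IsHeight c) (x : K.Space) {a : V} (ha : a ∈ supp x.1) {ε : ℤ}
    (hε : ε = 1 ∨ ε = -1) (h : ∀ v ∈ supp x.1, v ≠ a → c a v = ε) :
    x ∈ K.midSet c ↔ x.1 a = 1 / 2 := by
  classical
  have h1 : drift c x.1 a = -ε * (1 - x.1 a) := by
    rw [← x.sum_eq_one, drift, ← Finset.add_sum_erase _ _ (Finset.mem_univ a),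
      ← Finset.add_sum_erase _ x.1 (Finset.mem_univ a), hc.self x.supp_mem ha]
    rw [add_sub_cancel_left, Int.cast_zero, mul_zero, zero_add, Finset.mul_sum]
    refine Finset.sum_congr rfl fun u hu => ?_
    by_cases hus : u ∈ supp x.1
    · rw [hc.swap x.supp_mem ha hus, h u hus (Finset.ne_of_mem_erase hu)]
      push_cast; ring
    · simp [x.apply_eq_zero hus]
  have h0 := x.nonneg a
  have hle : x.1 a ≤ 1 := by
    rw [← x.sum_eq_one]
    exact Finset.single_le_sum (fun i _ => x.nonneg i) (Finset.mem_univ a)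
  have hapos := (x.pos_iff a).2 ha
  have ht0 := topWeight_nonneg (c := c) x
  have ht1 := topWeight_le_one (c := c) x
  rw [mem_midSet hc]
  have hnot : ∀ v ∈ supp x.1, v ≠ a → ε = 1 → ¬ IsHigh c (supp x.1) a := by
    rintro v hv hva rfl ⟨u, hu, hua⟩
    rcases eq_or_ne u a with rfl | hne
    · rw [hc.self x.supp_mem ha] at hua; omega
    · rw [hc.swap x.supp_mem ha hu, h u hu hne] at hua; omega
  have hyes : ∀ v ∈ supp x.1, v ≠ a → ε = -1 → IsHigh c (supp x.1) a := by
    rintro v hv hva rfl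
    exact ⟨v, hv, by rw [hc.swap x.supp_mem ha hv, h v hv hva]; rfl⟩
  -- If `x` is the vertex `a` itself, `IsHigh` gives no information about `ε`; then both sides fail.
  by_cases hex : ∃ v ∈ supp x.1, v ≠ a
  · obtain ⟨v, hv, hva⟩ := hex
    rcases hε with rfl | rfl
    · rw [drift_of_not_isHigh x hc ha (hnot v hv hva rfl)] at h1
      push_cast at h1
      constructor <;> intro <;> linarith
    · rw [drift_of_isHigh x hc ha (hyes v hv hva rfl)] at h1
      push_cast at h1
      constructor <;> intro <;> linarith
  · push Not at hex
    have hx1 : x.1 a = 1 := by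
      rw [← x.sum_eq_one]
      refine (Finset.sum_eq_single a (fun b _ hb => ?_) (by simp)).symm
      exact x.apply_eq_zero fun hbs => hb (hex b hbs)
    have hz : drift c x.1 a = 0 := by rw [h1, hx1]; ring
    by_cases hh : IsHigh c (supp x.1) a
    · rw [drift_of_isHigh x hc ha hh] at hz
      constructor <;> intro <;> linarith
    · rw [drift_of_not_isHigh x hc ha hh] at hz
      constructor <;> intro <;> linarith

variable (K c) in
/-- A face is sloped if its vertices do not have the same height. -/
def IsSloped (s : Finset V) : Prop := s ∈ K.faces ∧ ∃ u ∈ s, ∃ v ∈ s, c u v = 1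

lemma isSloped_supp (hc : K.IsHeight c) {x : K.Space} (hx : x ∈ K.midSet c) :
    K.IsSloped c (supp x.1) := by
  refine ⟨x.supp_mem, ?_⟩
  by_contra h
  push Not at h
  rw [mem_midSet hc, topWeight, Finset.sum_eq_zero] at hx
  · norm_num at hx
  · intro v _
    split_ifs with hv
    · obtain ⟨u, hu, huv⟩ := hv
      refine x.apply_eq_zero fun hv => h u hu v hv huv
    · rfl

/-- The midpoint of an edge. -/
def edgeMid {e : Finset V} (he : e ∈ K.faces) (h2 : e.card = 2) : K.Space := by
  classical
  exact ⟨fun v => if v ∈ e then 1 / 2 else 0, closedSimplex_subset he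
    ⟨fun v => by beta_reduce; split_ifs <;> norm_num, by simp [h2], fun v hv => by simp [hv]⟩⟩

lemma edgeMid_apply {e : Finset V} (he : e ∈ K.faces) (h2 : e.card = 2) {v : V} (hv : v ∈ e) :
    (edgeMid he h2).1 v = 1 / 2 := by simp [edgeMid, hv]

lemma supp_edgeMid {e : Finset V} (he : e ∈ K.faces) (h2 : e.card = 2) :
    supp (edgeMid he h2).1 = e := by
  ext v; simp [edgeMid]

lemma edgeMid_mem {e : Finset V} (hc : K.IsHeight c) (he : K.IsSloped c e) (h2 : e.card = 2) :
    edgeMid he.1 h2 ∈ K.midSet c := by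
  obtain ⟨hf, u, hu, v, hv, huv⟩ := he
  rw [mem_midSet_iff_of_split hc _ (a := u) (by rwa [supp_edgeMid]) (Or.inl rfl)]
  · exact edgeMid_apply _ _ hu
  · rw [supp_edgeMid]
    intro w hw hwu
    have : w = v := by
      by_contra hne
      have hvu : v ≠ u := by
        rintro rfl
        rw [hc.self hf hu] at huv; omega
      have : ({u, v, w} : Set V).ncard ≤ (e : Set V).ncard :=
        Set.ncard_le_ncard (by rintro z (rfl | rfl | rfl) <;> assumption) e.finite_toSet
      rw [Set.ncard_coe_finset, h2, Set.ncard_eq_three.2 ⟨u, v, w, hvu.symm, hwu.symm,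
        Ne.symm hne, rfl⟩]
        at this
      omega
    rw [this, huv]

lemma eq_edgeMid {x : K.Space} (hc : K.IsHeight c) (hx : x ∈ K.midSet c) (h2 : (supp x.1).card = 2) :
    x = edgeMid x.supp_mem h2 := by
  classical
  obtain ⟨hf, u, hu, v, hv, huv⟩ := isSloped_supp hc hx
  have hvu : v ≠ u := by
    rintro rfl
    rw [hc.self hf hu] at huv; omega
  have hsupp : supp x.1 = {u, v} :=
    (Finset.eq_of_subset_of_card_le (by
      intro z hz; simp only [Finset.mem_insert, Finset.mem_singleton] at hz
      rcases hz with rfl | rfl <;> assumption) (by rw [h2, Finset.card_pair hvu.symm])).symm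
  have h1 : x.1 u = 1 / 2 := by
    refine (mem_midSet_iff_of_split hc x hu (Or.inl rfl) fun w hw hwu => ?_).1 hx
    rw [hsupp] at hw
    simp only [Finset.mem_insert, Finset.mem_singleton] at hw
    rcases hw with rfl | rfl
    exacts [absurd rfl hwu, huv]
  have hs := x.sum_subset (s := {u, v}) (hsupp ▸ Finset.Subset.refl _)
  rw [Finset.sum_pair hvu.symm] at hs
  refine Subtype.ext (funext fun w => ?_)
  by_cases hw : w ∈ supp x.1
  · rw [edgeMid_apply _ _ hw]
    rw [hsupp] at hw
    simp only [Finset.mem_insert, Finset.mem_singleton] at hw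
    rcases hw with rfl | rfl
    · exact h1
    · linarith
  · rw [x.apply_eq_zero hw, Space.apply_eq_zero]
    rwa [supp_edgeMid]

variable (K c) in
/-- The position of a triangle with respect to the height: the vertex `a` is separated from the
vertices `b` and `d`. -/
structure Bend (s : Finset V) where
  (a b d : V)
  ne_ab : a ≠ b
  ne_ad : a ≠ d
  ne_bd : b ≠ d
  mem_iff : ∀ v, v ∈ s ↔ v = a ∨ v = b ∨ v = d
  mem_faces : s ∈ K.faces
  eq : c a b = c a d
  unit : c a b = 1 ∨ c a b = -1

-- Three vertices on two levels: one level contains exactly one of them, and that vertex is `a`.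
omit [Fintype V] in
lemma nonempty_bend (hc : K.IsHeight c) {s : Finset V} (hs : K.IsSloped c s) (h3 : s.card = 3) :
    Nonempty (K.Bend c s) := by
  classical
  obtain ⟨hf, u, hu, v, hv, huv⟩ := hs
  have hvu : v ≠ u := by
    rintro rfl
    rw [hc.self hf hu] at huv; omega
  have hcard : ((s.erase u).erase v).card = 1 := by
    rw [Finset.card_erase_of_mem (Finset.mem_erase.2 ⟨hvu, hv⟩), Finset.card_erase_of_mem hu, h3]
  obtain ⟨w, hw⟩ := Finset.card_eq_one.1 hcard
  have hw' : w ∈ (s.erase u).erase v := by rw [hw]; simp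
  simp only [Finset.mem_erase] at hw'
  obtain ⟨hwv, hwu, hws⟩ := hw'
  have hmem : ∀ z, z ∈ s ↔ z = u ∨ z = v ∨ z = w := fun z => by
    constructor
    · intro hz
      by_contra h
      push Not at h
      have : z ∈ (s.erase u).erase v := by simp [hz, h]
      rw [hw, Finset.mem_singleton] at this
      exact h.2.2 this
    · rintro (rfl | rfl | rfl) <;> assumption
  have e1 := hc.add s hf u hu v hv w hws
  have e2 := hc.le_one s hf u hu w hws
  have e3 := hc.le_one s hf w hws v hv
  have e4 := hc.swap hf hv hws
  have e5 := hc.swap hf hu hv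
  by_cases h : c v w = 0
  · exact ⟨⟨u, v, w, hvu.symm, hwu.symm, hwv.symm, hmem, hf, by omega, Or.inl huv⟩⟩
  · exact ⟨⟨v, u, w, hvu, hwv.symm, hwu.symm, fun z => by rw [hmem]; tauto, hf, by omega,
      Or.inr (by omega)⟩⟩

namespace Bend

variable {s : Finset V} (B : K.Bend c s)

/-- The points of the midset in a triangle. -/
def weight (r : ℝ) (v : V) : ℝ := by
  classical
  exact if v = B.a then 1 / 2 else if v = B.b then (1 - r) / 2 else if v = B.d then r / 2 else 0

omit [Fintype V] in
@[simp] lemma weight_a (r : ℝ) : B.weight r B.a = 1 / 2 := by simp [weight]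

omit [Fintype V] in
@[simp] lemma weight_b (r : ℝ) : B.weight r B.b = (1 - r) / 2 := by simp [weight, B.ne_ab.symm]

omit [Fintype V] in
@[simp] lemma weight_d (r : ℝ) : B.weight r B.d = r / 2 := by
  simp [weight, B.ne_ad.symm, B.ne_bd.symm]

omit [Fintype V] in
lemma weight_of_notMem (r : ℝ) {v : V} (hv : v ∉ s) : B.weight r v = 0 := by
  rw [B.mem_iff] at hv
  push Not at hv
  simp [weight, hv]

omit [Fintype V] in
lemma eq_insert [DecidableEq V] : s = {B.a, B.b, B.d} := by
  ext v; simp [B.mem_iff]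

omit [Fintype V] in
lemma sum_eq (f : V → ℝ) : ∑ v ∈ s, f v = f B.a + f B.b + f B.d := by
  classical
  rw [Finset.sum_congr B.eq_insert fun _ _ => rfl, Finset.sum_insert (by simp [B.ne_ab, B.ne_ad]),
    Finset.sum_pair B.ne_bd, add_assoc]

/-- The points of the midset in a triangle. -/
def point (r : Icc (0 : ℝ) 1) : K.Space :=
  ⟨B.weight r, closedSimplex_subset B.mem_faces ⟨fun v => by
      have := r.2.1
      have := r.2.2
      unfold weight
      split_ifs <;> linarith, by
      rw [← Finset.sum_subset (Finset.subset_univ s) fun v _ hv => B.weight_of_notMem _ hv,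
        B.sum_eq]
      simp
      ring, fun v hv => B.weight_of_notMem _ hv⟩⟩

lemma point_val (r : Icc (0 : ℝ) 1) : (B.point r).1 = B.weight r := rfl

lemma continuous_point : Continuous B.point := by
  refine Continuous.subtype_mk (continuous_pi fun v => ?_) _
  unfold weight
  split_ifs <;> fun_prop

lemma supp_point_subset (r : Icc (0 : ℝ) 1) : supp (B.point r).1 ⊆ s := fun v hv => by
  by_contra h
  exact mem_supp.1 hv (B.weight_of_notMem r h)

lemma supp_point {r : Icc (0 : ℝ) 1} (h0 : 0 < (r : ℝ)) (h1 : (r : ℝ) < 1) :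
    supp (B.point r).1 = s := by
  refine Finset.Subset.antisymm (B.supp_point_subset r) fun v hv => ?_
  rw [mem_supp, point_val]
  rcases (B.mem_iff v).1 hv with rfl | rfl | rfl
  · simp
  · rw [weight_b]; linarith
  · rw [weight_d]; linarith

lemma point_mem (hc : K.IsHeight c) (r : Icc (0 : ℝ) 1) : B.point r ∈ K.midSet c := by
  rw [mem_midSet_iff_of_split hc _ (a := B.a) (by rw [mem_supp, point_val]; simp) B.unit]
  · rw [point_val]; simp
  · intro v hv hva
    rcases (B.mem_iff v).1 (B.supp_point_subset r hv) with rfl | rfl | rfl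
    · exact absurd rfl hva
    · rfl
    · exact B.eq.symm

lemma exists_point_eq (hc : K.IsHeight c) {x : K.Space} (hx : x ∈ K.midSet c) (h : supp x.1 = s) :
    ∃ r : Icc (0 : ℝ) 1, 0 < (r : ℝ) ∧ (r : ℝ) < 1 ∧ B.point r = x := by
  have ha : B.a ∈ supp x.1 := by rw [h, B.mem_iff]; simp
  have hb : B.b ∈ supp x.1 := by rw [h, B.mem_iff]; simp
  have hd : B.d ∈ supp x.1 := by rw [h, B.mem_iff]; simp
  have h1 : x.1 B.a = 1 / 2 := by
    refine (mem_midSet_iff_of_split hc x ha B.unit fun v hv hva => ?_).1 hx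
    rcases (B.mem_iff v).1 (h ▸ hv) with rfl | rfl | rfl
    · exact absurd rfl hva
    · rfl
    · exact B.eq.symm
  have hs := x.sum_subset (s := s) (h ▸ Finset.Subset.refl _)
  rw [B.sum_eq] at hs
  have hbp := (x.pos_iff _).2 hb
  have hdp := (x.pos_iff _).2 hd
  refine ⟨⟨2 * x.1 B.d, by linarith, by linarith⟩, ?_, ?_, ?_⟩
  · change 0 < 2 * x.1 B.d; linarith
  · change 2 * x.1 B.d < 1; linarith
  · refine Subtype.ext (funext fun v => ?_)
    rw [point_val]
    by_cases hv : v ∈ s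
    · rcases (B.mem_iff v).1 hv with rfl | rfl | rfl
      · rw [weight_a, h1]
      · rw [weight_b]; linarith
      · rw [weight_d]; ring
    · rw [B.weight_of_notMem _ hv, x.apply_eq_zero (h ▸ hv)]

omit [Fintype V] in
lemma isSloped_ab [DecidableEq V] (hc : K.IsHeight c) : K.IsSloped c {B.a, B.b} := by
  have ha : B.a ∈ s := by rw [B.mem_iff]; simp
  have hb : B.b ∈ s := by rw [B.mem_iff]; simp
  refine ⟨K.mem_of_subset s B.mem_faces _ (by intro v; simp; rintro (rfl | rfl) <;> assumption)
    (by simp), ?_⟩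
  rcases B.unit with h | h
  · exact ⟨B.a, by simp, B.b, by simp, h⟩
  · exact ⟨B.b, by simp, B.a, by simp, by rw [hc.swap B.mem_faces ha hb, h]; rfl⟩

/-- The same bend with the two vertices on one side exchanged. -/
def swap : K.Bend c s where
  a := B.a
  b := B.d
  d := B.b
  ne_ab := B.ne_ad
  ne_ad := B.ne_ab
  ne_bd := B.ne_bd.symm
  mem_iff v := by rw [B.mem_iff]; tauto
  mem_faces := B.mem_faces
  eq := B.eq.symm
  unit := B.eq ▸ B.unit

lemma point_zero [DecidableEq V] (h : ({B.a, B.b} : Finset V) ∈ K.faces) :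
    B.point ⟨0, by simp⟩ = edgeMid h (Finset.card_pair B.ne_ab) := by
  refine Subtype.ext (funext fun v => ?_)
  rw [point_val]
  by_cases hv : v ∈ ({B.a, B.b} : Finset V)
  · rw [edgeMid_apply _ _ hv]
    simp only [Finset.mem_insert, Finset.mem_singleton] at hv
    rcases hv with rfl | rfl <;> simp
  · rw [Space.apply_eq_zero (edgeMid _ _) (by rwa [supp_edgeMid])]
    simp only [Finset.mem_insert, Finset.mem_singleton, not_or] at hv
    simp [weight, hv]

lemma point_one [DecidableEq V] (h : ({B.a, B.d} : Finset V) ∈ K.faces) :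
    B.point ⟨1, by simp⟩ = edgeMid h (Finset.card_pair B.ne_ad) := by
  refine Eq.trans ?_ (B.swap.point_zero h)
  refine Subtype.ext (funext fun v => ?_)
  simp only [point_val, weight, swap]
  have := B.ne_bd
  split_ifs <;> simp_all

end Bend

/-! ### The graph structure on the midset -/

variable (K c) in
/-- The cells of the midset: an edge crossing each sloped triangle and a vertex on each sloped
edge. -/
def MidCell : ℕ → Type
  | 0 => {s : Finset V // K.IsSloped c s ∧ s.card = 2}
  | 1 => {s : Finset V // K.IsSloped c s ∧ s.card = 3}
  | _ => Empty

/-- A chosen bend of a sloped triangle. -/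
def bend (hc : K.IsHeight c) (s : {s : Finset V // K.IsSloped c s ∧ s.card = 3}) : K.Bend c s.1 :=
  (nonempty_bend hc s.2.1 s.2.2).some

/-- The characteristic maps of the cells of the midset. -/
def midMap (hc : K.IsHeight c) : ∀ n, K.MidCell c n → (Fin n → ℝ) → K.Space
  | 0, s, _ => edgeMid s.2.1.1 s.2.2
  | 1, s, x => (bend hc s).point ⟨unitCoord (x 0), unitCoord_nonneg _, unitCoord_le_one _⟩
  | _ + 2, s, _ => nomatch s

/-- The face carrying a cell of the midset. -/
def MidCell.face : ∀ {n}, K.MidCell c n → Finset V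
  | 0, s => s.1
  | 1, s => s.1
  | _ + 2, s => nomatch s

omit [Fintype V] in
lemma MidCell.card_face : ∀ {n} (s : K.MidCell c n), s.face.card = n + 2
  | 0, s => s.2.2
  | 1, s => s.2.2
  | _ + 2, s => nomatch s

/-- An interior point of a cell remembers the face that the cell crosses, hence the cell; this gives
disjointness of the cells. -/
lemma supp_midMap (hc : K.IsHeight c) : ∀ {n} (s : K.MidCell c n) {x : Fin n → ℝ},
    x ∈ Metric.ball 0 1 → supp (midMap hc n s x).1 = s.face
  | 0, s, _, _ => supp_edgeMid s.2.1.1 s.2.2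
  | 1, s, x, hx => by
    rw [mem_ball_zero_iff, pi_norm_lt_iff one_pos] at hx
    have := abs_lt_one_iff_unitCoord.1 (hx 0)
    exact (bend hc s).supp_point this.1 this.2
  | _ + 2, s, _, _ => nomatch s

omit [Fintype V] in
lemma MidCell.ext : ∀ {n} {s t : K.MidCell c n}, s.face = t.face → s = t
  | 0, _, _, h => Subtype.ext h
  | 1, _, _, h => Subtype.ext h
  | _ + 2, s, _, _ => nomatch s

lemma midMap_mem (hc : K.IsHeight c) : ∀ {n} (s : K.MidCell c n) (x : Fin n → ℝ),
    midMap hc n s x ∈ K.midSet c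
  | 0, s, _ => edgeMid_mem hc s.2.1 s.2.2
  | 1, s, _ => (bend hc s).point_mem hc _
  | _ + 2, s, _ => nomatch s

/-- The cells of the midset. -/
def midFamily (hc : K.IsHeight c) (hcard : ∀ s ∈ K.faces,
  s.card ≤ 3) : CellFamily (K.midSet c) where
  cell := K.MidCell c
  map := midMap hc
  eventually_isEmpty := by
    filter_upwards [Filter.eventually_ge_atTop 2] with n hn
    obtain ⟨n, rfl⟩ := Nat.exists_eq_add_of_le' hn
    exact inferInstanceAs (IsEmpty Empty)
  finite_cell n := Finite.of_injective MidCell.face fun _ _ h => MidCell.ext h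
  continuous_map n s := by
    match n, s with
    | 0, s => exact continuous_const
    | 1, s =>
      exact (bend hc s).continuous_point.comp
        ((continuous_unitCoord.comp (continuous_apply 0)).subtype_mk _)
  eq_of_map_eq n s x hx y hy h := by
    match n, s with
    | 0, s => exact Subsingleton.elim _ _
    | 1, s =>
      rw [mem_ball_zero_iff, pi_norm_lt_iff one_pos] at hx
      rw [mem_closedBall_zero_iff, pi_norm_le_iff_of_nonneg zero_le_one] at hy
      have h1 : unitCoord (x 0) / 2 = unitCoord (y 0) / 2 := by
        have := congrFun (congrArg Subtype.val h) (bend hc s).d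
        simpa only [midMap, Bend.point_val, Bend.weight_d] using this
      rw [unitCoord_eq (hx 0).le, unitCoord_eq (hy 0)] at h1
      funext i
      obtain rfl : i = 0 := by omega
      linarith
  disjoint_cells n s m t := by
    rintro ⟨_, ⟨x, hx, rfl⟩, y, hy, hxy⟩
    have h1 : s.face = t.face := by rw [← supp_midMap hc s hx, ← hxy, supp_midMap hc t hy]
    have h2 := s.card_face
    rw [h1, t.card_face] at h2
    obtain rfl : n = m := by omega
    rw [MidCell.ext h1]
  mapsTo_sphere n s x hx := by
    classical
    match n, s with
    | 0, s =>
      rw [Subsingleton.elim x 0] at hx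
      exact absurd hx (by rw [mem_sphere_zero_iff_norm, norm_zero]; exact zero_ne_one)
    | 1, s =>
      have h1 : |x 0| = 1 := by
        rw [mem_sphere_zero_iff_norm] at hx
        rw [← hx, show x = fun _ => x 0 from funext fun i => by rw [Subsingleton.elim i 0],
          pi_norm_const, Real.norm_eq_abs]
      have hab := (bend hc s).isSloped_ab hc
      have had := (bend hc s).swap.isSloped_ab hc
      simp only [mem_iUnion]
      -- The two ends of the arc are the midpoints of `{a, d}` and of `{a, b}`.
      rcases eq_or_eq_neg_of_abs_eq h1 with h | h
      · refine ⟨0, by omega, ⟨_, had, Finset.card_pair (bend hc s).ne_ad⟩, 0, by simp, ?_⟩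
        refine ((bend hc s).point_one had.1).symm.trans ?_
        simp only [midMap]
        congr 2
        rw [h, unitCoord_eq (by simp)]; norm_num
      · refine ⟨0, by omega, ⟨_, hab, Finset.card_pair (bend hc s).ne_ab⟩, 0, by simp, ?_⟩
        refine ((bend hc s).point_zero hab.1).symm.trans ?_
        simp only [midMap]
        congr 2
        rw [h, unitCoord_eq (by simp)]; norm_num
  iUnion_eq := by
    ext x
    simp only [mem_iUnion]
    constructor
    · rintro ⟨n, s, y, -, rfl⟩
      exact midMap_mem hc s y
    · intro hx
      have hs := isSloped_supp hc hx
      have h3 := hcard _ hs.1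
      have h2 : 2 ≤ (supp x.1).card := by
        obtain ⟨hf, u, hu, v, hv, huv⟩ := hs
        refine Finset.one_lt_card.2 ⟨u, hu, v, hv, ?_⟩
        rintro rfl
        rw [hc.self hf hu] at huv; omega
      have : (supp x.1).card = 2 ∨ (supp x.1).card = 3 := by omega
      rcases this with h | h
      · exact ⟨0, ⟨_, hs, h⟩, 0, by simp, (eq_edgeMid hc hx h).symm⟩
      · obtain ⟨r, hr0, hr1, hr⟩ := (bend hc ⟨_, hs, h⟩).exists_point_eq hc hx rfl
        have hab : |2 * (r : ℝ) - 1| ≤ 1 := by rw [abs_le]; constructor <;> linarith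
        refine ⟨1, ⟨_, hs, h⟩, fun _ => 2 * r - 1, ?_, ?_⟩
        · rw [mem_closedBall_zero_iff, pi_norm_le_iff_of_nonneg zero_le_one]
          exact fun _ => hab
        · refine Eq.trans ?_ hr
          simp only [midMap]
          congr 2
          rw [unitCoord_eq hab]; ring

/-- The midset as a finite graph. -/
def midGraph (hc : K.IsHeight c) (hcard : ∀ s ∈ K.faces, s.card ≤ 3) :
    FiniteGraphStructure (K.midSet c) :=
  (midFamily hc hcard).graph fun n hn => by
    obtain ⟨n, rfl⟩ := Nat.exists_eq_add_of_le' hn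
    exact inferInstanceAs (IsEmpty Empty)

/-- The cooriented regular graph defined by a height difference. -/
def regularGraph (hc : K.IsHeight c) (hcard : ∀ s ∈ K.faces, s.card ≤ 3)
    (hbd : twoBoundary K.Space = ∅) : CoorientedRegularGraph K.Space where
  carrier := K.midSet c
  graph := midGraph hc hcard
  collar := collar hc
  isClosedEmbedding_collar := isClosedEmbedding_collar hc
  collar_zero p := Subtype.ext (funext fun v => by simp [collar_apply])
  isOpen_collar := by
    rw [image_collar]
    exact isOpen_lt continuous_const (continuous_spread c)
  collar_notMem_boundary q := by simp [hbd]

end VertexComplex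

namespace VertexComplex

variable {V : Type} [Fintype V] {K : VertexComplex V} {c : V → V → ℤ}

/-! ### The complexity of the midset -/

section Complexity

variable (K) in
/-- Every edge belongs to at least two triangles. -/
def IsThick : Prop := ∀ u v, u ≠ v → (∃ s ∈ K.faces, u ∈ s ∧ v ∈ s) →
  ∃ a b, a ≠ b ∧ a ≠ u ∧ a ≠ v ∧ b ≠ u ∧ b ≠ v ∧ (∃ s ∈ K.faces, u ∈ s ∧ v ∈ s ∧ a ∈ s) ∧
    ∃ s ∈ K.faces, u ∈ s ∧ v ∈ s ∧ b ∈ s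

/-- The component of the midset that contains the centre of a cell. -/
def midComponent (hc : K.IsHeight c) {n : ℕ} (s : K.MidCell c n) : Set K.Space :=
  connectedComponentIn (K.midSet c) (midMap hc n s 0)

lemma midMap_mem_iff (hc : K.IsHeight c) {n : ℕ} (s : K.MidCell c n) {D : Set K.Space}
    (hD : D ∈ connectedComponentIn (K.midSet c) '' K.midSet c) :
    midMap hc n s 0 ∈ D ↔ midComponent hc s = D := by
  obtain ⟨x, hx, rfl⟩ := hD
  constructor
  · intro h
    exact (connectedComponentIn_eq h).symm
  · intro h
    rw [← h]
    exact mem_connectedComponentIn (midMap_mem hc s 0)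

-- The edge `{b, d}` is level, so an arc of the midset has only the two ends on the edges at `a`.
omit [Fintype V] in
lemma eq_pair_of_subset [DecidableEq V] (hc : K.IsHeight c) {s e : Finset V} (B : K.Bend c s)
    (hes : e ⊆ s) (he : K.IsSloped c e) (h2 : e.card = 2) : e = {B.a, B.b} ∨ e = {B.a, B.d} := by
  obtain ⟨x, y, hxy, rfl⟩ := Finset.card_eq_two.1 h2
  have hx := (B.mem_iff x).1 (hes (by simp))
  have hy := (B.mem_iff y).1 (hes (by simp))
  have hmb : B.b ∈ s := by rw [B.mem_iff]; simp
  have hmd : B.d ∈ s := by rw [B.mem_iff]; simp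
  have hma : B.a ∈ s := by rw [B.mem_iff]; simp
  have h0 := B.eq
  have h1 := hc.add s B.mem_faces _ hma _ hmb _ hmd
  have h3 := hc.swap B.mem_faces hmb hmd
  have h4 := hc.self B.mem_faces hmb
  have h5 := hc.self B.mem_faces hmd
  obtain ⟨-, p, hp, q, hq, hpq⟩ := he
  simp only [Finset.mem_insert, Finset.mem_singleton] at hp hq
  rcases hx with rfl | rfl | rfl <;> rcases hy with rfl | rfl | rfl
  · exact absurd rfl hxy
  · exact Or.inl rfl
  · exact Or.inr rfl
  · exact Or.inl (Finset.pair_comm _ _)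
  · exact absurd rfl hxy
  · rcases hp with rfl | rfl <;> rcases hq with rfl | rfl <;> omega
  · exact Or.inr (Finset.pair_comm _ _)
  · rcases hp with rfl | rfl <;> rcases hq with rfl | rfl <;> omega
  · exact absurd rfl hxy

lemma midComponent_eq (hc : K.IsHeight c) (e : K.MidCell c 0) (s : K.MidCell c 1)
    (h : e.face ⊆ s.face) : midComponent hc e = midComponent hc s := by
  classical
  have hmem : midMap hc 0 e 0 ∈ range (bend hc s).point := by
    rcases eq_pair_of_subset hc (bend hc s) h e.2.1 e.2.2 with h1 | h1
    · refine ⟨⟨0, by simp⟩, ?_⟩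
      rw [(bend hc s).point_zero (h1 ▸ e.2.1.1)]
      simp only [midMap]
      congr 1
      exact h1.symm
    · refine ⟨⟨1, by simp⟩, ?_⟩
      rw [(bend hc s).point_one (h1 ▸ e.2.1.1)]
      simp only [midMap]
      congr 1
      exact h1.symm
  have hs : midMap hc 1 s 0 ∈ range (bend hc s).point := ⟨_, rfl⟩
  have hpre : IsPreconnected (range (bend hc s).point) :=
    isPreconnected_range (bend hc s).continuous_point
  refine connectedComponentIn_eq (hpre.subset_connectedComponentIn hmem ?_ hs)
  rintro _ ⟨r, rfl⟩
  exact (bend hc s).point_mem hc r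

-- Every triangle containing a sloped edge is sloped, so thickness makes each vertex of the midset
-- an end of two different arcs.
omit [Fintype V] in
lemma exists_two_midCells (hthick : K.IsThick) (e : K.MidCell c 0) :
    ∃ s t : K.MidCell c 1, s ≠ t ∧ e.face ⊆ s.face ∧ e.face ⊆ t.face := by
  classical
  obtain ⟨e, ⟨he, p, hp, q, hq, hpq⟩, h2⟩ := e
  obtain ⟨u, v, huv, rfl⟩ := Finset.card_eq_two.1 h2
  obtain ⟨a, b, hab, hau, hav, hbu, hbv, ⟨s, hs, hsu, hsv, hsa⟩, t, ht, htu, htv, htb⟩ :=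
    hthick u v huv ⟨_, he, by simp, by simp⟩
  have key : ∀ w, w ≠ u → w ≠ v → ∀ s ∈ K.faces, u ∈ s → v ∈ s → w ∈ s →
      K.IsSloped c {w, u, v} ∧ ({w, u, v} : Finset V).card = 3 := by
    intro w hwu hwv s hs hu hv hw
    refine ⟨⟨K.mem_of_subset s hs _ ?_ (by simp), p, Finset.mem_insert_of_mem hp, q,
      Finset.mem_insert_of_mem hq, hpq⟩, ?_⟩
    · intro z hz
      simp only [Finset.mem_insert, Finset.mem_singleton] at hz
      rcases hz with rfl | rfl | rfl <;> assumption
    · rw [Finset.card_insert_of_notMem (by simp [hwu, hwv]), h2]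
  refine ⟨⟨_, key a hau hav s hs hsu hsv hsa⟩, ⟨_, key b hbu hbv t ht htu htv htb⟩, ?_,
    Finset.subset_insert _ _, Finset.subset_insert _ _⟩
  intro h
  have h1 : ({a, u, v} : Finset V) = {b, u, v} := congrArg Subtype.val h
  have h2 : a ∈ ({b, u, v} : Finset V) := by rw [← h1]; simp
  simp [hab, hau, hav] at h2

/-- Edges of the midset are at least as numerous as vertices, in each component; the total
difference is the complexity. -/
theorem complexity_midGraph_add_le (hc : K.IsHeight c) (hcard : ∀ s ∈ K.faces, s.card ≤ 3)
    (hthick : K.IsThick) :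
    (midGraph hc hcard).complexity + Nat.card (K.MidCell c 0) ≤ Nat.card (K.MidCell c 1) := by
  classical
  have f0 : Finite (K.MidCell c 0) := (midFamily hc hcard).finite_cell 0
  have f1 : Finite (K.MidCell c 1) := (midFamily hc hcard).finite_cell 1
  have : Fintype (K.MidCell c 0) := Fintype.ofFinite _
  have : Fintype (K.MidCell c 1) := Fintype.ofFinite _
  let E (D : Set K.Space) : Finset (K.MidCell c 0) := {e | midComponent hc e = D}
  let T (D : Set K.Space) : Finset (K.MidCell c 1) := {e | midComponent hc e = D}
  have hET : ∀ D, (E D).card ≤ (T D).card := by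
    intro D
    -- Double counting of incidences in one component: at least two arcs at each vertex, at most two
    -- vertices on each arc. An arc and its ends lie in the same component.
    have := Finset.card_mul_le_card_mul (s := E D) (t := T D) (m := 2) (n := 2)
      (fun e s => e.face ⊆ s.face) (fun e he => ?_) (fun s hs => ?_)
    · omega
    · obtain ⟨s, t, hst, h1, h2⟩ := exists_two_midCells hthick e
      have he' : midComponent hc e = D := by simpa [E] using he
      rw [← Finset.card_pair hst]
      refine Finset.card_le_card fun z hz => ?_
      rw [Finset.mem_bipartiteAbove]
      simp only [Finset.mem_insert, Finset.mem_singleton] at hz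
      rcases hz with rfl | rfl
      · exact ⟨by simp [T, ← midComponent_eq hc e _ h1, he'], h1⟩
      · exact ⟨by simp [T, ← midComponent_eq hc e _ h2, he'], h2⟩
    · let B := bend hc s
      refine (Finset.card_le_card_of_injOn (t := {({B.a, B.b} : Finset V), {B.a, B.d}})
        (MidCell.face) (fun e he => ?_) fun e _ e' _ h => MidCell.ext h).trans Finset.card_le_two
      have h1 : e.face ⊆ s.face := ((Finset.mem_bipartiteBelow _).1 he).2
      simpa using eq_pair_of_subset hc B h1 e.2.1 e.2.2
  have hval : ∀ D ∈ connectedComponentIn (K.midSet c) '' K.midSet c,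
      (-(midGraph hc hcard).eulerChar D).toNat = (T D).card - (E D).card := by
    intro D hD
    have h0 : Nat.card {v : K.MidCell c 0 // midMap hc 0 v 0 ∈ D} = (E D).card := by
      rw [Nat.card_congr (Equiv.subtypeEquivRight fun v => midMap_mem_iff hc v hD),
        Nat.card_eq_fintype_card, Fintype.card_subtype]
    have h1 : Nat.card {v : K.MidCell c 1 // midMap hc 1 v 0 ∈ D} = (T D).card := by
      rw [Nat.card_congr (Equiv.subtypeEquivRight fun v => midMap_mem_iff hc v hD),
        Nat.card_eq_fintype_card, Fintype.card_subtype]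
    have h2 : (midGraph hc hcard).eulerChar D =
      (Nat.card {v : K.MidCell c 0 // midMap hc 0 v 0 ∈ D} : ℤ) -
        Nat.card {v : K.MidCell c 1 // midMap hc 1 v 0 ∈ D} := rfl
    rw [h2, h0, h1]
    omega
  -- Components that contain an arc suffice: every vertex is on an arc, and a component without arcs
  -- contributes 0.
  let F : Finset (Set K.Space) := Finset.univ.image fun s : K.MidCell c 1 => midComponent hc s
  have hF : ∀ s : K.MidCell c 1, midComponent hc s ∈ F := fun s =>
    Finset.mem_image_of_mem _ (Finset.mem_univ s)
  have hsum : (midGraph hc hcard).complexity = ∑ D ∈ F, ((T D).card - (E D).card) := by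
    rw [FiniteGraphStructure.complexity, finsum_mem_congr rfl hval]
    refine finsum_mem_eq_sum_of_inter_support_eq _ (Set.ext fun D => ?_)
    simp only [mem_inter_iff, Function.mem_support]
    refine and_congr_left fun hD => ?_
    have h1 : (T D).Nonempty := by
      rw [← Finset.card_pos]; omega
    obtain ⟨s, hs⟩ := h1
    have hs' : midComponent hc s = D := by simpa [T] using hs
    exact iff_of_true ⟨_, midMap_mem hc s 0, hs'⟩ (hs' ▸ hF s)
  have hT : Nat.card (K.MidCell c 1) = ∑ D ∈ F, (T D).card := by
    rw [Nat.card_eq_fintype_card, ← Finset.card_univ]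
    exact Finset.card_eq_sum_card_fiberwise fun s _ => hF s
  have hE : Nat.card (K.MidCell c 0) = ∑ D ∈ F, (E D).card := by
    rw [Nat.card_eq_fintype_card, ← Finset.card_univ]
    refine Finset.card_eq_sum_card_fiberwise fun e _ => ?_
    obtain ⟨s, t, -, h1, -⟩ := exists_two_midCells hthick e
    rw [midComponent_eq hc e s h1]
    exact hF s
  rw [hsum, hT, hE, ← Finset.sum_add_distrib]
  refine Finset.sum_le_sum fun D _ => ?_
  have := hET D
  omega

end Complexity

end VertexComplex

/-! ### The collapse map -/

/-- The map is glued from two closed sets, the closed collar and the complement of the open one.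
They overlap where the parameter is `-1` or `1`, and both values are 0 in the circle. -/
lemma CoorientedRegularGraph.continuous_collapse {X : Type*} [TopologicalSpace X]
    (Γ : CoorientedRegularGraph X) : Continuous Γ.collapse := by
  have hinj := Γ.isClosedEmbedding_collar.injective
  let A : Set X := range Γ.collar
  let B : Set X := (Γ.collar '' {q | -1 < (q.2 : ℝ) ∧ (q.2 : ℝ) < 1})ᶜ
  have hA : IsClosed A := Γ.isClosedEmbedding_collar.isClosed_range
  have hB : IsClosed B := Γ.isOpen_collar.isClosed_compl
  have hAB : A ∪ B = univ := by
    rw [← univ_subset_iff]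
    intro x _
    by_cases hx : x ∈ A
    · exact Or.inl hx
    · exact Or.inr fun ⟨q, _, hq⟩ => hx ⟨q, hq⟩
  rw [← continuousOn_univ, ← hAB]
  refine ContinuousOn.union_of_isClosed ?_ ?_ hA hB
  · rw [continuousOn_iff_continuous_domRestrict]
    let e := Γ.isClosedEmbedding_collar.isEmbedding.toHomeomorph
    rw [← e.symm.symm.comp_continuous_iff']
    have : A.domRestrict Γ.collapse ∘ e =
        fun q => ((((q.2 : ℝ) + 1) / 2 : ℝ) : AddCircle (1 : ℝ)) := by
      funext q
      change Γ.collapse (Γ.collar q) = _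
      rw [collapse, hinj.extend_apply]
    change Continuous (A.domRestrict Γ.collapse ∘ e)
    rw [this]
    exact (AddCircle.continuous_mk' (1 : ℝ)).comp (by fun_prop)
  · refine (continuousOn_const (c := (0 : AddCircle (1 : ℝ)))).congr fun x hx => ?_
    by_cases hxA : x ∈ A
    · obtain ⟨q, rfl⟩ := hxA
      rw [collapse, hinj.extend_apply]
      have h1 : ¬ (-1 < (q.2 : ℝ) ∧ (q.2 : ℝ) < 1) := fun h => hx ⟨q, h, rfl⟩
      have h2 := q.2.2.1
      have h3 := q.2.2.2
      rcases h2.eq_or_lt with h2 | h2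
      · rw [← h2]; simp
      · have : (q.2 : ℝ) = 1 := by
          by_contra hne
          exact h1 ⟨h2, lt_of_le_of_ne h3 hne⟩
        rw [this]
        norm_num
    · rw [collapse, Function.extend_apply' _ _ _ hxA]

namespace VertexComplex

variable {V : Type} [Fintype V] {K : VertexComplex V} {c : V → V → ℤ}

section Represents

variable (hc : K.IsHeight c) (hcard : ∀ s ∈ K.faces, s.card ≤ 3) (hbd : twoBoundary K.Space = ∅)

/-- In the collar the parameter is `4 t - 2` for the top weight `t`. Outside it, `unitCoord` is 0 or
1, both trivial in the circle; for the same reason the jump of `t` between 0 and 1 is harmless. -/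
lemma collapse_regularGraph (x : K.Space) : (regularGraph hc hcard hbd).collapse x =
    (unitCoord (4 * topWeight c x.1 - 2) : AddCircle (1 : ℝ)) := by
  have hinj := injective_collar hc
  have hval : ∀ q, (regularGraph hc hcard hbd).collapse (collar hc q) =
      ((((q.2 : ℝ) + 1) / 2 : ℝ) : AddCircle (1 : ℝ)) := fun q => hinj.extend_apply _ _ q
  by_cases hx : x ∈ range (collar hc)
  · obtain ⟨q, rfl⟩ := hx
    rw [hval, topWeight_collar, unitCoord_eq]
    · congr 1; ring
    · have := q.2.2.1
      have := q.2.2.2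
      rw [abs_le]; constructor <;> linarith
  · have h0 : (regularGraph hc hcard hbd).collapse x = 0 := Function.extend_apply' _ _ _ hx
    rw [h0]
    have : ¬ topWeight c x.1 ∈ Icc (1 / 4 : ℝ) (3 / 4) := fun h => by
      obtain ⟨q, hq, -⟩ := exists_collar_eq hc h
      exact hx ⟨q, hq⟩
    rw [mem_Icc, not_and_or, not_le, not_le] at this
    rcases this with h | h
    · have : unitCoord (4 * topWeight c x.1 - 2) = 0 := by
        rw [unitCoord, max_eq_left]
        exact (min_le_right _ _).trans (by linarith)
      rw [this]; rfl
    · have : unitCoord (4 * topWeight c x.1 - 2) = 1 := by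
        rw [unitCoord, min_eq_left (by linarith), max_eq_right zero_le_one]
      rw [this]
      exact (AddCircle.coe_period 1).symm

lemma unitCoord_neg (y : ℝ) : unitCoord (-y) = 1 - unitCoord y := by
  simp only [unitCoord, max_def, min_def]
  split_ifs <;> linarith

variable (hV : ∀ v, {v} ∈ K.faces)

/-- The top weight at parameter `r` inside a sloped edge is `r` when rising and `1 - r` when
falling, and it is 0 on a level edge. The formula is a real lift that changes by `c u v` from one
end to the other. -/
lemma collapse_line {u v : V} (h : K.Adj u v) (r : I) :
    (regularGraph hc hcard hbd).collapse (line (h.near hV) r) =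
      ((c u v * unitCoord (4 * r - 2) : ℝ) : AddCircle (1 : ℝ)) := by
  classical
  obtain ⟨s, hs, hu, hv⟩ := id h
  rw [collapse_regularGraph]
  set x := line (h.near hV) r with hx
  have hxv : ∀ w, x.1 w = (1 - r) * (vertex u (hV u)).1 w + r * (vertex v (hV v)).1 w := fun w => rfl
  have hsupp : ∀ w ∈ supp x.1, w = u ∨ w = v := by
    intro w hw
    by_contra hne
    push Not at hne
    rw [mem_supp, hxv, vertex_apply_of_ne _ _ hne.1, vertex_apply_of_ne _ _ hne.2] at hw
    simp at hw
  have hus := hc.self hs hu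
  have hvs := hc.self hs hv
  have hsw := hc.swap hs hu hv
  have hle := hc.le_one s hs u hu v hv
  have hle' := hc.le_one s hs v hv u hu
  have hhigh : (∀ w, IsHigh c (supp x.1) w → w ∈ supp x.1 → c u v = 1 ∧ w = v ∧ u ∈ supp x.1 ∨
      c u v = -1 ∧ w = u ∧ v ∈ supp x.1) := by
    rintro w ⟨z, hz, hzw⟩ hw
    rcases hsupp z hz with rfl | rfl <;> rcases hsupp w hw with rfl | rfl
    · omega
    · exact Or.inl ⟨hzw, rfl, hz⟩
    · exact Or.inr ⟨by omega, rfl, hz⟩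
    · omega
  have hr0 := r.2.1
  have hr1 := r.2.2
  have hzero : (∀ w ∈ supp x.1, ¬ IsHigh c (supp x.1) w) → topWeight c x.1 = 0 := by
    intro h
    refine Finset.sum_eq_zero fun w _ => ?_
    split_ifs with hw
    · exact x.apply_eq_zero fun h' => h w h' hw
    · rfl
  have hcoe0 : ((0 : ℝ) : AddCircle (1 : ℝ)) = 0 := rfl
  have hcoe1 : ((1 : ℝ) : AddCircle (1 : ℝ)) = 0 := AddCircle.coe_period 1
  have e0 : unitCoord (4 * 0 - 2) = 0 := by simp only [unitCoord]; norm_num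
  have e1 : unitCoord (4 * 1 - 2) = 1 := by simp only [unitCoord]; norm_num
  by_cases hmid : (r : ℝ) ≠ 0 ∧ (r : ℝ) ≠ 1 ∧ c u v ≠ 0
  · obtain ⟨h0, h1, hcuv⟩ := hmid
    have huv : u ≠ v := by rintro rfl; exact hcuv hus
    have hxu : x.1 u = 1 - r := by
      rw [hxv, vertex_apply_self, vertex_apply_of_ne _ _ huv]; ring
    have hxv' : x.1 v = r := by
      rw [hxv, vertex_apply_self, vertex_apply_of_ne _ _ huv.symm]; ring
    have hus' : u ∈ supp x.1 := by
      rw [mem_supp, hxu]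
      intro h
      exact h1 (by linarith)
    have hvs' : v ∈ supp x.1 := by rw [mem_supp, hxv']; exact h0
    have : c u v = 1 ∨ c u v = -1 := by omega
    rcases this with h1 | h1
    · have ht : topWeight c x.1 = r := by
        rw [topWeight, Finset.sum_eq_single v, if_pos ⟨u, hus', h1⟩, hxv']
        · intro w _ hw
          split_ifs with h2
          · refine x.apply_eq_zero fun h3 => ?_
            rcases hhigh w h2 h3 with ⟨-, h, -⟩ | ⟨h, -⟩
            · exact hw h
            · omega
          · rfl
        · simp
      rw [ht, h1]; simp
    · have ht : topWeight c x.1 = 1 - r := by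
        rw [topWeight, Finset.sum_eq_single u, if_pos ⟨v, hvs', by omega⟩, hxu]
        · intro w _ hw
          split_ifs with h2
          · refine x.apply_eq_zero fun h3 => ?_
            rcases hhigh w h2 h3 with ⟨h, -, -⟩ | ⟨-, h, -⟩
            · omega
            · exact hw h
          · rfl
        · simp
      rw [ht, h1, show 4 * (1 - (r : ℝ)) - 2 = -(4 * r - 2) by ring, unitCoord_neg]
      have : (1 - unitCoord (4 * r - 2) : ℝ) = 1 + (((-1 : ℤ) : ℝ) * unitCoord (4 * r - 2)) := by
        push_cast; ring
      rw [this, AddCircle.coe_add, hcoe1, zero_add]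
  -- At an end point of the edge, or on a level edge, the support has no high vertex; the right side
  -- is an integer there.
  · have ht : topWeight c x.1 = 0 := by
      refine hzero fun w hw hh => hmid ?_
      have hr : u ≠ v → u ∈ supp x.1 → v ∈ supp x.1 → (r : ℝ) ≠ 0 ∧ (r : ℝ) ≠ 1 := by
        intro huv h1 h2
        rw [mem_supp, hxv, vertex_apply_self, vertex_apply_of_ne _ _ huv] at h1
        rw [mem_supp, hxv, vertex_apply_self, vertex_apply_of_ne _ _ huv.symm] at h2
        constructor
        · intro h; simp [h] at h2
        · intro h; simp [h] at h1
      rcases hhigh w hh hw with ⟨h1, rfl, h3⟩ | ⟨h1, rfl, h3⟩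
      · have huv : u ≠ w := by rintro rfl; omega
        exact ⟨(hr huv h3 hw).1, (hr huv h3 hw).2, by omega⟩
      · have huv : w ≠ v := by rintro rfl; omega
        exact ⟨(hr huv hw h3).1, (hr huv hw h3).2, by omega⟩
    rw [ht, e0, hcoe0]
    by_cases h1 : (r : ℝ) = 0
    · rw [h1, e0, mul_zero]; rfl
    by_cases h2 : (r : ℝ) = 1
    · rw [h2, e1, mul_one]
      have := AddCircle.coe_eq_zero_iff (p := (1 : ℝ)) (x := ((c u v : ℤ) : ℝ))
      exact (this.2 ⟨c u v, by simp⟩).symm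
    · have : c u v = 0 := by
        by_contra h3
        exact hmid ⟨h1, h2, h3⟩
      rw [this]; simp

/-- The lifts over the edges are concatenated, each translated by the integer gain reached so far.
-/
lemma exists_lift_of_isEdgeWalk {v₀ v : V}
    {q : Path.Homotopic.Quotient (vertex v₀ (hV v₀)) (vertex v (hV v))} {a : Multiplicative ℤ}
    (h : IsEdgeWalk hV (fun u v => Multiplicative.ofAdd (c u v)) v₀ v q a) :
    ∃ p : Path (vertex v₀ (hV v₀)) (vertex v (hV v)), Path.Homotopic.Quotient.mk p = q ∧
      ∃ g : Path (0 : ℝ) (a.toAdd : ℤ), ∀ t,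
        ((g t : ℝ) : AddCircle (1 : ℝ)) = (regularGraph hc hcard hbd).collapse (p t) := by
  have e0 : unitCoord (4 * 0 - 2) = 0 := by simp only [unitCoord]; norm_num
  have e1 : unitCoord (4 * 1 - 2) = 1 := by simp only [unitCoord]; norm_num
  induction h with
  | nil =>
    refine ⟨Path.refl _, rfl, (Path.refl 0).cast rfl (by simp), fun t => ?_⟩
    have := collapse_line hc hcard hbd hV (u := v₀) (v := v₀) ⟨_, hV v₀, by simp, by simp⟩ 0
    rw [Path.source] at this
    simp only [Path.cast_coe, Path.refl_apply]
    rw [this, Icc.coe_zero, e0, mul_zero]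
  | @cons u v q a _ hadj ih =>
    obtain ⟨p, rfl, g, hg⟩ := ih
    let g' : Path ((a.toAdd : ℤ) : ℝ) ((a * Multiplicative.ofAdd (c u v)).toAdd : ℤ) :=
      { toFun := fun r => (a.toAdd : ℤ) + c u v * unitCoord (4 * r - 2)
        continuous_toFun := continuous_const.add (continuous_const.mul
          (continuous_unitCoord.comp (by fun_prop)))
        source' := by rw [Icc.coe_zero, e0, mul_zero, add_zero]
        target' := by rw [Icc.coe_one, e1, mul_one, toAdd_mul, toAdd_ofAdd, Int.cast_add] }
    refine ⟨p.trans (line (hadj.near hV)), rfl, g.trans g', fun t => ?_⟩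
    rw [Path.trans_apply, Path.trans_apply]
    split_ifs with ht
    · exact hg _
    · rw [collapse_line hc hcard hbd hV hadj]
      change ((((a.toAdd : ℤ) : ℝ) + _ : ℝ) : AddCircle (1 : ℝ)) = _
      rw [AddCircle.coe_add, (AddCircle.coe_eq_zero_iff (p := (1 : ℝ))
        (x := ((a.toAdd : ℤ) : ℝ))).2 ⟨_, by simp; rfl⟩, zero_add]

/-- The degree is a homotopy invariant, so a loop may be exchanged for a homotopic edge path, on
which the increment of the lift is the gain. -/
theorem represents_regularGraph {v₀ : V} {ψ : IntegralClass K.Space (vertex v₀ (hV v₀))}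
    (hψ : ∀ q, IsEdgeWalk hV (fun u v => Multiplicative.ofAdd (c u v)) v₀ v₀ q
      (ψ (FundamentalGroup.fromPath q))) : (regularGraph hc hcard hbd).Represents ψ := by
  intro γ
  let f : C(K.Space, AddCircle (1 : ℝ)) :=
    ⟨_, (regularGraph hc hcard hbd).continuous_collapse⟩
  obtain ⟨p, hp, g, hg⟩ := exists_lift_of_isEdgeWalk hc hcard hbd hV (hψ (.mk γ))
  have cov := AddCircle.isCoveringMap_coe (1 : ℝ)
  have hg0 : f (vertex v₀ (hV v₀)) = ((0 : ℝ) : AddCircle (1 : ℝ)) := by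
    have := hg 0
    rw [Path.source, Path.source] at this
    exact this.symm
  have h1 : (f.comp γ.toContinuousMap) 0 = ((0 : ℝ) : AddCircle (1 : ℝ)) := by
    change f (γ 0) = _
    rw [γ.source, hg0]
  have h2 : (f.comp p.toContinuousMap) 0 = ((0 : ℝ) : AddCircle (1 : ℝ)) := by
    change f (p 0) = _
    rw [p.source, hg0]
  have hhom : (f.comp γ.toContinuousMap).HomotopicRel (f.comp p.toContinuousMap) {0, 1} := by
    have : Path.Homotopic γ p := Path.Homotopic.Quotient.eq.1 hp.symm
    exact ContinuousMap.HomotopicRel.comp_continuousMap this f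
  have key := cov.liftPath_apply_one_eq_of_homotopicRel hhom 0 h1 h2
  have hgl : g.toContinuousMap = cov.liftPath (f.comp p.toContinuousMap) 0 h2 :=
    (cov.eq_liftPath_iff' h2).2 ⟨funext hg, g.source⟩
  refine ⟨cov.liftPath (f.comp γ.toContinuousMap) 0 h1,
    fun t => congrFun (cov.liftPath_lifts (f.comp γ.toContinuousMap) 0 h1) t, ?_⟩
  rw [key, ← hgl, cov.liftPath_zero, sub_zero]
  exact g.target

end Represents

end VertexComplex

/-! ### The complex obtained by attaching discs along closed walks -/

section Triple

variable {α : Type*}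

/-- The set of three given elements. -/
def triple (x y z : α) : Finset α := by classical exact {x, y, z}

@[simp] lemma mem_triple {x y z v : α} : v ∈ triple x y z ↔ v = x ∨ v = y ∨ v = z := by
  simp [triple]

lemma card_triple_le (x y z : α) : (triple x y z).card ≤ 3 := by
  classical exact Finset.card_le_three

lemma card_triple {x y z : α} (hxy : x ≠ y) (hxz : x ≠ z) (hyz : y ≠ z) :
    (triple x y z).card = 3 := by
  classical exact Finset.card_eq_three.2 ⟨x, y, z, hxy, hxz, hyz, rfl⟩

end Triple

/-- A finite family of closed walks of length `M` such that each edge is traversed at least twice.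
The number `R` is the radius of the discs to be attached along the walks. -/
structure WalkSystem where
  U : Type
  J : Type
  fintypeU : Fintype U
  fintypeJ : Fintype J
  nonemptyJ : Nonempty J
  M : ℕ
  R : ℕ
  three_le : 3 ≤ M
  R_pos : 0 < R
  w : J → ℕ → U
  periodic : ∀ j p, w j (p + M) = w j p
  ne_succ : ∀ j p, w j p ≠ w j (p + 1)
  exists_eq : ∀ u, ∃ j p, w j p = u
  exists_other : ∀ (j : J) (p : ℕ), ∃ (j' : J) (p' : ℕ), (j' ≠ j ∨ (p' : ZMod M) ≠ (p : ℕ)) ∧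
    (w j' p' = w j p ∧ w j' (p' + 1) = w j (p + 1) ∨ w j' p' = w j (p + 1) ∧ w j' (p' + 1) = w j p)

namespace WalkSystem

attribute [instance] WalkSystem.fintypeU WalkSystem.fintypeJ WalkSystem.nonemptyJ

variable (S : WalkSystem)

instance : NeZero S.M := ⟨by have := S.three_le; omega⟩

/-- The vertices: those of the walks, those of the rings of the discs, and the centres of the
discs. -/
abbrev Vertex : Type := S.U ⊕ (S.J × Fin S.R × ZMod S.M) ⊕ S.J

variable {S}

/-- The vertex of the disc `j` at distance `k` from the boundary and at position `p`. -/
def q (j : S.J) : ℕ → ℕ → S.Vertex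
  | 0, p => .inl (S.w j p)
  | k + 1, p => if h : k < S.R then .inr (.inl (j, ⟨k, h⟩, p)) else .inr (.inr j)

lemma q_zero (j : S.J) (p : ℕ) : q j 0 p = .inl (S.w j p) := rfl

lemma q_succ (j : S.J) {k : ℕ} (h : k < S.R) (p : ℕ) : q j (k + 1) p = .inr (.inl (j, ⟨k, h⟩, p)) :=
  dif_pos h

lemma q_apex (j : S.J) (p : ℕ) : q j (S.R + 1) p = .inr (.inr j) := dif_neg (lt_irrefl _)

lemma q_periodic (j : S.J) (k p : ℕ) : q j k (p + S.M) = q j k p := by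
  cases k with
  | zero => simp [q, S.periodic]
  | succ k => simp [q]

/-- The distance to the boundary. -/
def level : S.Vertex → ℕ
  | .inl _ => 0
  | .inr (.inl (_, k, _)) => k + 1
  | .inr (.inr _) => S.R + 1

lemma level_q (j : S.J) {k : ℕ} (h : k ≤ S.R + 1) (p : ℕ) : level (q j k p) = k := by
  cases k with
  | zero => rfl
  | succ k =>
    rcases (Nat.le_of_succ_le_succ h).eq_or_lt with rfl | h
    · rw [q_apex]; rfl
    · rw [q_succ j h]; rfl

lemma q_ne_of_lt (j j' : S.J) {k k' : ℕ} (h : k < k') (h' : k' ≤ S.R + 1) (p p' : ℕ) :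
    q j k p ≠ q j' k' p' := fun heq => by
  have := congrArg level heq
  rw [level_q j (by omega), level_q j' h'] at this
  omega

lemma q_eq_iff {j j' : S.J} {k : ℕ} (h : k < S.R) {p p' : ℕ} :
    q j (k + 1) p = q j' (k + 1) p' ↔ j = j' ∧ (p : ZMod S.M) = p' := by
  rw [q_succ j h, q_succ j' h]
  simp

lemma one_ne_zero_zmod : (1 : ZMod S.M) ≠ 0 := by
  have := S.three_le
  have h : ((1 : ℕ) : ZMod S.M) ≠ 0 := by
    rw [Ne, ZMod.natCast_eq_zero_iff]
    exact fun h => by have := Nat.le_of_dvd one_pos h; omega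
  simpa using h

lemma two_ne_zero_zmod : (1 + 1 : ZMod S.M) ≠ 0 := by
  have := S.three_le
  have h : ((2 : ℕ) : ZMod S.M) ≠ 0 := by
    rw [Ne, ZMod.natCast_eq_zero_iff]
    exact fun h => by have := Nat.le_of_dvd two_pos h; omega
  norm_num
  exact_mod_cast h

lemma q_ne_succ (j : S.J) {k : ℕ} (h : k ≤ S.R) (p : ℕ) : q j k p ≠ q j k (p + 1) := by
  cases k with
  | zero => exact fun h => S.ne_succ j p (Sum.inl_injective h)
  | succ k =>
    rw [Ne, q_eq_iff (by omega)]
    rintro ⟨-, h⟩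
    push_cast at h
    exact one_ne_zero_zmod (S := S) (by simpa using h)

/-- At least three positions are needed here. It keeps apart the two outer neighbours of a radial
edge at the centre of a disc. -/
lemma q_ne_add_two (j : S.J) {k : ℕ} (h : k < S.R) (p : ℕ) :
    q j (k + 1) p ≠ q j (k + 1) (p + 1 + 1) := by
  rw [Ne, q_eq_iff (by omega)]
  rintro ⟨-, h⟩
  push_cast at h
  refine two_ne_zero_zmod (S := S) ?_
  rw [add_assoc] at h
  simpa using h

/-- The triangles of the discs of the first kind. -/
def t1 (j : S.J) (k p : ℕ) : Finset S.Vertex := triple (q j k p) (q j k (p + 1)) (q j (k + 1) p)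

/-- The triangles of the discs of the second kind. -/
def t2 (j : S.J) (k p : ℕ) : Finset S.Vertex :=
  triple (q j k (p + 1)) (q j (k + 1) p) (q j (k + 1) (p + 1))

variable (S) in
/-- The complex obtained by attaching discs to the walks. -/
def complex : VertexComplex S.Vertex where
  faces := {s | s.Nonempty ∧ ∃ j k p, k ≤ S.R ∧ (s ⊆ t1 j k p ∨ s ⊆ t2 j k p)}
  nonempty_of_mem _ h := h.1
  mem_of_subset := by
    rintro s ⟨-, j, k, p, hk, h⟩ t hts ht
    exact ⟨ht, j, k, p, hk, h.imp hts.trans hts.trans⟩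

lemma t1_mem (j : S.J) {k : ℕ} (hk : k ≤ S.R) (p : ℕ) : t1 j k p ∈ S.complex.faces :=
  ⟨⟨q j k p, by simp [t1]⟩, j, k, p, hk, Or.inl (Finset.Subset.refl _)⟩

lemma t2_mem (j : S.J) {k : ℕ} (hk : k ≤ S.R) (p : ℕ) : t2 j k p ∈ S.complex.faces :=
  ⟨⟨q j k (p + 1), by simp [t2]⟩, j, k, p, hk, Or.inr (Finset.Subset.refl _)⟩

lemma card_t1 (j : S.J) {k : ℕ} (hk : k ≤ S.R) (p : ℕ) : (t1 j k p).card = 3 :=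
  card_triple (q_ne_succ j hk p) (q_ne_of_lt j j (by omega) (by omega) _ _)
    (q_ne_of_lt j j (by omega) (by omega) _ _)

lemma card_t2 (j : S.J) {k : ℕ} (hk : k < S.R) (p : ℕ) : (t2 j k p).card = 3 :=
  card_triple (q_ne_of_lt j j (by omega) (by omega) _ _) (q_ne_of_lt j j (by omega) (by omega) _ _)
    (q_ne_succ j (by omega) p)

/-- At the innermost level two vertices of the second triangle coincide with the centre. -/
lemma t2_subset_t1 (j : S.J) (p : ℕ) : t2 j S.R p ⊆ t1 j S.R p := by
  intro v
  simp only [t1, t2, mem_triple, q_apex]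
  tauto

lemma card_le_three : ∀ s ∈ S.complex.faces, s.card ≤ 3 := by
  rintro s ⟨-, j, k, p, -, h | h⟩
  · exact (Finset.card_le_card h).trans (card_triple_le _ _ _)
  · exact (Finset.card_le_card h).trans (card_triple_le _ _ _)

lemma exists_triangle : ∀ s ∈ S.complex.faces, ∃ t ∈ S.complex.faces, s ⊆ t ∧ t.card = 3 := by
  rintro s ⟨-, j, k, p, hk, h | h⟩
  · exact ⟨_, t1_mem j hk p, h, card_t1 j hk p⟩
  · rcases hk.eq_or_lt with rfl | hk'
    · exact ⟨_, t1_mem j hk p, h.trans (t2_subset_t1 j p), card_t1 j hk p⟩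
    · exact ⟨_, t2_mem j hk p, h, card_t2 j hk' p⟩

lemma exists_face_card_eq_three : ∃ s ∈ S.complex.faces, s.card = 3 :=
  ⟨_, t1_mem S.nonemptyJ.some (Nat.zero_le _) 0, card_t1 _ (Nat.zero_le _) 0⟩

lemma q_val (j : S.J) (k : Fin S.R) (p : ZMod S.M) :
    q j (k + 1) p.val = .inr (.inl (j, k, p)) := by
  rw [q_succ j k.2]; simp

lemma singleton_mem (v : S.Vertex) : {v} ∈ S.complex.faces := by
  have key : ∀ j k p, k ≤ S.R + 1 → {q j k p} ∈ S.complex.faces := by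
    intro j k p hk
    rcases Nat.le_succ_iff.1 hk with hk | rfl
    · exact ⟨Finset.singleton_nonempty _, j, k, p, hk, Or.inl (by simp [t1])⟩
    · exact ⟨Finset.singleton_nonempty _, j, S.R, p, le_rfl, Or.inl (by simp [t1])⟩
  match v with
  | .inl u =>
    obtain ⟨j, p, rfl⟩ := S.exists_eq u
    exact key j 0 p (Nat.zero_le _)
  | .inr (.inl (j, k, p)) =>
    rw [← q_val]
    exact key j _ _ (by omega)
  | .inr (.inr j) =>
    rw [← q_apex j 0]
    exact key j _ _ le_rfl

/-- Positions are natural numbers read modulo `M`, so `p + (M - 1)` serves as `p - 1`, also for `p =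
0`. -/
lemma exists_pred (p : ℕ) : ∃ p', ∀ (j : S.J) k, q j k (p' + 1) = q j k p := by
  refine ⟨p + (S.M - 1), fun j k => ?_⟩
  have := S.three_le
  rw [show p + (S.M - 1) + 1 = p + S.M by omega, q_periodic]

/-- Two triangles with a common edge. -/
structure Opposite (u v a b : S.Vertex) : Prop where
  ab : a ≠ b
  au : a ≠ u
  av : a ≠ v
  bu : b ≠ u
  bv : b ≠ v
  left : ∃ s ∈ S.complex.faces, u ∈ s ∧ v ∈ s ∧ a ∈ s
  right : ∃ s ∈ S.complex.faces, u ∈ s ∧ v ∈ s ∧ b ∈ s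

lemma Opposite.swap {u v a b : S.Vertex} (h : Opposite u v a b) : Opposite v u a b where
  ab := h.ab
  au := h.av
  av := h.au
  bu := h.bv
  bv := h.bu
  left := by obtain ⟨s, hs, h1, h2, h3⟩ := h.left; exact ⟨s, hs, h2, h1, h3⟩
  right := by obtain ⟨s, hs, h1, h2, h3⟩ := h.right; exact ⟨s, hs, h2, h1, h3⟩

/-- A ring edge has a triangle on its inner and on its outer side. An edge of a walk has the
triangle of its own disc and that of another traversal; different traversals give different vertices
of first rings. This is where `exists_other`, and with it goodness of the presentation, enters. -/
lemma exists_opposite_horizontal (j : S.J) {k : ℕ} (hk : k ≤ S.R) (p : ℕ) :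
    ∃ a b, Opposite (q j k p) (q j k (p + 1)) a b := by
  cases k with
  | zero =>
    obtain ⟨j', p', hne, h⟩ := S.exists_other j p
    refine ⟨q j 1 p, q j' 1 p', ?_, ?_, ?_, ?_, ?_, ?_, ?_⟩
    · rw [Ne, q_eq_iff S.R_pos]
      rintro ⟨rfl, h'⟩
      exact hne.elim (fun hj => hj rfl) (fun hp => hp h'.symm)
    · exact (q_ne_of_lt j j (by omega) (by omega) _ _).symm
    · exact (q_ne_of_lt j j (by omega) (by omega) _ _).symm
    · exact (q_ne_of_lt j j' (by omega) (by omega) _ _).symm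
    · exact (q_ne_of_lt j j' (by omega) (by omega) _ _).symm
    · exact ⟨_, t1_mem j (Nat.zero_le _) p, by simp [t1], by simp [t1], by simp [t1]⟩
    · refine ⟨_, t1_mem j' (Nat.zero_le _) p', ?_, ?_, by simp [t1]⟩
      · rcases h with ⟨h1, h2⟩ | ⟨h1, h2⟩ <;> simp [t1, q_zero, h1, h2]
      · rcases h with ⟨h1, h2⟩ | ⟨h1, h2⟩ <;> simp [t1, q_zero, h1, h2]
  | succ k =>
    refine ⟨q j (k + 2) p, q j k (p + 1), ?_, ?_, ?_, ?_, ?_, ?_, ?_⟩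
    · exact (q_ne_of_lt j j (by omega) (by omega) _ _).symm
    · exact (q_ne_of_lt j j (by omega) (by omega) _ _).symm
    · exact (q_ne_of_lt j j (by omega) (by omega) _ _).symm
    · exact q_ne_of_lt j j (by omega) (by omega) _ _
    · exact q_ne_of_lt j j (by omega) (by omega) _ _
    · exact ⟨_, t1_mem j hk p, by simp [t1], by simp [t1], by simp [t1]⟩
    · exact ⟨_, t2_mem j (k := k) (by omega) p, by simp [t2], by simp [t2], by simp [t2]⟩

lemma exists_opposite_vertical (j : S.J) {k : ℕ} (hk : k ≤ S.R) (p : ℕ) :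
    ∃ a b, Opposite (q j k p) (q j (k + 1) p) a b := by
  obtain ⟨p', hp'⟩ := exists_pred (S := S) p
  have h1 : q j k p' ≠ q j k p := by
    rw [← hp' j k]
    exact q_ne_succ j hk p'
  rcases hk.eq_or_lt with rfl | hk'
  · refine ⟨q j S.R (p + 1), q j S.R p', ?_, ?_, ?_, ?_, ?_, ?_, ?_⟩
    · have h2 : q j S.R (p + 1) = q j S.R (p' + 1 + 1) := by
        obtain ⟨k, hk⟩ := Nat.exists_eq_add_of_lt S.R_pos
        rw [zero_add] at hk
        have := hp' j (k + 1)
        rw [hk, q_eq_iff (by omega)]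
        rw [q_eq_iff (by omega)] at this
        refine ⟨rfl, ?_⟩
        have h3 := this.2
        push_cast at h3 ⊢
        rw [h3]
      rw [h2]
      obtain ⟨k, hk⟩ := Nat.exists_eq_add_of_lt S.R_pos
      rw [zero_add] at hk
      rw [hk]
      exact (q_ne_add_two j (by omega) p').symm
    · exact (q_ne_succ j hk p).symm
    · exact q_ne_of_lt j j (by omega) (by omega) _ _
    · exact h1
    · exact q_ne_of_lt j j (by omega) (by omega) _ _
    · exact ⟨_, t1_mem j hk p, by simp [t1], by simp [t1], by simp [t1]⟩
    · refine ⟨_, t1_mem j hk p', ?_, ?_, by simp [t1]⟩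
      · simp [t1, hp']
      · simp [t1, q_apex]
  · refine ⟨q j k (p + 1), q j (k + 1) p', ?_, ?_, ?_, ?_, ?_, ?_, ?_⟩
    · exact q_ne_of_lt j j (by omega) (by omega) _ _
    · exact (q_ne_succ j hk p).symm
    · exact q_ne_of_lt j j (by omega) (by omega) _ _
    · exact (q_ne_of_lt j j (by omega) (by omega) _ _).symm
    · rw [← hp' j (k + 1)]
      exact q_ne_succ j (by omega) p'
    · exact ⟨_, t1_mem j hk p, by simp [t1], by simp [t1], by simp [t1]⟩
    · exact ⟨_, t2_mem j hk p', by simp [t2, hp'], by simp [t2, hp'], by simp [t2]⟩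

lemma exists_opposite_diagonal (j : S.J) {k : ℕ} (hk : k ≤ S.R) (p : ℕ) :
    ∃ a b, Opposite (q j k (p + 1)) (q j (k + 1) p) a b := by
  rcases hk.eq_or_lt with rfl | hk'
  · have := exists_opposite_vertical j hk (p + 1)
    rwa [q_apex] at this ⊢
  · refine ⟨q j k p, q j (k + 1) (p + 1), ?_, ?_, ?_, ?_, ?_, ?_, ?_⟩
    · exact q_ne_of_lt j j (by omega) (by omega) _ _
    · exact q_ne_succ j hk p
    · exact q_ne_of_lt j j (by omega) (by omega) _ _
    · exact (q_ne_of_lt j j (by omega) (by omega) _ _).symm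
    · exact (q_ne_succ j (by omega) p).symm
    · exact ⟨_, t1_mem j hk p, by simp [t1], by simp [t1], by simp [t1]⟩
    · exact ⟨_, t2_mem j hk p, by simp [t2], by simp [t2], by simp [t2]⟩

/-- A symmetric relation that holds for the edges of the discs holds for all adjacent vertices. -/
lemma adj_induction {C : S.Vertex → S.Vertex → Prop} (hrefl : ∀ u, C u u)
    (hswap : ∀ u v, C u v → C v u)
    (hH : ∀ j k p, k ≤ S.R → C (q j k p) (q j k (p + 1)))
    (hV : ∀ j k p, k ≤ S.R → C (q j k p) (q j (k + 1) p))
    (hD : ∀ j k p, k ≤ S.R → C (q j k (p + 1)) (q j (k + 1) p)) {u v : S.Vertex}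
    (h : ∃ s ∈ S.complex.faces, u ∈ s ∧ v ∈ s) : C u v := by
  obtain ⟨s, ⟨-, j, k, p, hk, hs⟩, hu, hv⟩ := h
  have hV' : C (q j k (p + 1)) (q j (k + 1) (p + 1)) := hV j k (p + 1) hk
  have hH' : C (q j (k + 1) p) (q j (k + 1) (p + 1)) := by
    rcases hk.eq_or_lt with rfl | hk
    · rw [q_apex, q_apex]
      exact hrefl _
    · exact hH j (k + 1) p hk
  rcases hs with hs | hs
  · have h1 := hs hu
    have h2 := hs hv
    simp only [t1, mem_triple] at h1 h2
    rcases h1 with rfl | rfl | rfl <;> rcases h2 with rfl | rfl | rfl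
    exacts [hrefl _, hH _ _ _ hk, hV _ _ _ hk, hswap _ _ (hH _ _ _ hk), hrefl _, hD _ _ _ hk,
      hswap _ _ (hV _ _ _ hk), hswap _ _ (hD _ _ _ hk), hrefl _]
  · have h1 := hs hu
    have h2 := hs hv
    simp only [t2, mem_triple] at h1 h2
    rcases h1 with rfl | rfl | rfl <;> rcases h2 with rfl | rfl | rfl
    exacts [hrefl _, hD _ _ _ hk, hV', hswap _ _ (hD _ _ _ hk), hrefl _, hH', hswap _ _ hV',
      hswap _ _ hH', hrefl _]

lemma isThick_complex : S.complex.IsThick := by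
  have key : ∀ u v : S.Vertex, (∃ s ∈ S.complex.faces, u ∈ s ∧ v ∈ s) →
      u ≠ v → ∃ a b, Opposite u v a b := by
    intro u v h
    refine adj_induction (C := fun u v => u ≠ v → ∃ a b, Opposite u v a b)
      (fun u h => absurd rfl h) (fun u v h hne => ?_)
      (fun j k p hk _ => exists_opposite_horizontal j hk p)
      (fun j k p hk _ => exists_opposite_vertical j hk p)
      (fun j k p hk _ => exists_opposite_diagonal j hk p) h
    obtain ⟨a, b, hab⟩ := h hne.symm
    exact ⟨a, b, hab.swap⟩
  intro u v huv h
  obtain ⟨a, b, hab⟩ := key u v h huv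
  exact ⟨a, b, hab.ab, hab.au, hab.av, hab.bu, hab.bv, hab.left, hab.right⟩

end WalkSystem

namespace WalkSystem

variable {S : WalkSystem}

/-! ### The gain on the complex of a walk system -/

section Gain

variable {G : Type} [Group G]

/-- The product of a function on pairs of vertices along the first `p` steps of a walk. -/
def transport (g₀ : S.U → S.U → G) (j : S.J) : ℕ → G
  | 0 => 1
  | p + 1 => transport g₀ j p * g₀ (S.w j p) (S.w j (p + 1))

/-- A gain on the vertices of the walks: a function with trivial product along each walk. -/
structure IsGain (g₀ : S.U → S.U → G) : Prop where
  swap : ∀ u v, g₀ v u = (g₀ u v)⁻¹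
  self : ∀ u, g₀ u u = 1
  transport_eq_one : ∀ j, transport g₀ j S.M = 1

lemma IsGain.transport_periodic {g₀ : S.U → S.U → G} (h : IsGain g₀) (j : S.J) (p : ℕ) :
    transport g₀ j (p + S.M) = transport g₀ j p := by
  induction p with
  | zero => rw [zero_add, h.transport_eq_one]; rfl
  | succ p ih =>
    rw [show p + 1 + S.M = p + S.M + 1 by omega, transport, ih, transport, S.periodic,
      show p + S.M + 1 = p + 1 + S.M by omega, S.periodic]

/-- The gain on the complex of a walk system. -/
def gain (g₀ : S.U → S.U → G) : S.Vertex → S.Vertex → G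
  | .inl u, .inl v => g₀ u v
  | .inl u, .inr (.inl (j, _, p)) => g₀ u (S.w j p.val)
  | .inl _, .inr (.inr _) => 1
  | .inr (.inl (j, _, p)), .inl u => g₀ (S.w j p.val) u
  | .inr (.inl (j, _, p)), .inr (.inl (j', _, p')) =>
    (transport g₀ j p.val)⁻¹ * transport g₀ j' p'.val
  | .inr (.inl (j, _, p)), .inr (.inr _) => (transport g₀ j p.val)⁻¹
  | .inr (.inr _), .inl _ => 1
  | .inr (.inr _), .inr (.inl (j, _, p)) => transport g₀ j p.val
  | .inr (.inr _), .inr (.inr _) => 1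

lemma val_natCast_periodic {X : Type*} {f : ℕ → X} (hf : ∀ p, f (p + S.M) = f p) (p : ℕ) :
    f ((p : ZMod S.M).val) = f p := by
  rw [ZMod.val_natCast]
  exact Function.Periodic.map_mod_nat hf p

/-- The potential of the gain on a disc. -/
def potential (g₀ : S.U → S.U → G) (j : S.J) (k p : ℕ) : G :=
  if k ≤ S.R then transport g₀ j p else 1

section

variable {g₀ : S.U → S.U → G} (hg : IsGain g₀)
include hg

lemma gain_swap (u v : S.Vertex) : gain g₀ v u = (gain g₀ u v)⁻¹ := by
  rcases u with u | ⟨j, k, p⟩ | j <;> rcases v with v | ⟨j', k', p'⟩ | j' <;>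
    simp [gain, ← hg.swap]

lemma gain_self (u : S.Vertex) : gain g₀ u u = 1 := by
  rcases u with u | ⟨j, k, p⟩ | j <;> simp [gain, hg.self]

/-- Over a disc the gain is the coboundary of `potential`. A ring vertex has the same potential as
the boundary vertex on its radius, and the centre has potential 1. This is consistent because the
transport is periodic. -/
lemma gain_vertical (j : S.J) {k : ℕ} (hk : k ≤ S.R) (p : ℕ) :
    gain g₀ (q j k p) (q j (k + 1) p) = (potential g₀ j k p)⁻¹ * potential g₀ j (k + 1) p := by
  have e1 := val_natCast_periodic (S := S) (hg.transport_periodic j) p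
  have e2 := val_natCast_periodic (S := S) (S.periodic j) p
  have hR := S.R_pos
  rw [potential, if_pos hk, potential]
  cases k with
  | zero =>
    rw [q_succ j hR, q_zero, if_pos (by omega)]
    simp only [gain]
    rw [e2, hg.self]; simp
  | succ k =>
    rw [q_succ j hk]
    rcases hk.eq_or_lt with hk' | hk'
    · rw [if_neg (by omega), hk', q_apex]
      simp only [gain]
      rw [e1]; simp
    · rw [if_pos (by omega), q_succ j hk']
      simp only [gain, e1]

lemma gain_horizontal (j : S.J) {k : ℕ} (hk : k ≤ S.R) (p : ℕ) :
    gain g₀ (q j k p) (q j k (p + 1)) = (potential g₀ j k p)⁻¹ * potential g₀ j k (p + 1) := by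
  have e1 := val_natCast_periodic (S := S) (hg.transport_periodic j)
  rw [potential, if_pos hk, potential, if_pos hk]
  cases k with
  | zero => simp [q_zero, gain, transport]
  | succ k =>
    rw [q_succ j hk, q_succ j hk]
    simp only [gain, e1]

lemma gain_diagonal (j : S.J) {k : ℕ} (hk : k ≤ S.R) (p : ℕ) :
    gain g₀ (q j k (p + 1)) (q j (k + 1) p) =
      (potential g₀ j k (p + 1))⁻¹ * potential g₀ j (k + 1) p := by
  have e1 := val_natCast_periodic (S := S) (hg.transport_periodic j)
  have e2 := val_natCast_periodic (S := S) (S.periodic j) p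
  have hR := S.R_pos
  rw [potential, if_pos hk, potential]
  cases k with
  | zero =>
    rw [q_succ j hR, q_zero, if_pos (by omega)]
    simp only [gain, e2, transport]
    rw [hg.swap]; group
  | succ k =>
    rw [q_succ j hk]
    rcases hk.eq_or_lt with hk' | hk'
    · rw [if_neg (by omega), hk', q_apex]
      simp only [gain]
      rw [e1]; simp
    · rw [if_pos (by omega), q_succ j hk']
      simp only [gain, e1]

end

/-- On a triangle, antisymmetry and one product relation already make `θ` a coboundary, with
primitive `θ x`. -/
lemma isCocycle_of_triangles {θ : S.Vertex → S.Vertex → G} (hself : ∀ u, θ u u = 1)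
    (hswap : ∀ u v, θ v u = (θ u v)⁻¹)
    (h1 : ∀ j k p, k ≤ S.R →
      θ (q j k p) (q j k (p + 1)) * θ (q j k (p + 1)) (q j (k + 1) p) = θ (q j k p) (q j (k + 1) p))
    (h2 : ∀ j k p, k ≤ S.R →
      θ (q j k (p + 1)) (q j (k + 1) p) * θ (q j (k + 1) p) (q j (k + 1) (p + 1)) =
        θ (q j k (p + 1)) (q j (k + 1) (p + 1))) : S.complex.IsCocycle θ := by
  have key : ∀ x y z : S.Vertex, θ x y * θ y z = θ x z →
      ∀ u ∈ triple x y z, ∀ v ∈ triple x y z, θ u v = (θ x u)⁻¹ * θ x v := by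
    intro x y z h u hu v hv
    simp only [mem_triple] at hu hv
    rcases hu with rfl | rfl | rfl <;> rcases hv with rfl | rfl | rfl
    · simp [hself]
    · simp [hself]
    · simp [hself]
    · simp [hself, ← hswap]
    · simp [hself]
    · rw [← h]; group
    · simp [hself, ← hswap]
    · rw [← h, hswap v u]; group
    · simp [hself]
  have key' : ∀ x y z : S.Vertex, θ x y * θ y z = θ x z →
      ∀ u ∈ triple x y z, ∀ v ∈ triple x y z, ∀ w ∈ triple x y z, θ u v * θ v w = θ u w := by
    intro x y z h u hu v hv w hw
    rw [key x y z h u hu v hv, key x y z h v hv w hw, key x y z h u hu w hw]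
    group
  rintro s ⟨-, j, k, p, hk, hs | hs⟩ u hu v hv w hw
  · exact key' _ _ _ (h1 j k p hk) _ (hs hu) _ (hs hv) _ (hs hw)
  · exact key' _ _ _ (h2 j k p hk) _ (hs hu) _ (hs hv) _ (hs hw)

lemma gain_inner_horizontal {g₀ : S.U → S.U → G} (hg : IsGain g₀) (j : S.J) {k : ℕ} (hk : k ≤ S.R)
    (p : ℕ) : gain g₀ (q j (k + 1) p) (q j (k + 1) (p + 1)) =
      (potential g₀ j (k + 1) p)⁻¹ * potential g₀ j (k + 1) (p + 1) := by
  rcases hk.eq_or_lt with rfl | hk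
  · rw [q_apex, q_apex, gain_self hg]
    simp [potential]
  · exact gain_horizontal hg j hk p

theorem isCocycle_gain {g₀ : S.U → S.U → G} (hg : IsGain g₀) : S.complex.IsCocycle (gain g₀) := by
  refine isCocycle_of_triangles (gain_self hg) (gain_swap hg) (fun j k p hk => ?_)
    (fun j k p hk => ?_)
  · rw [gain_horizontal hg j hk, gain_diagonal hg j hk, gain_vertical hg j hk]
    group
  · rw [gain_diagonal hg j hk, gain_inner_horizontal hg j hk, gain_vertical hg j hk]
    group

/-! ### Connectedness -/

lemma adj_vertical (j : S.J) {k : ℕ} (hk : k ≤ S.R) (p : ℕ) :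
    S.complex.Adj (q j k p) (q j (k + 1) p) :=
  ⟨_, t1_mem j hk p, by simp [t1], by simp [t1]⟩

lemma adj_horizontal (j : S.J) {k : ℕ} (hk : k ≤ S.R) (p : ℕ) :
    S.complex.Adj (q j k p) (q j k (p + 1)) :=
  ⟨_, t1_mem j hk p, by simp [t1], by simp [t1]⟩

lemma adj_diagonal (j : S.J) {k : ℕ} (hk : k ≤ S.R) (p : ℕ) :
    S.complex.Adj (q j k (p + 1)) (q j (k + 1) p) :=
  ⟨_, t1_mem j hk p, by simp [t1], by simp [t1]⟩

lemma exists_hasGain {g₀ : S.U → S.U → G} {v₀ : S.Vertex}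
    (h : ∀ u, ∃ a, S.complex.HasGain (gain g₀) v₀ (.inl u) a) (v : S.Vertex) :
    ∃ a, S.complex.HasGain (gain g₀) v₀ v a := by
  have key : ∀ j p k, k ≤ S.R + 1 → ∃ a, S.complex.HasGain (gain g₀) v₀ (q j k p) a := by
    intro j p k hk
    induction k with
    | zero => exact h _
    | succ k ih =>
      obtain ⟨a, ha⟩ := ih (by omega)
      exact ⟨_, ha.cons (adj_vertical j (by omega) p)⟩
  match v with
  | .inl u => exact h u
  | .inr (.inl (j, k, p)) =>
    rw [← q_val]
    exact key j _ _ (by omega)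
  | .inr (.inr j) =>
    rw [← q_apex j 0]
    exact key j _ _ le_rfl

end Gain

/-! ### Extension of functions to the discs -/

/-- The function on the vertices defined by functions on the vertices of the walks and on the
discs. -/
def extend {X : Type*} (f₀ : S.U → X) (f : S.J → ℕ → ℕ → X) : S.Vertex → X
  | .inl u => f₀ u
  | .inr (.inl (j, k, p)) => f j (k + 1) p.val
  | .inr (.inr j) => f j (S.R + 1) 0

lemma extend_q {X : Type*} (f₀ : S.U → X) {f : S.J → ℕ → ℕ → X}
    (hf : ∀ j k p, f j k (p + S.M) = f j k p) (hf' : ∀ j p, f j (S.R + 1) p = f j (S.R + 1) 0)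
    (j : S.J) {k : ℕ} (hk : k ≤ S.R) (p : ℕ) : extend f₀ f (q j (k + 1) p) = f j (k + 1) p := by
  rcases hk.eq_or_lt with rfl | hk
  · rw [q_apex, hf']; rfl
  · rw [q_succ j hk]
    exact val_natCast_periodic (S := S) (hf j (k + 1)) p

/-! ### Universality -/

/-- The gain `g₀` is universal for the functions with trivial product along the walks. -/
def IsUniversalGain {G : Type} [Group G] (g₀ : S.U → S.U → G) (u₀ : S.U) : Prop :=
  ∀ (H : Type) [Group H] (θ : S.U → S.U → H),
    (∀ j p, θ (S.w j (p + 1)) (S.w j p) = (θ (S.w j p) (S.w j (p + 1)))⁻¹) →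
    (∀ j, transport θ j S.M = 1) →
    ∃ (F : G →* H) (b : S.U → H), b u₀ = 1 ∧ ∀ j p, θ (S.w j p) (S.w j (p + 1)) =
      (b (S.w j p))⁻¹ * F (g₀ (S.w j p) (S.w j (p + 1))) * b (S.w j (p + 1))

/-- Parallel transport from the boundary to the points of a disc. -/
def radial {H : Type} [Group H] (θ : S.Vertex → S.Vertex → H) (j : S.J) (p : ℕ) : ℕ → H
  | 0 => 1
  | k + 1 => radial θ j p k * θ (q j k p) (q j (k + 1) p)

section

variable {H : Type} [Group H] {θ : S.Vertex → S.Vertex → H} (hθ : S.complex.IsCocycle θ)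
include hθ

lemma cocycle_self (u : S.Vertex) : θ u u = 1 := hθ.self (singleton_mem u) (by simp)

lemma cocycle_swap {u v : S.Vertex} (h : S.complex.Adj u v) : θ v u = (θ u v)⁻¹ := by
  obtain ⟨s, hs, hu, hv⟩ := h
  rw [eq_inv_iff_mul_eq_one, hθ s hs v hv u hu v hv, cocycle_self hθ]

lemma cocycle_t1 (j : S.J) {k : ℕ} (hk : k ≤ S.R) (p : ℕ) :
    θ (q j k p) (q j k (p + 1)) * θ (q j k (p + 1)) (q j (k + 1) p) =
      θ (q j k p) (q j (k + 1) p) :=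
  hθ _ (t1_mem j hk p) _ (by simp [t1]) _ (by simp [t1]) _ (by simp [t1])

lemma cocycle_t2 (j : S.J) {k : ℕ} (hk : k ≤ S.R) (p : ℕ) :
    θ (q j k (p + 1)) (q j (k + 1) p) * θ (q j (k + 1) p) (q j (k + 1) (p + 1)) =
      θ (q j k (p + 1)) (q j (k + 1) (p + 1)) :=
  hθ _ (t2_mem j hk p) _ (by simp [t2]) _ (by simp [t2]) _ (by simp [t2])

/-- The two triangles between consecutive rings transfer a ring edge outwards; iterating, it is the
boundary edge corrected by the radial transports at its ends. -/
lemma cocycle_horizontal (j : S.J) {k : ℕ} (hk : k ≤ S.R + 1) (p : ℕ) :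
    θ (q j k p) (q j k (p + 1)) =
      (radial θ j p k)⁻¹ * θ (q j 0 p) (q j 0 (p + 1)) * radial θ j (p + 1) k := by
  induction k with
  | zero => simp [radial]
  | succ k ih =>
    have h1 := cocycle_t1 hθ j (k := k) (by omega) p
    have h2 := cocycle_t2 hθ j (k := k) (by omega) p
    have h3 := ih (by omega)
    have h4 : θ (q j (k + 1) p) (q j (k + 1) (p + 1)) = (θ (q j k p) (q j (k + 1) p))⁻¹ *
        θ (q j k p) (q j k (p + 1)) * θ (q j k (p + 1)) (q j (k + 1) (p + 1)) := by
      rw [← h2, ← h1]; group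
    rw [h4, h3, radial, radial]
    group

/-- At level `R + 1` the ring is the centre and its edges are trivial, so on the boundary walk the
cocycle is a coboundary of the radial transports. Its product around the walk is therefore trivial.
-/
lemma cocycle_boundary (j : S.J) (p : ℕ) : θ (q j 0 p) (q j 0 (p + 1)) =
    radial θ j p (S.R + 1) * (radial θ j (p + 1) (S.R + 1))⁻¹ := by
  have h := cocycle_horizontal hθ j le_rfl p
  rw [q_apex, q_apex, cocycle_self hθ] at h
  calc θ (q j 0 p) (q j 0 (p + 1)) = radial θ j p (S.R + 1) * ((radial θ j p (S.R + 1))⁻¹ *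
        θ (q j 0 p) (q j 0 (p + 1)) * radial θ j (p + 1) (S.R + 1)) *
        (radial θ j (p + 1) (S.R + 1))⁻¹ := by group
    _ = _ := by rw [← h, mul_one]

omit hθ in
lemma radial_periodic (j : S.J) (p k : ℕ) : radial θ j (p + S.M) k = radial θ j p k := by
  induction k with
  | zero => rfl
  | succ k ih => rw [radial, radial, ih, q_periodic, q_periodic]

lemma transport_cocycle (j : S.J) (p : ℕ) : transport (fun u v => θ (.inl u) (.inl v)) j p =
    radial θ j 0 (S.R + 1) * (radial θ j p (S.R + 1))⁻¹ := by
  induction p with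
  | zero => simp [transport]
  | succ p ih =>
    have h := cocycle_boundary hθ j p
    rw [q_zero, q_zero] at h
    rw [transport, ih, h]
    group

end

/-- The walks determine `F` and `b` on the boundary vertices. On a disc both `θ` and the gain are
coboundaries, so `b` extends as the quotient of their primitives. -/
theorem isUniversal_gain {G : Type} [Group G] {g₀ : S.U → S.U → G} (hg : IsGain g₀) {u₀ : S.U}
    (hu : IsUniversalGain g₀ u₀) : S.complex.IsUniversal (gain g₀) (.inl u₀) := by
  intro H _ θ hθ
  obtain ⟨F, b₀, hb₀, hF⟩ := hu H (fun u v => θ (.inl u) (.inl v))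
    (fun j p => cocycle_swap hθ (adj_horizontal j (Nat.zero_le _) p)) (fun j => by
      have h := radial_periodic (θ := θ) j 0 (S.R + 1)
      rw [zero_add] at h
      rw [transport_cocycle hθ, h, mul_inv_cancel])
  -- A primitive of `θ` on the disc, normalised so that the quotient `f` equals `b₀` at level 0.
  let Φ (j : S.J) (k p : ℕ) : H := F (transport g₀ j p) * b₀ (S.w j p) * radial θ j p k
  let f (j : S.J) (k p : ℕ) : H := (F (potential g₀ j k p))⁻¹ * Φ j k p
  have hΦ0 : ∀ j p, b₀ (S.w j (p + 1)) =
      (F (g₀ (S.w j p) (S.w j (p + 1))))⁻¹ * b₀ (S.w j p) * θ (q j 0 p) (q j 0 (p + 1)) := by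
    intro j p
    rw [q_zero, q_zero, hF]; group
  have hH : ∀ j k p, k ≤ S.R + 1 → θ (q j k p) (q j k (p + 1)) = (Φ j k p)⁻¹ * Φ j k (p + 1) := by
    intro j k p hk
    rw [cocycle_horizontal hθ j hk]
    simp only [Φ]
    rw [hΦ0, transport, map_mul]
    group
  have hV : ∀ j k p, θ (q j k p) (q j (k + 1) p) = (Φ j k p)⁻¹ * Φ j (k + 1) p := by
    intro j k p
    simp only [Φ, radial]
    group
  have hD : ∀ j k p, k ≤ S.R →
      θ (q j k (p + 1)) (q j (k + 1) p) = (Φ j k (p + 1))⁻¹ * Φ j (k + 1) p := by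
    intro j k p hk
    have h1 := cocycle_t1 hθ j hk p
    rw [← eq_inv_mul_iff_mul_eq, hH j k p (by omega), hV] at h1
    rw [h1]; group
  have hf : ∀ j k p, f j k (p + S.M) = f j k p := by
    intro j k p
    simp only [f, Φ, potential, radial_periodic, S.periodic, hg.transport_periodic]
  -- The centre is reached along every radius; `Φ` does not depend on the radius there because `θ`
  -- is trivial from the centre to itself.
  have hf' : ∀ j p, f j (S.R + 1) p = f j (S.R + 1) 0 := by
    intro j p
    induction p with
    | zero => rfl
    | succ p ih =>
      rw [← ih]
      have h1 := hH j (S.R + 1) p le_rfl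
      rw [q_apex, q_apex, cocycle_self hθ, eq_comm, inv_mul_eq_one] at h1
      simp only [f, potential, ← h1]
      simp
  let b := extend b₀ f
  have hb : ∀ j k p, k ≤ S.R + 1 → b (q j k p) = f j k p := by
    intro j k p hk
    cases k with
    | zero =>
      simp only [f, Φ, potential, radial, Nat.zero_le, if_true]
      change b₀ (S.w j p) = _
      group
    | succ k => exact extend_q b₀ hf hf' j (by omega) p
  refine ⟨F, b, hb₀, fun u v h => ?_⟩
  have key := adj_induction
    (C := fun u v => S.complex.Adj u v → θ u v = (b u)⁻¹ * F (gain g₀ u v) * b v)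
    (fun u _ => by rw [cocycle_self hθ, gain_self hg]; simp)
    (fun u v h hvu => by
      have huv : S.complex.Adj u v := by
        obtain ⟨s, hs, h1, h2⟩ := hvu
        exact ⟨s, hs, h2, h1⟩
      rw [cocycle_swap hθ huv, h huv, gain_swap hg u v, map_inv]
      group)
    (fun j k p hk _ => by
      rw [gain_horizontal hg j hk, hH j k p (by omega), hb j k p (by omega), hb j k _ (by omega)]
      simp only [f, map_mul, map_inv]
      group)
    (fun j k p hk _ => by
      rw [gain_vertical hg j hk, hV j k p, hb j k p (by omega), hb j _ _ (by omega)]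
      simp only [f, map_mul, map_inv]
      group)
    (fun j k p hk _ => by
      rw [gain_diagonal hg j hk, hD j k p hk, hb j k _ (by omega), hb j _ _ (by omega)]
      simp only [f, map_mul, map_inv]
      group) h
  exact key h

/-! ### Heights -/

/-- The retraction of the integers to the interval `[-r, r]`. -/
def clamp (r : ℕ) (x : ℤ) : ℤ := max (-r) (min r x)

section Height

variable {G : Type} [Group G] (g₀ : S.U → S.U → G) (ψ : G →* Multiplicative ℤ) (b₀ : S.U → ℤ)

/-- The height along the walk `j`. -/
def walkHeight (j : S.J) (p : ℕ) : ℤ := (ψ (transport g₀ j p)).toAdd + b₀ (S.w j p)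

/-- The height on the discs. -/
def discHeight (j : S.J) (k p : ℕ) : ℤ := clamp (S.R - k) (walkHeight g₀ ψ b₀ j p)

/-- The extension of `b₀` to the complex. -/
def offset : S.Vertex → ℤ :=
  extend b₀ fun j k p => discHeight g₀ ψ b₀ j k p - (ψ (potential g₀ j k p)).toAdd

/-- The height differences on the complex. -/
def heightDiff (u v : S.Vertex) : ℤ :=
  (ψ (gain g₀ u v)).toAdd + offset g₀ ψ b₀ v - offset g₀ ψ b₀ u

/-- The heights along the walks are bounded by the radius of the discs and change by at most one
in each step. -/
structure IsTame : Prop where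
  isGain : IsGain g₀
  bounded : ∀ j p, |walkHeight g₀ ψ b₀ j p| ≤ S.R
  step_le : ∀ j p, |walkHeight g₀ ψ b₀ j (p + 1) - walkHeight g₀ ψ b₀ j p| ≤ 1

variable {g₀ ψ b₀} (h : IsTame g₀ ψ b₀)
include h

lemma IsTame.discHeight_zero (j : S.J) (p : ℕ) :
    discHeight g₀ ψ b₀ j 0 p = walkHeight g₀ ψ b₀ j p := by
  have := abs_le.1 (h.bounded j p)
  simp only [discHeight, clamp]
  omega

omit h in
-- The clamping interval has shrunk to 0 at ring `R`, so every triangle at the centre is level and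
-- can be left out of the count.
lemma discHeight_of_le (j : S.J) {k : ℕ} (hk : S.R ≤ k) (p : ℕ) :
    discHeight g₀ ψ b₀ j k p = 0 := by
  simp only [discHeight, clamp, Nat.sub_eq_zero_of_le hk]
  omega

lemma IsTame.offset_q (j : S.J) {k : ℕ} (hk : k ≤ S.R + 1) (p : ℕ) :
    offset g₀ ψ b₀ (q j k p) = discHeight g₀ ψ b₀ j k p - (ψ (potential g₀ j k p)).toAdd := by
  cases k with
  | zero =>
    rw [h.discHeight_zero]
    simp [walkHeight, potential, offset, q_zero, extend]
  | succ k =>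
    refine extend_q _ (fun j k p => ?_) (fun j p => ?_) j (by omega) p
    · simp only [discHeight, walkHeight, potential, S.periodic, h.isGain.transport_periodic]
    · rw [discHeight_of_le j (by omega), discHeight_of_le j (by omega)]
      simp [potential]

lemma IsTame.heightDiff_horizontal (j : S.J) {k : ℕ} (hk : k ≤ S.R) (p : ℕ) :
    heightDiff g₀ ψ b₀ (q j k p) (q j k (p + 1)) =
      discHeight g₀ ψ b₀ j k (p + 1) - discHeight g₀ ψ b₀ j k p := by
  rw [heightDiff, gain_horizontal h.isGain j hk, h.offset_q j (by omega), h.offset_q j (by omega)]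
  simp only [map_mul, map_inv, toAdd_mul, toAdd_inv]
  ring

lemma IsTame.heightDiff_vertical (j : S.J) {k : ℕ} (hk : k ≤ S.R) (p : ℕ) :
    heightDiff g₀ ψ b₀ (q j k p) (q j (k + 1) p) =
      discHeight g₀ ψ b₀ j (k + 1) p - discHeight g₀ ψ b₀ j k p := by
  rw [heightDiff, gain_vertical h.isGain j hk, h.offset_q j (by omega), h.offset_q j (by omega)]
  simp only [map_mul, map_inv, toAdd_mul, toAdd_inv]
  ring

lemma IsTame.heightDiff_diagonal (j : S.J) {k : ℕ} (hk : k ≤ S.R) (p : ℕ) :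
    heightDiff g₀ ψ b₀ (q j k (p + 1)) (q j (k + 1) p) =
      discHeight g₀ ψ b₀ j (k + 1) p - discHeight g₀ ψ b₀ j k (p + 1) := by
  rw [heightDiff, gain_diagonal h.isGain j hk, h.offset_q j (by omega), h.offset_q j (by omega)]
  simp only [map_mul, map_inv, toAdd_mul, toAdd_inv]
  ring

lemma IsTame.heightDiff_swap (u v : S.Vertex) :
    heightDiff g₀ ψ b₀ v u = - heightDiff g₀ ψ b₀ u v := by
  rw [heightDiff, heightDiff, gain_swap h.isGain u v, map_inv, toAdd_inv]
  ring

lemma IsTame.heightDiff_self (u : S.Vertex) : heightDiff g₀ ψ b₀ u u = 0 := by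
  have := h.heightDiff_swap u u
  omega

/-- Clamping is 1-Lipschitz, and shrinking the interval by one moves only extreme values, by one and
towards 0. On a diagonal edge both changes occur, but they cannot add up to 2. -/
lemma IsTame.abs_heightDiff_le {u v : S.Vertex} (huv : S.complex.Adj u v) :
    |heightDiff g₀ ψ b₀ u v| ≤ 1 := by
  refine adj_induction (C := fun u v => |heightDiff g₀ ψ b₀ u v| ≤ 1)
    (fun u => by rw [h.heightDiff_self]; simp)
    (fun u v huv => by rwa [h.heightDiff_swap u v, abs_neg])
    (fun j k p hk => ?_) (fun j k p hk => ?_) (fun j k p hk => ?_) huv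
  · rw [h.heightDiff_horizontal j hk]
    have := abs_le.1 (h.step_le j p)
    simp only [discHeight, clamp, abs_le]
    omega
  · rw [h.heightDiff_vertical j hk]
    simp only [discHeight, clamp, abs_le]
    omega
  · rw [h.heightDiff_diagonal j hk]
    have := abs_le.1 (h.step_le j p)
    simp only [discHeight, clamp, abs_le]
    omega

theorem IsTame.isHeight : S.complex.IsHeight (heightDiff g₀ ψ b₀) where
  add s hs u hu v hv w hw := by
    simp only [heightDiff]
    rw [← isCocycle_gain h.isGain s hs u hu v hv w hw, map_mul, toAdd_mul]
    ring
  le_one s hs u hu v hv := (abs_le.1 (h.abs_heightDiff_le ⟨s, hs, hu, hv⟩)).2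

end Height

end WalkSystem

namespace WalkSystem

variable {S : WalkSystem}

/-! ### Counting sloped edges and triangles -/

variable (S) in
/-- Indices for the interior vertices of the discs. -/
def positions : Finset (S.J × ℕ × ℕ) :=
  Finset.univ ×ˢ Finset.range S.R ×ˢ Finset.range S.M

lemma sum_positions (f : S.J → ℕ → ℕ → ℕ) : ∑ x ∈ S.positions, f x.1 x.2.1 x.2.2 =
    ∑ j, ∑ k ∈ Finset.range S.R, ∑ p ∈ Finset.range S.M, f j k p := by
  rw [positions, Finset.sum_product]
  exact Finset.sum_congr rfl fun j _ => Finset.sum_product _ _ _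

lemma mem_positions {x : S.J × ℕ × ℕ} : x ∈ S.positions ↔ x.2.1 < S.R ∧ x.2.2 < S.M := by
  simp [positions]

/-- Three neighbours of an interior vertex. -/
def neighbor (x : S.J × ℕ × ℕ) : Fin 3 → S.Vertex :=
  ![q x.1 x.2.1 x.2.2, q x.1 x.2.1 (x.2.2 + 1), q x.1 (x.2.1 + 1) (x.2.2 + 1)]

lemma level_neighbor {x : S.J × ℕ × ℕ} (hx : x ∈ S.positions) (i : Fin 3) :
    level (neighbor x i) = if i = 2 then x.2.1 + 1 else x.2.1 := by
  have := (mem_positions.1 hx).1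
  fin_cases i
  · exact level_q x.1 (k := x.2.1) (by omega) _
  · exact level_q x.1 (k := x.2.1) (by omega) _
  · exact level_q x.1 (k := x.2.1 + 1) (by omega) _

lemma neighbor_injective {x : S.J × ℕ × ℕ} (hx : x ∈ S.positions) :
    Function.Injective (neighbor x) := by
  have hk := (mem_positions.1 hx).1
  have h01 : neighbor x 0 ≠ neighbor x 1 := q_ne_succ x.1 hk.le x.2.2
  intro i i' h
  have h1 := congrArg level h
  rw [level_neighbor hx, level_neighbor hx] at h1
  fin_cases i <;> fin_cases i' <;> first
    | rfl
    | exact absurd h h01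
    | exact absurd h.symm h01
    | (simp at h1)

lemma position_eq {x y : S.J × ℕ × ℕ} (hx : x ∈ S.positions) (hy : y ∈ S.positions)
    (h : q x.1 (x.2.1 + 1) x.2.2 = q y.1 (y.2.1 + 1) y.2.2) : x = y := by
  obtain ⟨j, k, p⟩ := x
  obtain ⟨j', k', p'⟩ := y
  obtain ⟨hk, hp⟩ := mem_positions.1 hx
  obtain ⟨hk', hp'⟩ := mem_positions.1 hy
  simp only at h hk hp hk' hp'
  have h1 := congrArg level h
  rw [level_q _ (by omega), level_q _ (by omega)] at h1
  obtain rfl : k = k' := by omega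
  rw [q_eq_iff hk] at h
  obtain ⟨rfl, h2⟩ := h
  rw [ZMod.natCast_eq_natCast_iff', Nat.mod_eq_of_lt hp, Nat.mod_eq_of_lt hp'] at h2
  rw [h2]

lemma pair_eq_pair {α : Type*} [DecidableEq α] {a b c d : α} (h : ({a, b} : Finset α) = {c, d}) :
    a = c ∧ b = d ∨ a = d ∧ b = c := by
  have := congrArg (fun s : Finset α => (s : Set α)) h
  simp only [Finset.coe_pair] at this
  exact Set.pair_eq_pair_iff.1 this

/-- An interior edge is determined by its interior vertex and the index of the neighbour. -/
lemma interior_edge_injective [DecidableEq S.Vertex] {x y : S.J × ℕ × ℕ} (hx : x ∈ S.positions)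
    (hy : y ∈ S.positions) {i i' : Fin 3}
    (h : ({q x.1 (x.2.1 + 1) x.2.2, neighbor x i} : Finset S.Vertex) =
      {q y.1 (y.2.1 + 1) y.2.2, neighbor y i'}) : x = y ∧ i = i' := by
  obtain ⟨hk, hp⟩ := mem_positions.1 hx
  obtain ⟨hk', hp'⟩ := mem_positions.1 hy
  rcases pair_eq_pair h with ⟨h1, h2⟩ | ⟨h1, h2⟩
  · obtain rfl := position_eq hx hy h1
    exact ⟨rfl, neighbor_injective hx h2⟩
  -- With the ends exchanged both edges would be ring edges on one ring, each one step ahead of the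
  -- other, so 2 would vanish modulo `M`.
  · exfalso
    have l1 := congrArg level h1
    have l2 := congrArg level h2
    rw [level_q _ (by omega), level_neighbor hy] at l1
    rw [level_q _ (by omega), level_neighbor hx] at l2
    have hi : i = 2 := by
      by_contra hi
      rw [if_neg hi] at l2
      split_ifs at l1 <;> omega
    have hi' : i' = 2 := by
      by_contra hi'
      rw [if_neg hi'] at l1
      split_ifs at l2; omega
    subst hi hi'
    simp only [if_true] at l1 l2
    obtain ⟨j, k, p⟩ := x
    obtain ⟨j', k', p'⟩ := y
    simp only [neighbor, Matrix.cons_val] at h1 h2 l1 l2 hk hk'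
    obtain rfl : k = k' := by omega
    rw [q_eq_iff hk] at h1 h2
    have e1 := h1.2
    have e2 := h2.2
    push_cast at e1 e2
    rw [e1, add_assoc] at e2
    exact two_ne_zero_zmod (S := S) (by simpa using e2)

variable {G : Type} [Group G] {g₀ : S.U → S.U → G} {ψ : G →* Multiplicative ℤ} {b₀ : S.U → ℤ}

section

variable (g₀ ψ b₀)

/-- The absolute height difference along the edges of the discs parallel to the boundary. -/
def costH (j : S.J) (k p : ℕ) : ℕ := (heightDiff g₀ ψ b₀ (q j k p) (q j k (p + 1))).natAbs

/-- The absolute height difference along the radial edges of the discs. -/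
def costV (j : S.J) (k p : ℕ) : ℕ := (heightDiff g₀ ψ b₀ (q j k p) (q j (k + 1) p)).natAbs

/-- The absolute height difference along the diagonal edges of the discs. -/
def costD (j : S.J) (k p : ℕ) : ℕ := (heightDiff g₀ ψ b₀ (q j k (p + 1)) (q j (k + 1) p)).natAbs

end

variable (h : IsTame g₀ ψ b₀)
include h

lemma IsTame.isSloped_pair [DecidableEq S.Vertex] {u v : S.Vertex} (huv : S.complex.Adj u v)
    (h0 : heightDiff g₀ ψ b₀ u v ≠ 0) : S.complex.IsSloped (heightDiff g₀ ψ b₀) {u, v} := by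
  obtain ⟨s, hs, hu, hv⟩ := id huv
  refine ⟨S.complex.mem_of_subset s hs _ ?_ (by simp), ?_⟩
  · intro z hz
    simp only [Finset.mem_insert, Finset.mem_singleton] at hz
    rcases hz with rfl | rfl <;> assumption
  · have h1 := abs_le.1 (h.abs_heightDiff_le huv)
    have h2 := h.heightDiff_swap u v
    have : heightDiff g₀ ψ b₀ u v = 1 ∨ heightDiff g₀ ψ b₀ v u = 1 := by omega
    rcases this with h3 | h3
    · exact ⟨u, by simp, v, by simp, h3⟩
    · exact ⟨v, by simp, u, by simp, h3⟩

lemma IsTame.natAbs_eq {u v : S.Vertex} (huv : S.complex.Adj u v) :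
    (heightDiff g₀ ψ b₀ u v).natAbs = if heightDiff g₀ ψ b₀ u v ≠ 0 then 1 else 0 := by
  have h1 := abs_le.1 (h.abs_heightDiff_le huv)
  split_ifs <;> omega

/-- Absolute height differences are 0 or 1, so the sum counts sloped edges. Each ring vertex owns
three edges: the radial and the diagonal one going outwards, and the ring edge to its successor.
These and the edges of the walks are pairwise distinct. -/
lemma IsTame.sum_le_card_edges {ε : Type} [Fintype ε] (src tgt : ε → S.U)
    (hinj : Function.Injective fun e => s(src e, tgt e)) (hne : ∀ e, src e ≠ tgt e)
    (hadj : ∀ e, S.complex.Adj (.inl (src e)) (.inl (tgt e))) :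
    ∑ x ∈ S.positions, (costV g₀ ψ b₀ x.1 x.2.1 x.2.2 + costD g₀ ψ b₀ x.1 x.2.1 x.2.2 +
        costH g₀ ψ b₀ x.1 (x.2.1 + 1) x.2.2) +
      ∑ e, (heightDiff g₀ ψ b₀ (.inl (src e)) (.inl (tgt e))).natAbs ≤
      Nat.card (S.complex.MidCell (heightDiff g₀ ψ b₀) 0) := by
  classical
  let c := heightDiff g₀ ψ b₀
  let r (x : S.J × ℕ × ℕ) : S.Vertex := q x.1 (x.2.1 + 1) x.2.2
  have hr : ∀ x ∈ S.positions, ∀ i, S.complex.Adj (neighbor x i) (r x) := by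
    intro x hx i
    obtain ⟨hk, hp⟩ := mem_positions.1 hx
    fin_cases i
    · exact adj_vertical x.1 hk.le _
    · exact adj_diagonal x.1 hk.le _
    · obtain ⟨s, hs, h1, h2⟩ := adj_horizontal x.1 hk x.2.2
      exact ⟨s, hs, h2, h1⟩
  have hrne : ∀ x ∈ S.positions, ∀ i, neighbor x i ≠ r x := by
    intro x hx i
    obtain ⟨hk, hp⟩ := mem_positions.1 hx
    fin_cases i
    · exact q_ne_of_lt _ _ (by omega) (by omega) _ _
    · exact q_ne_of_lt _ _ (by omega) (by omega) _ _
    · exact (q_ne_succ _ hk _).symm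
  let X : Finset ((S.J × ℕ × ℕ) × Fin 3) :=
    (S.positions ×ˢ Finset.univ).filter fun x => c (neighbor x.1 x.2) (r x.1) ≠ 0
  let Y : Finset ε := Finset.univ.filter fun e => c (.inl (src e)) (.inl (tgt e)) ≠ 0
  have hX : X.card = ∑ x ∈ S.positions, (costV g₀ ψ b₀ x.1 x.2.1 x.2.2 +
      costD g₀ ψ b₀ x.1 x.2.1 x.2.2 + costH g₀ ψ b₀ x.1 (x.2.1 + 1) x.2.2) := by
    rw [Finset.card_filter, Finset.sum_product]
    refine Finset.sum_congr rfl fun x hx => ?_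
    have : ∀ i, (if c (neighbor x i) (r x) ≠ 0 then 1 else 0) = (c (neighbor x i) (r x)).natAbs :=
      fun i => (h.natAbs_eq (hr x hx i)).symm
    simp only [this, Fin.sum_univ_three]
    have h2 : (c (neighbor x 2) (r x)).natAbs = costH g₀ ψ b₀ x.1 (x.2.1 + 1) x.2.2 := by
      rw [costH, ← Int.natAbs_neg, ← h.heightDiff_swap]; rfl
    rw [h2]; rfl
  have hY : Y.card = ∑ e, (c (.inl (src e)) (.inl (tgt e))).natAbs := by
    rw [Finset.card_filter]
    exact Finset.sum_congr rfl fun e _ => (h.natAbs_eq (hadj e)).symm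
  rw [← hX, ← hY, ← Finset.card_disjSum]
  have : Nat.card (S.complex.MidCell c 0) =
      (Finset.univ.filter fun s => S.complex.IsSloped c s ∧ s.card = 2).card := by
    rw [← Fintype.card_subtype, ← Nat.card_eq_fintype_card]; rfl
  rw [this]
  refine Finset.card_le_card_of_injOn
    (Sum.elim (fun x => {r x.1, neighbor x.1 x.2}) fun e => {.inl (src e), .inl (tgt e)}) ?_ ?_
  · intro z hz
    rw [Finset.mem_coe, Finset.mem_filter]
    refine ⟨Finset.mem_univ _, ?_⟩
    rw [Finset.mem_coe, Finset.mem_disjSum] at hz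
    rcases hz with ⟨⟨x, i⟩, hx, rfl⟩ | ⟨e, he, rfl⟩
    · obtain ⟨hx1, hx2⟩ := Finset.mem_filter.1 hx
      have hx3 := (Finset.mem_product.1 hx1).1
      simp only [Sum.elim_inl]
      rw [Finset.pair_comm]
      exact ⟨h.isSloped_pair (hr x hx3 i) hx2, Finset.card_pair (hrne x hx3 i)⟩
    · simp only [Sum.elim_inr]
      exact ⟨h.isSloped_pair (hadj e) (Finset.mem_filter.1 he).2,
        Finset.card_pair fun h => hne e (Sum.inl_injective h)⟩
  · have hmix : ∀ x ∈ S.positions, ∀ i e,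
        ({r x, neighbor x i} : Finset S.Vertex) ≠ {.inl (src e), .inl (tgt e)} := by
      intro x hx i e heq
      have : r x ∈ ({.inl (src e), .inl (tgt e)} : Finset S.Vertex) := by rw [← heq]; simp
      have hl : level (r x) = x.2.1 + 1 := level_q _ (by have := (mem_positions.1 hx).1; omega) _
      simp only [Finset.mem_insert, Finset.mem_singleton] at this
      rcases this with h1 | h1 <;> simp [h1, level] at hl
    have hmem : ∀ x i, (x, i) ∈ X → x ∈ S.positions := fun x i hx =>
      (Finset.mem_product.1 (Finset.mem_filter.1 hx).1).1
    intro z hz z' hz' heq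
    rw [Finset.mem_coe, Finset.mem_disjSum] at hz hz'
    rcases hz with ⟨⟨x, i⟩, hx, rfl⟩ | ⟨e, he, rfl⟩ <;>
      rcases hz' with ⟨⟨x', i'⟩, hx', rfl⟩ | ⟨e', he', rfl⟩
    · obtain ⟨rfl, rfl⟩ := interior_edge_injective (hmem _ _ hx) (hmem _ _ hx') heq
      rfl
    · exact absurd heq (hmix x (hmem _ _ hx) i e')
    · exact absurd heq.symm (hmix x' (hmem _ _ hx') i' e)
    · simp only [Sum.elim_inr] at heq
      have : e = e' := by
        refine hinj (Sym2.eq_iff.2 ?_)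
        simpa using pair_eq_pair heq
      rw [this]

/-- The differences around a triangle cancel, so a single one of them cannot be nonzero. -/
lemma IsTame.heightDiff_triple {x y z : S.Vertex} (hf : triple x y z ∈ S.complex.faces)
    (hs : S.complex.IsSloped (heightDiff g₀ ψ b₀) (triple x y z)) :
    2 ≤ (heightDiff g₀ ψ b₀ x y).natAbs + (heightDiff g₀ ψ b₀ y z).natAbs +
      (heightDiff g₀ ψ b₀ x z).natAbs := by
  have h1 := h.isHeight.add _ hf x (by simp) y (by simp) z (by simp)
  obtain ⟨-, u, hu, v, hv, huv⟩ := hs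
  simp only [mem_triple] at hu hv
  have s1 := h.heightDiff_swap x y
  have s2 := h.heightDiff_swap y z
  have s3 := h.heightDiff_swap x z
  have e1 := h.heightDiff_self x
  have e2 := h.heightDiff_self y
  have e3 := h.heightDiff_self z
  rcases hu with rfl | rfl | rfl <;> rcases hv with rfl | rfl | rfl <;> omega

lemma IsTame.not_isSloped_of_subset (j : S.J) (p : ℕ) {s : Finset S.Vertex}
    (hs : s ⊆ t1 j S.R p) : ¬ S.complex.IsSloped (heightDiff g₀ ψ b₀) s := by
  rintro ⟨-, u, hu, v, hv, huv⟩
  have h1 := h.heightDiff_horizontal j le_rfl p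
  have h2 := h.heightDiff_vertical j le_rfl p
  have h3 := h.heightDiff_diagonal j le_rfl p
  rw [discHeight_of_le j (by omega), discHeight_of_le j (by omega)] at h1 h2 h3
  have s1 := h.heightDiff_swap (q j S.R p) (q j S.R (p + 1))
  have s2 := h.heightDiff_swap (q j S.R p) (q j (S.R + 1) p)
  have s3 := h.heightDiff_swap (q j S.R (p + 1)) (q j (S.R + 1) p)
  have hu := hs hu
  have hv := hs hv
  simp only [t1, mem_triple] at hu hv
  rcases hu with rfl | rfl | rfl <;> rcases hv with rfl | rfl | rfl <;>
    first
    | omega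
    | (rw [h.heightDiff_self] at huv; omega)

/-- Sloped triangles lie outside the innermost level, so after reduction of the position modulo `M`
each is one of the two triangles at some position; each accounts for two units of edge cost. -/
lemma IsTame.card_triangles_le :
    2 * Nat.card (S.complex.MidCell (heightDiff g₀ ψ b₀) 1) ≤
      ∑ x ∈ S.positions,
        ((costH g₀ ψ b₀ x.1 x.2.1 x.2.2 + costD g₀ ψ b₀ x.1 x.2.1 x.2.2 +
          costV g₀ ψ b₀ x.1 x.2.1 x.2.2) +
        (costD g₀ ψ b₀ x.1 x.2.1 x.2.2 + costH g₀ ψ b₀ x.1 (x.2.1 + 1) x.2.2 +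
          costV g₀ ψ b₀ x.1 x.2.1 (x.2.2 + 1))) := by
  classical
  let c := heightDiff g₀ ψ b₀
  let A := S.positions.filter fun x => S.complex.IsSloped c (t1 x.1 x.2.1 x.2.2)
  let B := S.positions.filter fun x => S.complex.IsSloped c (t2 x.1 x.2.1 x.2.2)
  have hT : Nat.card (S.complex.MidCell c 1) =
      (Finset.univ.filter fun s => S.complex.IsSloped c s ∧ s.card = 3).card := by
    rw [← Fintype.card_subtype, ← Nat.card_eq_fintype_card]; rfl
  have hsub : (Finset.univ.filter fun s => S.complex.IsSloped c s ∧ s.card = 3) ⊆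
      A.image (fun x => t1 x.1 x.2.1 x.2.2) ∪ B.image (fun x => t2 x.1 x.2.1 x.2.2) := by
    intro s hs
    obtain ⟨-, hsl, hs3⟩ := Finset.mem_filter.1 hs
    obtain ⟨-, j, k, p, hk, hsub⟩ := hsl.1
    have hkR : k < S.R := by
      refine lt_of_le_of_ne hk ?_
      rintro rfl
      refine h.not_isSloped_of_subset j p ?_ hsl
      exact hsub.elim id fun h => h.trans (t2_subset_t1 j p)
    have hmod : ∀ k, q j k (p % S.M) = q j k p := fun k =>
      Function.Periodic.map_mod_nat (f := q j k) (q_periodic j k) p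
    have hmod1 : ∀ k, q j k (p % S.M + 1) = q j k (p + 1) := fun k =>
      Function.Periodic.map_mod_nat (f := fun p => q j k (p + 1))
        (fun p => by
          beta_reduce
          rw [show p + S.M + 1 = p + 1 + S.M by omega, q_periodic]) p
    have hpos : (j, k, p % S.M) ∈ S.positions :=
      mem_positions.2 ⟨hkR, Nat.mod_lt _ (by have := S.three_le; omega)⟩
    rw [Finset.mem_union, Finset.mem_image, Finset.mem_image]
    rcases hsub with hsub | hsub
    · have hst : t1 j k (p % S.M) = s := by
        rw [t1, hmod, hmod1, hmod]
        exact (Finset.eq_of_subset_of_card_le hsub (by rw [hs3]; exact card_triple_le _ _ _)).symm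
      exact Or.inl ⟨_, Finset.mem_filter.2 ⟨hpos,
        by change S.complex.IsSloped c (t1 j k (p % S.M)); rwa [hst]⟩, hst⟩
    · have hst : t2 j k (p % S.M) = s := by
        rw [t2, hmod, hmod1, hmod1]
        exact (Finset.eq_of_subset_of_card_le hsub (by rw [hs3]; exact card_triple_le _ _ _)).symm
      exact Or.inr ⟨_, Finset.mem_filter.2 ⟨hpos,
        by change S.complex.IsSloped c (t2 j k (p % S.M)); rwa [hst]⟩, hst⟩
  have hle := (Finset.card_le_card hsub).trans (Finset.card_union_le _ _)
  have hA : (A.image fun x => t1 x.1 x.2.1 x.2.2).card ≤ A.card := Finset.card_image_le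
  have hB : (B.image fun x => t2 x.1 x.2.1 x.2.2).card ≤ B.card := Finset.card_image_le
  have hA2 : 2 * A.card ≤ ∑ x ∈ S.positions, (costH g₀ ψ b₀ x.1 x.2.1 x.2.2 +
      costD g₀ ψ b₀ x.1 x.2.1 x.2.2 + costV g₀ ψ b₀ x.1 x.2.1 x.2.2) := by
    rw [Finset.card_filter, Finset.mul_sum]
    refine Finset.sum_le_sum fun x hx => ?_
    split_ifs with hs
    · exact h.heightDiff_triple hs.1 hs
    · simp
  have hB2 : 2 * B.card ≤ ∑ x ∈ S.positions, (costD g₀ ψ b₀ x.1 x.2.1 x.2.2 +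
      costH g₀ ψ b₀ x.1 (x.2.1 + 1) x.2.2 + costV g₀ ψ b₀ x.1 x.2.1 (x.2.2 + 1)) := by
    rw [Finset.card_filter, Finset.mul_sum]
    refine Finset.sum_le_sum fun x hx => ?_
    split_ifs with hs
    · exact h.heightDiff_triple hs.1 hs
    · simp
  rw [Finset.sum_add_distrib, hT]
  omega

/-- The number of sloped triangles minus the number of sloped edges, up to a factor of two. -/
theorem IsTame.two_mul_card_le {ε : Type} [Fintype ε] (src tgt : ε → S.U)
    (hinj : Function.Injective fun e => s(src e, tgt e)) (hne : ∀ e, src e ≠ tgt e)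
    (hadj : ∀ e, S.complex.Adj (.inl (src e)) (.inl (tgt e))) :
    2 * Nat.card (S.complex.MidCell (heightDiff g₀ ψ b₀) 1) +
        2 * ∑ e, (heightDiff g₀ ψ b₀ (.inl (src e)) (.inl (tgt e))).natAbs ≤
      2 * Nat.card (S.complex.MidCell (heightDiff g₀ ψ b₀) 0) +
        ∑ j, ∑ p ∈ Finset.range S.M,
          (walkHeight g₀ ψ b₀ j (p + 1) - walkHeight g₀ ψ b₀ j p).natAbs := by
  have h1 := h.card_triangles_le
  have h2 := h.sum_le_card_edges src tgt hinj hne hadj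
  simp only [Finset.sum_add_distrib] at h1 h2
  -- A cyclic shift of the position: every radial edge borders two triangles.
  have h3 : ∑ x ∈ S.positions, costV g₀ ψ b₀ x.1 x.2.1 (x.2.2 + 1) =
      ∑ x ∈ S.positions, costV g₀ ψ b₀ x.1 x.2.1 x.2.2 := by
    rw [sum_positions (costV g₀ ψ b₀), sum_positions fun j k p => costV g₀ ψ b₀ j k (p + 1)]
    refine Finset.sum_congr rfl fun j _ => Finset.sum_congr rfl fun k _ => ?_
    have e1 := Finset.sum_range_succ (costV g₀ ψ b₀ j k) S.M
    have e2 := Finset.sum_range_succ' (costV g₀ ψ b₀ j k) S.M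
    have e3 : costV g₀ ψ b₀ j k S.M = costV g₀ ψ b₀ j k 0 := by
      have := q_periodic (S := S) j
      have a1 := this k 0
      have a2 := this (k + 1) 0
      rw [zero_add] at a1 a2
      rw [costV, a1, a2]; rfl
    omega
  -- Shifting the ring index by one leaves the boundary ring as the only excess; the innermost ring
  -- is dropped.
  have h4 : ∑ x ∈ S.positions, costH g₀ ψ b₀ x.1 x.2.1 x.2.2 ≤
      ∑ x ∈ S.positions, costH g₀ ψ b₀ x.1 (x.2.1 + 1) x.2.2 +
        ∑ j, ∑ p ∈ Finset.range S.M, costH g₀ ψ b₀ j 0 p := by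
    rw [sum_positions (costH g₀ ψ b₀), sum_positions fun j k p => costH g₀ ψ b₀ j (k + 1) p,
      ← Finset.sum_add_distrib]
    refine Finset.sum_le_sum fun j _ => ?_
    have e1 := Finset.sum_range_succ (fun k => ∑ p ∈ Finset.range S.M, costH g₀ ψ b₀ j k p) S.R
    have e2 := Finset.sum_range_succ' (fun k => ∑ p ∈ Finset.range S.M, costH g₀ ψ b₀ j k p) S.R
    omega
  have h5 : ∑ j, ∑ p ∈ Finset.range S.M, costH g₀ ψ b₀ j 0 p = ∑ j, ∑ p ∈ Finset.range S.M,
      (walkHeight g₀ ψ b₀ j (p + 1) - walkHeight g₀ ψ b₀ j p).natAbs := by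
    refine Finset.sum_congr rfl fun j _ => Finset.sum_congr rfl fun p _ => ?_
    rw [costH, h.heightDiff_horizontal j (Nat.zero_le _), h.discHeight_zero, h.discHeight_zero]
  omega

end WalkSystem

/-! ### Walk systems defined by words -/

section WordProd

variable {ι H : Type} [Group H]

/-- The value of a letter. -/
def letterValue (y : ι → H) (a : ι × Bool) : H := if a.2 then y a.1 else (y a.1)⁻¹

/-- The product of the values of the first letters of a word. -/
def wordProd (y : ι → H) (word : ℕ → ι × Bool) : ℕ → H
  | 0 => 1
  | l + 1 => wordProd y word l * letterValue y (word l)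

end WordProd

open Classical in
/-- A finite family of cyclic words of length `L` such that each letter occurs at least twice. -/
structure WordSystem where
  ι : Type
  J : Type
  fintypeι : Fintype ι
  fintypeJ : Fintype J
  nonemptyJ : Nonempty J
  L : ℕ
  L_pos : 0 < L
  word : J → ℕ → ι × Bool
  periodic : ∀ j l, word j (l + L) = word j l
  two_le : ∀ i, 2 ≤ ∑ j, ∑ l ∈ Finset.range L, if (word j l).1 = i then 1 else 0
  n : ℕ
  two_le_n : 2 ≤ n

namespace WordSystem

attribute [instance] WordSystem.fintypeι WordSystem.fintypeJ WordSystem.nonemptyJ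

variable (W : WordSystem)

open Classical in
/-- The number of occurrences of a letter. -/
def occ (i : W.ι) : ℕ := ∑ j, ∑ l ∈ Finset.range W.L, if (W.word j l).1 = i then 1 else 0

/-- The vertices of a bouquet of circles with `n + 1` edges each. -/
abbrev U : Type := Option (W.ι × Fin W.n)

variable {W}

/-- The vertices along a circle. -/
def point (i : W.ι) : ℕ → W.U
  | 0 => none
  | r + 1 => if h : r < W.n then some (i, ⟨r, h⟩) else none

/-- The position on a circle after `r` steps in the given direction. -/
def pos (W : WordSystem) (ε : Bool) (r : ℕ) : ℕ := if ε then r else W.n + 1 - r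

/-- The index of a vertex on its circle. -/
def index : W.U → ℕ
  | none => 0
  | some (_, k) => k + 1

/-- The circle containing a vertex. -/
def circle : W.U → Option W.ι
  | none => none
  | some (i, _) => some i

lemma point_zero (i : W.ι) : point i 0 = none := rfl

lemma point_last (i : W.ι) : point i (W.n + 1) = none := dif_neg (lt_irrefl _)

lemma point_succ (i : W.ι) {r : ℕ} (h : r < W.n) : point i (r + 1) = some (i, ⟨r, h⟩) := dif_pos h

lemma index_point (i : W.ι) {r : ℕ} (h : r ≤ W.n) : index (point i r) = r := by
  cases r with
  | zero => rfl
  | succ r => rw [point_succ i h]; rfl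

lemma circle_point (i : W.ι) {r : ℕ} (h0 : 0 < r) (h : r ≤ W.n) :
    circle (point i r) = some i := by
  obtain ⟨r, rfl⟩ := Nat.exists_eq_add_of_lt h0
  rw [zero_add, point_succ i (by omega)]; rfl

lemma index_point_succ (i : W.ι) {r : ℕ} (h : r ≤ W.n) :
    index (point i (r + 1)) = if r = W.n then 0 else r + 1 := by
  split_ifs with h1
  · rw [h1, point_last]; rfl
  · exact index_point i (by omega)

lemma point_ne_succ (i : W.ι) {r : ℕ} (h : r ≤ W.n) : point i r ≠ point i (r + 1) := fun heq => by
  have h1 := congrArg index heq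
  rw [index_point i h, index_point_succ i h] at h1
  have := W.two_le_n
  split_ifs at h1 <;> omega

lemma edge_injective :
    Function.Injective fun e : W.ι × Fin (W.n + 1) => s(point e.1 e.2, point e.1 (e.2 + 1)) := by
  rintro ⟨i, r, hr⟩ ⟨i', r', hr'⟩ h
  have hn := W.two_le_n
  simp only at h
  rw [Sym2.eq_iff] at h
  rcases h with ⟨h1, h2⟩ | ⟨h1, h2⟩
  · have e1 := congrArg index h1
    rw [index_point i (by omega), index_point i' (by omega)] at e1
    subst e1
    have : some i = some i' := by
      -- The common base point has no circle, so for the first edge the circle is read off at the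
      -- other end.
      rcases Nat.eq_zero_or_pos r with rfl | h0
      · rw [← circle_point i (r := 1) (by omega) (by omega), ← circle_point i' (r := 1) (by omega)
          (by omega)]
        exact congrArg circle h2
      · rw [← circle_point i h0 (by omega), ← circle_point i' h0 (by omega)]
        exact congrArg circle h1
    rw [Option.some_injective _ this]
  · exfalso
    have e1 := congrArg index h1
    have e2 := congrArg index h2
    rw [index_point i (by omega), index_point_succ i' (by omega)] at e1
    rw [index_point_succ i (by omega), index_point i' (by omega)] at e2
    split_ifs at e1 e2 <;> omega

/-- The walk along the circles defined by a word. -/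
def walk (j : W.J) (p : ℕ) : W.U :=
  point (W.word j (p / (W.n + 1))).1 (pos W (W.word j (p / (W.n + 1))).2 (p % (W.n + 1)))

lemma point_pos_zero (i : W.ι) (ε : Bool) : point i (pos W ε 0) = none := by
  cases ε
  · exact point_last i
  · rfl

lemma point_pos_last (i : W.ι) (ε : Bool) : point i (pos W ε (W.n + 1)) = none := by
  cases ε
  · simp [pos, point_zero]
  · exact point_last i

/-- The formula includes `r = n + 1`, the start of the next letter: every letter begins and ends at
the base point. -/
lemma walk_add (j : W.J) (l : ℕ) {r : ℕ} (hr : r ≤ W.n + 1) :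
    walk j ((W.n + 1) * l + r) = point (W.word j l).1 (pos W (W.word j l).2 r) := by
  rcases hr.eq_or_lt with rfl | hr
  · rw [walk, point_pos_last, show (W.n + 1) * l + (W.n + 1) = (W.n + 1) * (l + 1) by ring,
      Nat.mul_mod_right, point_pos_zero]
  · rw [walk, Nat.mul_add_div (by omega), Nat.div_eq_of_lt hr, Nat.mul_add_mod,
      Nat.mod_eq_of_lt hr, add_zero]

lemma exists_eq_add (W : WordSystem) (p : ℕ) : ∃ l r, r ≤ W.n ∧ p = (W.n + 1) * l + r :=
  ⟨p / (W.n + 1), p % (W.n + 1), Nat.lt_succ_iff.1 (Nat.mod_lt _ (by omega)),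
    (Nat.div_add_mod _ _).symm⟩

/-- The edge traversed in a step of a walk. -/
lemma exists_edge (ε : Bool) {r : ℕ} (hr : r ≤ W.n) : ∃ s ≤ W.n,
    (ε = true ∧ pos W ε r = s ∧ pos W ε (r + 1) = s + 1) ∨
      (ε = false ∧ pos W ε r = s + 1 ∧ pos W ε (r + 1) = s) := by
  cases ε
  · exact ⟨W.n - r, by omega, Or.inr ⟨rfl, by simp [pos]; omega, by simp [pos]⟩⟩
  · exact ⟨r, hr, Or.inl ⟨rfl, rfl, rfl⟩⟩

lemma exists_step (ε : Bool) {s : ℕ} (hs : s ≤ W.n) : ∃ r ≤ W.n,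
    (ε = true ∧ pos W ε r = s ∧ pos W ε (r + 1) = s + 1) ∨
      (ε = false ∧ pos W ε r = s + 1 ∧ pos W ε (r + 1) = s) := by
  cases ε
  · exact ⟨W.n - s, by omega, Or.inr ⟨rfl, by simp [pos]; omega, by simp [pos]; omega⟩⟩
  · exact ⟨s, hs, Or.inl ⟨rfl, rfl, rfl⟩⟩

lemma exists_other_occurrence (j : W.J) (l : ℕ) :
    ∃ j' l', (j' ≠ j ∨ l' % W.L ≠ l % W.L) ∧ (W.word j' l').1 = (W.word j l).1 := by
  classical
  have h := W.two_le (W.word j l).1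
  rw [← Finset.sum_product', ← Finset.card_filter] at h
  obtain ⟨⟨j', l'⟩, hmem, hne⟩ := Finset.exists_mem_ne h (j, l % W.L)
  simp only [Finset.mem_filter, Finset.mem_product, Finset.mem_univ, true_and,
    Finset.mem_range] at hmem
  refine ⟨j', l', ?_, hmem.2⟩
  rw [Nat.mod_eq_of_lt hmem.1]
  by_contra hh
  push Not at hh
  exact hne (Prod.ext hh.1 hh.2)

lemma exists_occurrence (i : W.ι) : ∃ j l, (W.word j l).1 = i := by
  classical
  have h := W.two_le i
  rw [← Finset.sum_product', ← Finset.card_filter] at h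
  obtain ⟨⟨j, l⟩, hmem⟩ := Finset.card_pos.1 (two_pos.trans_le h)
  exact ⟨j, l, (Finset.mem_filter.1 hmem).2⟩

/-- The edges of a circle are traversed by some walk. -/
lemma exists_walk_edge (i : W.ι) {s : ℕ} (hs : s ≤ W.n) : ∃ j p,
    (walk j p = point i s ∧ walk j (p + 1) = point i (s + 1)) ∨
      (walk j p = point i (s + 1) ∧ walk j (p + 1) = point i s) := by
  obtain ⟨j, l, rfl⟩ := exists_occurrence i
  obtain ⟨r, hr, h⟩ := exists_step (W.word j l).2 hs
  refine ⟨j, (W.n + 1) * l + r, ?_⟩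
  rw [walk_add j l (by omega), add_assoc, walk_add j l (by omega)]
  rcases h with ⟨-, h1, h2⟩ | ⟨-, h1, h2⟩
  · exact Or.inl ⟨by rw [h1], by rw [h2]⟩
  · exact Or.inr ⟨by rw [h1], by rw [h2]⟩

instance : NeZero ((W.n + 1) * W.L) := ⟨by have := W.L_pos; positivity⟩

variable (W) in
/-- The system of walks on a bouquet of circles defined by a system of words. -/
@[reducible]
def walkSystem : WalkSystem where
  U := W.U
  J := W.J
  fintypeU := inferInstance
  fintypeJ := inferInstance
  nonemptyJ := inferInstance
  M := (W.n + 1) * W.L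
  -- As many rings as steps in a walk: heights start at 0 and change by at most one per step, so
  -- they never exceed this number.
  R := (W.n + 1) * W.L
  three_le := by
    have h1 := W.two_le_n
    have h2 := W.L_pos
    nlinarith
  R_pos := by
    have h2 := W.L_pos
    positivity
  w := walk
  periodic j p := by
    obtain ⟨l, r, hr, rfl⟩ := W.exists_eq_add p
    rw [show (W.n + 1) * l + r + (W.n + 1) * W.L = (W.n + 1) * (l + W.L) + r by ring,
      walk_add j _ (by omega), walk_add j _ (by omega), W.periodic]
  ne_succ j p := by
    obtain ⟨l, r, hr, rfl⟩ := W.exists_eq_add p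
    rw [walk_add j l (by omega), add_assoc, walk_add j l (by omega)]
    obtain ⟨s, hs, ⟨-, h1, h2⟩ | ⟨-, h1, h2⟩⟩ := exists_edge (W.word j l).2 hr
    · rw [h1, h2]
      exact point_ne_succ _ hs
    · rw [h1, h2]
      exact (point_ne_succ _ hs).symm
  exists_eq := by
    rintro (_ | ⟨i, k⟩)
    · exact ⟨W.nonemptyJ.some, (W.n + 1) * 0 + 0, by rw [walk_add _ _ (by omega), point_pos_zero]⟩
    · obtain ⟨j, p, ⟨-, h⟩ | ⟨h, -⟩⟩ := exists_walk_edge i k.2.le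
      · exact ⟨j, p + 1, h.trans (point_succ i k.2)⟩
      · exact ⟨j, p, h.trans (point_succ i k.2)⟩
  exists_other j p := by
    obtain ⟨l, r, hr, rfl⟩ := W.exists_eq_add p
    obtain ⟨j', l', hne, hi⟩ := exists_other_occurrence j l
    obtain ⟨s, hs, h⟩ := exists_edge (W.word j l).2 hr
    obtain ⟨r', hr', h'⟩ := exists_step (W.word j' l').2 hs
    refine ⟨j', (W.n + 1) * l' + r', ?_, ?_⟩
    -- Dividing positions modulo `M` by the number of edges of a circle recovers the positions of
    -- the letters.
    · refine hne.imp_right fun hl heq => hl ?_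
      rw [ZMod.natCast_eq_natCast_iff'] at heq
      have := congrArg (· / (W.n + 1)) heq
      simp only [Nat.mod_mul_right_div_self] at this
      rwa [Nat.mul_add_div (by omega), Nat.mul_add_div (by omega), Nat.div_eq_of_lt (by omega),
        Nat.div_eq_of_lt (by omega), add_zero, add_zero] at this
    · rw [add_assoc, add_assoc, walk_add j l (by omega), walk_add j l (by omega),
        walk_add j' l' (by omega), walk_add j' l' (by omega), hi]
      rcases h with ⟨-, h1, h2⟩ | ⟨-, h1, h2⟩ <;> rcases h' with ⟨-, h3, h4⟩ | ⟨-, h3, h4⟩ <;>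
        simp [h1, h2, h3, h4]

end WordSystem

namespace WordSystem

variable {W : WordSystem}

/-! ### The gain defined by a presentation -/

section Gain

variable {G : Type} [Group G]

/-- The group `G` is presented by the generators `x` and the words of `W` as relators. -/
structure IsPresented (W : WordSystem) (x : W.ι → G) : Prop where
  rel : ∀ j, wordProd x (W.word j) W.L = 1
  closure : Subgroup.closure (range x) = ⊤
  lift : ∀ (H : Type) [Group H] (y : W.ι → H), (∀ j, wordProd y (W.word j) W.L = 1) →
    ∃ F : G →* H, ∀ i, F (x i) = y i

/-- The gain that is concentrated on the last edge of each circle. -/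
def arcGain (x : W.ι → G) : W.U → W.U → G
  | none, none => 1
  | some _, some _ => 1
  | some (i, k), none => if (k : ℕ) + 1 = W.n then x i else 1
  | none, some (i, k) => if (k : ℕ) + 1 = W.n then (x i)⁻¹ else 1

lemma arcGain_point (x : W.ι → G) (i : W.ι) {r : ℕ} (hr : r ≤ W.n) :
    arcGain x (point i r) (point i (r + 1)) = if r = W.n then x i else 1 := by
  have hn := W.two_le_n
  cases r with
  | zero =>
    rw [point_zero, point_succ i (by omega), if_neg (by omega)]
    exact if_neg (by simp; omega)
  | succ r =>
    rw [point_succ i hr]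
    split_ifs with h
    · rw [h, point_last]
      exact if_pos h
    · rw [point_succ i (by omega)]
      rfl

lemma arcGain_swap (x : W.ι → G) (u v : W.U) : arcGain x v u = (arcGain x u v)⁻¹ := by
  rcases u with _ | ⟨i, k⟩ <;> rcases v with _ | ⟨i', k'⟩ <;> simp only [arcGain, inv_one]
  · split_ifs <;> simp
  · split_ifs <;> simp

lemma arcGain_self (x : W.ι → G) (u : W.U) : arcGain x u u = 1 := by
  rcases u with _ | ⟨i, k⟩ <;> rfl

/-- The product of a function along the first edges of a circle. -/
def arcProd (θ : W.U → W.U → G) (i : W.ι) : ℕ → G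
  | 0 => 1
  | r + 1 => arcProd θ i r * θ (point i r) (point i (r + 1))

lemma arcProd_arcGain (x : W.ι → G) (i : W.ι) {r : ℕ} (hr : r ≤ W.n) :
    arcProd (arcGain x) i r = 1 := by
  induction r with
  | zero => rfl
  | succ r ih => rw [arcProd, ih (by omega), arcGain_point x i (by omega), if_neg (by omega),
    mul_one]

lemma arcProd_arcGain_last (x : W.ι → G) (i : W.ι) : arcProd (arcGain x) i (W.n + 1) = x i := by
  rw [arcProd, arcProd_arcGain x i le_rfl, arcGain_point x i le_rfl, if_pos rfl, one_mul]

section Transport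

variable {θ : W.U → W.U → G}
  (hθ : ∀ i, ∀ r ≤ W.n, θ (point i (r + 1)) (point i r) = (θ (point i r) (point i (r + 1)))⁻¹)
include hθ

/-- Inside one letter the walk stays on one circle, where `arcProd` is a primitive of `θ`; the
formula is therefore the same for both directions. -/
lemma transport_add (j : W.J) (l : ℕ) {r : ℕ} (hr : r ≤ W.n + 1) :
    WalkSystem.transport (S := W.walkSystem) θ j ((W.n + 1) * l + r) =
      WalkSystem.transport (S := W.walkSystem) θ j ((W.n + 1) * l) *
        (arcProd θ (W.word j l).1 (pos W (W.word j l).2 0))⁻¹ *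
          arcProd θ (W.word j l).1 (pos W (W.word j l).2 r) := by
  induction r with
  | zero => simp
  | succ r ih =>
    have hr' : r ≤ W.n := by omega
    rw [← add_assoc, WalkSystem.transport, ih (by omega)]
    change _ * θ (walk j _) (walk j _) = _
    rw [walk_add j l (by omega), add_assoc, walk_add j l hr]
    obtain ⟨s, hs, ⟨-, h1, h2⟩ | ⟨-, h1, h2⟩⟩ := exists_edge (W := W) (W.word j l).2 hr'
    · rw [h1, h2, mul_assoc, arcProd]
    · rw [h1, h2, mul_assoc, arcProd, hθ _ s hs]
      group

lemma transport_mul (j : W.J) (l : ℕ) :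
    WalkSystem.transport (S := W.walkSystem) θ j ((W.n + 1) * l) =
      wordProd (fun i => arcProd θ i (W.n + 1)) (W.word j) l := by
  induction l with
  | zero => rfl
  | succ l ih =>
    rw [mul_add, mul_one, transport_add hθ j l le_rfl, ih, wordProd, letterValue, mul_assoc]
    congr 1
    cases h : (W.word j l).2 <;> simp [pos, arcProd]

end Transport

lemma isGain_arcGain {x : W.ι → G} (hrel : ∀ j, wordProd x (W.word j) W.L = 1) :
    WalkSystem.IsGain (S := W.walkSystem) (arcGain x) where
  swap := arcGain_swap x
  self := arcGain_self x
  transport_eq_one j := by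
    change WalkSystem.transport (S := W.walkSystem) _ j ((W.n + 1) * W.L) = 1
    rw [transport_mul (fun i r _ => arcGain_swap x _ _)]
    simp only [arcProd_arcGain_last]
    exact hrel j

/-- A function on the edges of the walks that is compatible with reversal in one direction of each
edge is compatible with reversal. -/
lemma swap_of_walk {θ : W.U → W.U → G}
    (h : ∀ j p, θ (walk j (p + 1)) (walk j p) = (θ (walk j p) (walk j (p + 1)))⁻¹) (i : W.ι) (r : ℕ)
    (hr : r ≤ W.n) : θ (point i (r + 1)) (point i r) = (θ (point i r) (point i (r + 1)))⁻¹ := by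
  obtain ⟨j, p, ⟨h1, h2⟩ | ⟨h1, h2⟩⟩ := exists_walk_edge i hr
  · rw [← h1, ← h2]
    exact h j p
  · rw [← h1, ← h2, h j p, inv_inv]

/-- All edges but the last of each circle form a spanning tree of the bouquet. Taking `b` to be the
product of `θ` along the tree removes `θ` there, and the last edge keeps the holonomy of the circle.
These holonomies satisfy the relators, so the presentation supplies `F`. -/
theorem isUniversalGain_arcGain {x : W.ι → G} (hx : W.IsPresented x) :
    WalkSystem.IsUniversalGain (S := W.walkSystem) (arcGain x) none := by
  intro H _ θ hθ hT
  have hθ' := swap_of_walk hθ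
  obtain ⟨F, hF⟩ := hx.lift H (fun i => arcProd θ i (W.n + 1)) fun j => by
    rw [← transport_mul hθ']
    exact hT j
  let b : W.U → H
    | none => 1
    | some (i, k) => arcProd θ i (k + 1)
  have hb : ∀ i r, r ≤ W.n → b (point i r) = arcProd θ i r := by
    intro i r hr
    cases r with
    | zero => rfl
    | succ r => rw [point_succ i hr]
  have key : ∀ i r, r ≤ W.n → θ (point i r) (point i (r + 1)) =
      (b (point i r))⁻¹ * F (arcGain x (point i r) (point i (r + 1))) * b (point i (r + 1)) := by
    intro i r hr
    rw [hb i r hr, arcGain_point x i hr]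
    split_ifs with h
    · have h1 : b (point i (r + 1)) = 1 := by rw [h, point_last]
      rw [h1, hF, h, arcProd]
      group
    · rw [hb i (r + 1) (by omega), arcProd, map_one]
      group
  refine ⟨F, b, rfl, fun j p => ?_⟩
  change θ (walk j p) (walk j (p + 1)) = (b (walk j p))⁻¹ *
    F (arcGain x (walk j p) (walk j (p + 1))) * b (walk j (p + 1))
  obtain ⟨l, r, hr, rfl⟩ := W.exists_eq_add p
  rw [walk_add j l (by omega), add_assoc, walk_add j l (by omega)]
  obtain ⟨s, hs, ⟨-, h1, h2⟩ | ⟨-, h1, h2⟩⟩ := exists_edge (W := W) (W.word j l).2 hr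
  · rw [h1, h2]
    exact key _ s hs
  · rw [h1, h2, hθ' _ s hs, key _ s hs, arcGain_swap x (point _ s), map_inv]
    group

/-! ### Gains of edge paths -/

lemma adj_point (i : W.ι) {r : ℕ} (hr : r ≤ W.n) :
    W.walkSystem.complex.Adj (.inl (point i r)) (.inl (point i (r + 1))) := by
  obtain ⟨j, p, ⟨h1, h2⟩ | ⟨h1, h2⟩⟩ := exists_walk_edge i hr
  · rw [← h1, ← h2]
    exact WalkSystem.adj_horizontal (S := W.walkSystem) j (Nat.zero_le _) p
  · rw [← h1, ← h2]
    obtain ⟨s, hs, hu, hv⟩ := WalkSystem.adj_horizontal (S := W.walkSystem) j (Nat.zero_le _) p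
    exact ⟨s, hs, hv, hu⟩

variable {x : W.ι → G}

lemma hasGain_point {a : G} (h : W.walkSystem.complex.HasGain (WalkSystem.gain (arcGain x))
    (.inl none) (.inl none) a) (i : W.ι) {r : ℕ} (hr : r ≤ W.n + 1) :
    W.walkSystem.complex.HasGain (WalkSystem.gain (arcGain x)) (.inl none) (.inl (point i r))
      (a * arcProd (arcGain x) i r) := by
  induction r with
  | zero => simpa [arcProd, point_zero] using h
  | succ r ih =>
    rw [arcProd, ← mul_assoc]
    exact (ih (by omega)).cons (adj_point i (by omega))

lemma hasGain_point_reverse {a : G} (h : W.walkSystem.complex.HasGain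
    (WalkSystem.gain (arcGain x)) (.inl none) (.inl none) a) (i : W.ι) {r : ℕ} (hr : r ≤ W.n + 1) :
    W.walkSystem.complex.HasGain (WalkSystem.gain (arcGain x)) (.inl none)
      (.inl (point i (W.n + 1 - r)))
      (a * ((arcProd (arcGain x) i (W.n + 1))⁻¹ * arcProd (arcGain x) i (W.n + 1 - r))) := by
  induction r with
  | zero => simpa [point_last] using h
  | succ r ih =>
    obtain ⟨s, hs⟩ : ∃ s, W.n + 1 - r = s + 1 := ⟨W.n - r, by omega⟩
    have hs' : W.n + 1 - (r + 1) = s := by omega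
    have h1 := ih (by omega)
    rw [hs] at h1
    rw [hs']
    obtain ⟨t, ht, hu, hv⟩ := adj_point i (r := s) (by omega)
    have h2 := h1.cons ⟨t, ht, hv, hu⟩
    change W.walkSystem.complex.HasGain _ _ _
      (a * _ * arcGain x (point i (s + 1)) (point i s)) at h2
    convert h2 using 1
    rw [arcGain_swap x (point i s), arcProd.eq_2 _ _ s]
    group

theorem hasGain_base (hx : Subgroup.closure (range x) = ⊤) (a : G) :
    W.walkSystem.complex.HasGain (WalkSystem.gain (arcGain x)) (.inl none) (.inl none) a := by
  -- Allowing an arbitrary prefix `b`, and treating `a` and `a⁻¹` together, lets the closure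
  -- induction pass through products and inverses.
  have key : ∀ a ∈ Subgroup.closure (range x), ∀ b,
      W.walkSystem.complex.HasGain (WalkSystem.gain (arcGain x)) (.inl none) (.inl none) b →
      W.walkSystem.complex.HasGain (WalkSystem.gain (arcGain x)) (.inl none) (.inl none) (b * a) ∧
      W.walkSystem.complex.HasGain (WalkSystem.gain (arcGain x)) (.inl none) (.inl none)
        (b * a⁻¹) := by
    intro a ha
    induction ha using Subgroup.closure_induction with
    | mem a ha =>
      obtain ⟨i, rfl⟩ := ha
      intro b hb
      constructor
      · have := hasGain_point hb i le_rfl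
        rwa [arcProd_arcGain_last, point_last] at this
      · have := hasGain_point_reverse hb i le_rfl
        rwa [arcProd_arcGain_last, Nat.sub_self, point_zero, arcProd, mul_one] at this
    | one => intro b hb; simpa using hb
    | mul a a' _ _ ih ih' =>
      intro b hb
      constructor
      · rw [← mul_assoc]
        exact (ih' _ (ih b hb).1).1
      · rw [mul_inv_rev, ← mul_assoc]
        exact (ih _ (ih' b hb).2).2
    | inv a _ ih =>
      intro b hb
      rw [inv_inv]
      exact (ih b hb).symm
  have := (key a (hx ▸ Subgroup.mem_top a) 1 .nil).1
  rwa [one_mul] at this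

theorem exists_hasGain (v : W.walkSystem.Vertex) :
    ∃ a, W.walkSystem.complex.HasGain (WalkSystem.gain (arcGain x)) (.inl none) v a := by
  refine WalkSystem.exists_hasGain (fun u => ?_) v
  rcases u with _ | ⟨i, k⟩
  · exact ⟨1, .nil⟩
  · have h := hasGain_point (x := x) .nil i (r := k + 1) (by omega)
    rw [point_succ i k.2] at h
    exact ⟨_, h⟩

end Gain

/-! ### Heights -/

section Height

variable {G : Type} [Group G] (x : W.ι → G) (ψ : G →* Multiplicative ℤ)

/-- The height of the vertices on the circles. -/
def arcOffset : W.U → ℤ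
  | none => 0
  | some (i, k) => WalkSystem.clamp (k + 1) (ψ (x i)).toAdd

/-- The height on a circle, lifted to the integers. -/
def arcHeight (i : W.ι) (r : ℕ) : ℤ := WalkSystem.clamp r (ψ (x i)).toAdd

variable {x ψ}

/-- At the end of the circle the offset returns to 0 and the gain of the last edge supplies `ψ (x
i)`; the bound on `ψ (x i)` makes the clamp inactive there. -/
lemma arcHeight_eq (hb : ∀ i, |(ψ (x i)).toAdd| ≤ W.n) (i : W.ι) {r : ℕ} (hr : r ≤ W.n + 1) :
    (ψ (arcProd (arcGain x) i r)).toAdd + arcOffset x ψ (point i r) = arcHeight x ψ i r := by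
  rcases hr.eq_or_lt with rfl | hr
  · have := abs_le.1 (hb i)
    rw [arcProd_arcGain_last, point_last]
    simp only [arcOffset, arcHeight, WalkSystem.clamp]
    omega
  · rw [arcProd_arcGain x i (by omega), map_one, toAdd_one, zero_add]
    cases r with
    | zero => simp [point_zero, arcOffset, arcHeight, WalkSystem.clamp]
    | succ r => rw [point_succ i (by omega)]; rfl

lemma walkHeight_add (hb : ∀ i, |(ψ (x i)).toAdd| ≤ W.n) (j : W.J) (l : ℕ) {r : ℕ}
    (hr : r ≤ W.n + 1) :
    WalkSystem.walkHeight (S := W.walkSystem) (arcGain x) ψ (arcOffset x ψ) j ((W.n + 1) * l + r) =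
      (ψ (WalkSystem.transport (S := W.walkSystem) (arcGain x) j ((W.n + 1) * l))).toAdd -
        (ψ (arcProd (arcGain x) (W.word j l).1 (pos W (W.word j l).2 0))).toAdd +
          arcHeight x ψ (W.word j l).1 (pos W (W.word j l).2 r) := by
  have hp : pos W (W.word j l).2 r ≤ W.n + 1 := by
    cases (W.word j l).2 <;> simp [pos]
    exact hr
  rw [← arcHeight_eq hb _ hp, WalkSystem.walkHeight,
    transport_add (fun i r _ => arcGain_swap x _ _) j l hr]
  change _ + arcOffset x ψ (walk j _) = _
  rw [walk_add j l hr]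
  simp only [map_mul, map_inv, toAdd_mul, toAdd_inv]
  ring

/-- The height moves monotonically away from 0, so its total variation is its final absolute value.
-/
lemma sum_natAbs_arcHeight (hb : ∀ i, |(ψ (x i)).toAdd| ≤ W.n) (i : W.ι) :
    ∑ r ∈ Finset.range (W.n + 1), (arcHeight x ψ i (r + 1) - arcHeight x ψ i r).natAbs =
      (ψ (x i)).toAdd.natAbs := by
  have key : ∀ r, ∑ r ∈ Finset.range r, (arcHeight x ψ i (r + 1) - arcHeight x ψ i r).natAbs =
      (arcHeight x ψ i r).natAbs := by
    intro r
    induction r with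
    | zero => simp [arcHeight, WalkSystem.clamp]
    | succ r ih =>
      rw [Finset.sum_range_succ, ih]
      simp only [arcHeight, WalkSystem.clamp]
      omega
  have := abs_le.1 (hb i)
  rw [key]
  simp only [arcHeight, WalkSystem.clamp]
  omega

lemma sum_natAbs_walkHeight_letter (hb : ∀ i, |(ψ (x i)).toAdd| ≤ W.n) (j : W.J) (l : ℕ) :
    ∑ r ∈ Finset.range (W.n + 1),
      (WalkSystem.walkHeight (S := W.walkSystem) (arcGain x) ψ (arcOffset x ψ) j
          ((W.n + 1) * l + r + 1) -
        WalkSystem.walkHeight (S := W.walkSystem) (arcGain x) ψ (arcOffset x ψ) j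
          ((W.n + 1) * l + r)).natAbs = (ψ (x (W.word j l).1)).toAdd.natAbs := by
  rw [← sum_natAbs_arcHeight hb]
  have h1 : ∀ r ∈ Finset.range (W.n + 1),
      (WalkSystem.walkHeight (S := W.walkSystem) (arcGain x) ψ (arcOffset x ψ) j
          ((W.n + 1) * l + r + 1) -
        WalkSystem.walkHeight (S := W.walkSystem) (arcGain x) ψ (arcOffset x ψ) j
          ((W.n + 1) * l + r)).natAbs =
      (arcHeight x ψ (W.word j l).1 (pos W (W.word j l).2 (r + 1)) -
        arcHeight x ψ (W.word j l).1 (pos W (W.word j l).2 r)).natAbs := by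
    intro r hr
    have hr := Finset.mem_range.1 hr
    rw [add_assoc, walkHeight_add hb j l (by omega), walkHeight_add hb j l (by omega)]
    congr 1
    ring
  rw [Finset.sum_congr rfl h1]
  cases h : (W.word j l).2
  -- An inverse letter runs through the same edges in the opposite order.
  · rw [← Finset.sum_range_reflect]
    refine Finset.sum_congr rfl fun r hr => ?_
    have hr := Finset.mem_range.1 hr
    rw [← Int.natAbs_neg, neg_sub]
    simp only [pos, Bool.false_eq_true, if_false]
    congr 3 <;> omega
  · rfl

lemma abs_walkHeight_sub_le (hb : ∀ i, |(ψ (x i)).toAdd| ≤ W.n) (j : W.J) (p : ℕ) :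
    |WalkSystem.walkHeight (S := W.walkSystem) (arcGain x) ψ (arcOffset x ψ) j (p + 1) -
      WalkSystem.walkHeight (S := W.walkSystem) (arcGain x) ψ (arcOffset x ψ) j p| ≤ 1 := by
  obtain ⟨l, r, hr, rfl⟩ := W.exists_eq_add p
  rw [add_assoc, walkHeight_add hb j l (by omega), walkHeight_add hb j l (by omega)]
  obtain ⟨s, hs, ⟨-, h1, h2⟩ | ⟨-, h1, h2⟩⟩ := exists_edge (W := W) (W.word j l).2 hr <;>
  · rw [h1, h2, abs_le]
    simp only [arcHeight, WalkSystem.clamp]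
    omega

theorem isTame (hrel : ∀ j, wordProd x (W.word j) W.L = 1) (hb : ∀ i, |(ψ (x i)).toAdd| ≤ W.n) :
    WalkSystem.IsTame (S := W.walkSystem) (arcGain x) ψ (arcOffset x ψ) where
  isGain := isGain_arcGain hrel
  bounded j p := by
    have hg := isGain_arcGain hrel
    have hper : ∀ p, WalkSystem.walkHeight (S := W.walkSystem) (arcGain x) ψ (arcOffset x ψ) j
        (p + W.walkSystem.M) =
        WalkSystem.walkHeight (S := W.walkSystem) (arcGain x) ψ (arcOffset x ψ) j p := by
      intro p
      rw [WalkSystem.walkHeight, WalkSystem.walkHeight, hg.transport_periodic,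
        W.walkSystem.periodic]
    have hle : ∀ p : ℕ,
        |WalkSystem.walkHeight (S := W.walkSystem) (arcGain x) ψ (arcOffset x ψ) j p| ≤ p := by
      intro p
      induction p with
      | zero =>
        have h0 : walk j 0 = none := by
          have := walk_add j 0 (r := 0) (by omega)
          rwa [mul_zero, point_pos_zero] at this
        rw [WalkSystem.walkHeight]
        change |(ψ 1).toAdd + arcOffset x ψ (walk j 0)| ≤ _
        rw [h0]
        simp [arcOffset]
      | succ p ih =>
        have := abs_walkHeight_sub_le hb j p
        rw [abs_le] at this ih ⊢
        push_cast
        constructor <;> linarith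
    have hmod := Function.Periodic.map_mod_nat (f := fun p =>
      WalkSystem.walkHeight (S := W.walkSystem) (arcGain x) ψ (arcOffset x ψ) j p) hper p
    simp only at hmod
    rw [← hmod]
    refine (hle _).trans ?_
    exact_mod_cast (Nat.mod_lt p (by have := W.walkSystem.three_le; exact two_pos.trans this)).le
  step_le := abs_walkHeight_sub_le hb

/-- The bound for the complexity of the midset. -/
theorem two_mul_complexity_le (hrel : ∀ j, wordProd x (W.word j) W.L = 1)
    (hb : ∀ i, |(ψ (x i)).toAdd| ≤ W.n) :
    2 * ((VertexComplex.midGraph (isTame hrel hb).isHeight WalkSystem.card_le_three).complexity : ℤ) ≤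
      ∑ i, ((W.occ i : ℤ) - 2) * |(ψ (x i)).toAdd| := by
  classical
  have h1 := VertexComplex.complexity_midGraph_add_le (isTame hrel hb).isHeight
    WalkSystem.card_le_three WalkSystem.isThick_complex
  have h2 := (isTame hrel hb).two_mul_card_le (ε := W.ι × Fin (W.n + 1))
    (fun e => point e.1 e.2) (fun e => point e.1 (e.2 + 1)) edge_injective
    (fun e => point_ne_succ e.1 (by omega)) (fun e => adj_point e.1 (by omega))
  -- Every edge of the bouquet counted once gives `|ψ (x i)|` for each circle; `h4` to `h6` count it
  -- once for each occurrence in the words.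
  have h3 : ∑ e : W.ι × Fin (W.n + 1), (WalkSystem.heightDiff (S := W.walkSystem) (arcGain x) ψ
      (arcOffset x ψ) (.inl (point e.1 e.2)) (.inl (point e.1 (e.2 + 1)))).natAbs =
      ∑ i, (ψ (x i)).toAdd.natAbs := by
    rw [Fintype.sum_prod_type]
    refine Finset.sum_congr rfl fun i _ => ?_
    rw [← sum_natAbs_arcHeight hb, Finset.sum_range]
    refine Finset.sum_congr rfl fun r _ => ?_
    rw [← arcHeight_eq hb i (r := r + 1) (by omega), ← arcHeight_eq hb i (r := r) (by omega),
      arcProd]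
    congr 1
    change (ψ (arcGain x (point i r) (point i (r + 1)))).toAdd + arcOffset x ψ (point i (r + 1)) -
      arcOffset x ψ (point i r) = _
    rw [map_mul, toAdd_mul]
    ring
  have h4 : ∀ j, ∑ p ∈ Finset.range ((W.n + 1) * W.L),
      (WalkSystem.walkHeight (S := W.walkSystem) (arcGain x) ψ (arcOffset x ψ) j (p + 1) -
        WalkSystem.walkHeight (S := W.walkSystem) (arcGain x) ψ (arcOffset x ψ) j p).natAbs =
      ∑ l ∈ Finset.range W.L, (ψ (x (W.word j l).1)).toAdd.natAbs := by
    intro j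
    generalize W.L = L
    induction L with
    | zero => simp
    | succ L ih =>
      rw [Finset.sum_range_succ, ← ih, mul_add, mul_one, Finset.sum_range_add,
        sum_natAbs_walkHeight_letter hb]
  have h5 : ∑ j, ∑ l ∈ Finset.range W.L, (ψ (x (W.word j l).1)).toAdd.natAbs =
      ∑ i, W.occ i * (ψ (x i)).toAdd.natAbs := by
    simp only [occ, Finset.sum_mul, ite_mul, one_mul, zero_mul]
    rw [Finset.sum_comm (s := (Finset.univ : Finset W.ι))]
    refine Finset.sum_congr rfl fun j _ => ?_
    rw [Finset.sum_comm (s := (Finset.univ : Finset W.ι))]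
    refine Finset.sum_congr rfl fun l _ => ?_
    simp
  have h6 : ∑ j, ∑ p ∈ Finset.range W.walkSystem.M,
      (WalkSystem.walkHeight (S := W.walkSystem) (arcGain x) ψ (arcOffset x ψ) j (p + 1) -
        WalkSystem.walkHeight (S := W.walkSystem) (arcGain x) ψ (arcOffset x ψ) j p).natAbs =
      ∑ i, W.occ i * (ψ (x i)).toAdd.natAbs := by
    rw [← h5]
    exact Finset.sum_congr rfl fun j _ => h4 j
  rw [h3, h6] at h2
  have h7 : ∑ i, ((W.occ i : ℤ) - 2) * |(ψ (x i)).toAdd| =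
      ((∑ i, W.occ i * (ψ (x i)).toAdd.natAbs : ℕ) : ℤ) -
        2 * ((∑ i, (ψ (x i)).toAdd.natAbs : ℕ) : ℤ) := by
    push_cast
    rw [Finset.mul_sum, ← Finset.sum_sub_distrib]
    exact Finset.sum_congr rfl fun i _ => by ring
  rw [h7]
  omega

end Height

end WordSystem

/-! ### The complex of a word system as a finite 2-complex -/

namespace VertexComplex

variable {V : Type} [Fintype V] {K : VertexComplex V} (hV : ∀ v, {v} ∈ K.faces)

include hV in
lemma isFiniteTwoComplex (hcard : ∀ s ∈ K.faces, s.card ≤ 3)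
    (hpure : ∀ s ∈ K.faces, ∃ t ∈ K.faces, s ⊆ t ∧ t.card = 3) (hex : ∃ s ∈ K.faces, s.card = 3)
    {v₀ : V} (hconn : ∀ v,
      Nonempty (Path.Homotopic.Quotient (vertex v₀ (hV v₀)) (vertex v (hV v)))) :
    IsFiniteTwoComplex K.Space where
  t2 := inferInstance
  connected := by
    have : PathConnectedSpace K.Space := by
      have h1 : ∀ x : K.Space, Joined (vertex v₀ (hV v₀)) x := by
        intro x
        obtain ⟨v, hv⟩ := x.exists_mem_supp
        obtain ⟨q⟩ := hconn v
        obtain ⟨γ, -⟩ := Path.Homotopic.Quotient.mk_surjective q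
        exact Joined.trans ⟨γ⟩ ⟨(line (near_vertex hV hv)).symm⟩
      exact ⟨⟨vertex v₀ (hV v₀)⟩, fun x y => (h1 x).symm.trans (h1 y)⟩
    infer_instance
  exists_cw := exists_cw K hcard hex
  exists_cone_nhd := exists_cone_nhd hcard hpure

/-- In a commutative target the coboundary of `b` telescopes along the path and leaves only its
values at the ends. -/
lemma IsEdgeWalk.map {G H : Type} [Group G] [CommGroup H] {g : V → V → G} (F : G →* H) (b : V → H)
    {v₀ v : V} {q : Path.Homotopic.Quotient (vertex v₀ (hV v₀)) (vertex v (hV v))} {a : G}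
    (h : IsEdgeWalk hV g v₀ v q a) :
    IsEdgeWalk hV (fun u v => F (g u v) * b v / b u) v₀ v q (F a * b v / b v₀) := by
  induction h with
  | nil => simpa using IsEdgeWalk.nil (hV := hV) (g := fun u v => F (g u v) * b v / b u) (v₀ := v₀)
  | @cons u v q a _ hadj ih =>
    have h1 := ih.cons hadj
    convert h1 using 1
    rw [map_mul, div_mul_div_comm, div_eq_div_iff_mul_eq_mul]
    simp only [mul_assoc, mul_comm, mul_left_comm]

end VertexComplex

/-! ### Fundamental group and Turaev norm of the space of a word system -/

namespace WordSystem

variable {W : WordSystem} {G : Type} [Group G] {x : W.ι → G}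

open VertexComplex

/-- The space of a word system. -/
abbrev Space (W : WordSystem) : Type := W.walkSystem.complex.Space

/-- The base point of the space of a word system. -/
def basePoint (W : WordSystem) : W.Space :=
  vertex (K := W.walkSystem.complex) (.inl none) (WalkSystem.singleton_mem _)

lemma isFiniteTwoComplex_space (W : WordSystem) : IsFiniteTwoComplex W.Space := by
  refine VertexComplex.isFiniteTwoComplex WalkSystem.singleton_mem WalkSystem.card_le_three
    WalkSystem.exists_triangle WalkSystem.exists_face_card_eq_three (v₀ := .inl none) fun v => ?_
  obtain ⟨a, ha⟩ := exists_hasGain (x := fun _ : W.ι => (1 : Multiplicative ℤ)) v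
  obtain ⟨q, -⟩ := ha.exists_isEdgeWalk WalkSystem.singleton_mem
  exact ⟨q⟩

lemma twoBoundary_space (W : WordSystem) : twoBoundary W.Space = ∅ :=
  twoBoundary_space_eq_empty WalkSystem.card_le_three WalkSystem.isThick_complex

/-- The fundamental group of the space of a word system is the group presented by the words; the
Turaev norm is bounded in terms of the occurrences of the letters. -/
theorem exists_mulEquiv (hx : W.IsPresented x) (ψ : G →* Multiplicative ℤ)
    (hb : ∀ i, |(ψ (x i)).toAdd| ≤ W.n) :
    ∃ (f : FundamentalGroup W.Space W.basePoint ≃* G) (m : ℕ),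
      turaevNormInt (ψ.comp f.toMonoidHom : IntegralClass W.Space W.basePoint) ≤ m ∧
      2 * (m : ℤ) ≤ ∑ i, ((W.occ i : ℤ) - 2) * |(ψ (x i)).toAdd| := by
  have hg := WalkSystem.isCocycle_gain (isGain_arcGain hx.rel)
  obtain ⟨f, hf⟩ := exists_fundamentalGroup_mulEquiv (K := W.walkSystem.complex)
    WalkSystem.singleton_mem hg exists_hasGain (hasGain_base hx.closure)
    (WalkSystem.isUniversal_gain (isGain_arcGain hx.rel) (isUniversalGain_arcGain hx))
  -- The isomorphism `f` sends a closed edge path to the inverse of its gain, so the heights are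
  -- built from `ψ⁻¹`; absolute values do not notice.
  have hb' : ∀ i, |(ψ⁻¹ (x i)).toAdd| ≤ W.n := fun i => by
    rw [MonoidHom.inv_apply, toAdd_inv, abs_neg]
    exact hb i
  have ht := isTame (ψ := ψ⁻¹) hx.rel hb'
  refine ⟨f, _, ?_, (two_mul_complexity_le (ψ := ψ⁻¹) hx.rel hb').trans_eq
    (Finset.sum_congr rfl fun i _ => by rw [MonoidHom.inv_apply, toAdd_inv, abs_neg])⟩
  refine iInf₂_le (regularGraph ht.isHeight WalkSystem.card_le_three W.twoBoundary_space)
    (represents_regularGraph ht.isHeight WalkSystem.card_le_three W.twoBoundary_space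
      WalkSystem.singleton_mem fun q => ?_)
  obtain ⟨a, ha⟩ := exists_isEdgeWalk (K := W.walkSystem.complex) WalkSystem.singleton_mem
    (WalkSystem.gain (S := W.walkSystem) (arcGain x)) (.inl none) (.inl none) q
  have h1 := ha.map WalkSystem.singleton_mem ψ⁻¹ fun v =>
    Multiplicative.ofAdd (WalkSystem.offset (S := W.walkSystem) (arcGain x) ψ⁻¹ (arcOffset x ψ⁻¹) v)
  -- The path is closed, so the offsets at its two ends cancel.
  rw [mul_div_cancel_right] at h1
  have h2 : ψ⁻¹ a = ψ (f (FundamentalGroup.fromPath q)) := by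
    rw [hf q a ha, MonoidHom.inv_apply, map_inv]
  rw [h2] at h1
  exact h1

end WordSystem

/-! ### The word system of a presentation -/

section Words

variable {ι H : Type} [Group H]

lemma wordProd_congr {y : ι → H} {w w' : ℕ → ι × Bool} {L : ℕ} (h : ∀ l < L, w l = w' l) :
    wordProd y w L = wordProd y w' L := by
  induction L with
  | zero => rfl
  | succ L ih => rw [wordProd, wordProd, ih fun l hl => h l (by omega), h L (by omega)]

lemma wordProd_succ' (y : ι → H) (w : ℕ → ι × Bool) (L : ℕ) :
    wordProd y w (L + 1) = letterValue y (w 0) * wordProd y (fun l => w (l + 1)) L := by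
  induction L with
  | zero => simp [wordProd]
  | succ L ih => rw [wordProd, ih, wordProd, mul_assoc]

lemma wordProd_getD {y : ι → H} {d : ι × Bool} (hd : letterValue y d = 1) (s : List (ι × Bool))
    {L : ℕ} (h : s.length ≤ L) :
    wordProd y (fun l => s.getD l d) L = (s.map (letterValue y)).prod := by
  induction s generalizing L with
  | nil =>
    clear h
    induction L with
    | zero => rfl
    | succ L ih => rw [wordProd, ih]; simp [hd]
  | cons a s ih =>
    obtain ⟨L, rfl⟩ := Nat.exists_eq_succ_of_ne_zero (n := L) (by simp at h; omega)
    rw [Nat.succ_eq_add_one, wordProd_succ']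
    simp only [List.getD_cons_zero, List.getD_cons_succ, List.map_cons, List.prod_cons]
    rw [ih (by simpa using h)]

/-- The word `x x⁻¹ x ⋯ x` of odd length reduces to `x`; the odd value of `wordLength` is chosen for
this. -/
lemma wordProd_alternating (y : ι → H) (i : ι) (t : ℕ) :
    wordProd y (fun l => (i, decide (l % 2 = 0))) (2 * t + 1) = y i := by
  have key : wordProd y (fun l => (i, decide (l % 2 = 0))) (2 * t) = 1 := by
    induction t with
    | zero => rfl
    | succ t ih =>
      rw [show 2 * (t + 1) = 2 * t + 1 + 1 by ring, wordProd, wordProd, ih]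
      have h1 : (2 * t + 1) % 2 = 1 := by omega
      simp [letterValue, h1]
  rw [wordProd, key]
  simp [letterValue]

lemma sum_range_getD {α : Type} (p : α → Bool) {d : α} (hd : p d = false) (s : List α) {L : ℕ}
    (h : s.length ≤ L) :
    ∑ l ∈ Finset.range L, (if p (s.getD l d) = true then 1 else 0) = s.countP p := by
  induction s generalizing L with
  | nil => simp [hd]
  | cons a s ih =>
    obtain ⟨L, rfl⟩ := Nat.exists_eq_succ_of_ne_zero (n := L) (by simp at h; omega)
    rw [Nat.succ_eq_add_one, Finset.sum_range_succ']
    simp only [List.getD_cons_zero, List.getD_cons_succ]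
    rw [ih (by simpa using h), List.countP_cons]

end Words

namespace FinitePresentation

variable (P : FinitePresentation)

/-- A common odd upper bound for the lengths of the relators. -/
def wordLength : ℕ := 2 * (∑ j, (P.relator j).length) + 1

lemma length_le (j : Fin P.numRelators) : (P.relator j).length ≤ P.wordLength := by
  have := Finset.single_le_sum (f := fun j => (P.relator j).length) (fun _ _ => Nat.zero_le _)
    (Finset.mem_univ j)
  simp only [wordLength]
  omega

/-- The relators, padded by an additional generator, and two relators that make this generator
trivial. -/
def paddedWord : Fin P.numRelators ⊕ Bool → ℕ → Option (Fin P.numGenerators) × Bool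
  | .inl j, l => ((P.relator j).map (Prod.map some id)).getD l (none, true)
  -- Two copies of the relator ensure that the extra generator occurs twice even when the word
  -- length is 1; they also give a disc to attach when there are no other relators.
  | .inr _, l => (none, decide (l % 2 = 0))

lemma sum_paddedWord (i : Fin P.numGenerators) [∀ a : Option (Fin P.numGenerators),
    Decidable (a = some i)] :
    ∑ j, ∑ l ∈ Finset.range P.wordLength, (if (P.paddedWord j l).1 = some i then 1 else 0) =
      P.occurrences i := by
  rw [Fintype.sum_sum_type]
  have h2 : ∑ b : Bool, ∑ l ∈ Finset.range P.wordLength,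
      (if (P.paddedWord (.inr b) l).1 = some i then 1 else 0) = 0 := by
    simp [paddedWord]
  rw [h2, add_zero, occurrences]
  refine Finset.sum_congr rfl fun j _ => ?_
  have h := sum_range_getD (fun a : Option (Fin P.numGenerators) × Bool => decide (a.1 = some i))
    (d := (none, true)) (by simp) ((P.relator j).map (Prod.map some id)) (L := P.wordLength)
    (by simpa using P.length_le j)
  rw [List.countP_map] at h
  simp only [decide_eq_true_eq] at h
  rw [show P.paddedWord (.inl j) = fun l =>
    ((P.relator j).map (Prod.map some id)).getD l (none, true) from rfl]
  refine h.trans (List.countP_congr fun a _ => ?_)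
  simp

lemma sum_paddedWord_mod (f : Option (Fin P.numGenerators) → ℕ) :
    ∑ j, ∑ l ∈ Finset.range P.wordLength, f (P.paddedWord j (l % P.wordLength)).1 =
      ∑ j, ∑ l ∈ Finset.range P.wordLength, f (P.paddedWord j l).1 :=
  Finset.sum_congr rfl fun _ _ => Finset.sum_congr rfl fun l hl => by
    rw [Nat.mod_eq_of_lt (Finset.mem_range.1 hl)]

open Classical in
/-- The word system of a good presentation. -/
@[reducible]
def wordSystem (hP : P.IsGood) (n : ℕ) (hn : 2 ≤ n) : WordSystem where
  ι := Option (Fin P.numGenerators)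
  J := Fin P.numRelators ⊕ Bool
  fintypeι := inferInstance
  fintypeJ := inferInstance
  nonemptyJ := inferInstance
  L := P.wordLength
  L_pos := Nat.succ_pos _
  word j l := P.paddedWord j (l % P.wordLength)
  periodic j l := by rw [Nat.add_mod_right]
  two_le i := by
    refine le_of_le_of_eq ?_ (P.sum_paddedWord_mod fun a =>
      @ite _ (a = i) (Classical.propDecidable _) 1 0).symm
    cases i with
    | some i =>
      exact (hP i).trans_eq (@sum_paddedWord P i fun _ => Classical.propDecidable _).symm
    | none =>
      rw [Fintype.sum_sum_type]
      have : 1 ≤ P.wordLength := Nat.succ_pos _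
      simp [paddedWord]
      omega
  n := n
  two_le_n := hn

lemma occ_wordSystem (hP : P.IsGood) (n : ℕ) (hn : 2 ≤ n) (i : Fin P.numGenerators) :
    (P.wordSystem hP n hn).occ (some i) = P.occurrences i := by
  exact (P.sum_paddedWord_mod fun a => @ite _ (a = some i) (Classical.propDecidable _) 1 0).trans
    (@sum_paddedWord P i fun _ => Classical.propDecidable _)

/-- The generators of the word system of a presentation. -/
def generator : Option (Fin P.numGenerators) → P.Group
  | none => 1
  | some i => PresentedGroup.of i

lemma wordProd_paddedWord {H : Type} [_root_.Group H] (y : Option (Fin P.numGenerators) → H)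
    (hy : y none = 1) (j : Fin P.numRelators) :
    wordProd y (fun l => P.paddedWord (.inl j) (l % P.wordLength)) P.wordLength =
      FreeGroup.lift (fun i => y (some i)) (FreeGroup.mk (P.relator j)) := by
  rw [wordProd_congr (w' := P.paddedWord (.inl j)) fun l hl => by rw [Nat.mod_eq_of_lt hl]]
  have h := wordProd_getD (y := y) (d := (none, true)) (by simp [letterValue, hy])
    ((P.relator j).map (Prod.map some id)) (L := P.wordLength) (by simpa using P.length_le j)
  refine h.trans ?_
  rw [FreeGroup.lift_mk, List.map_map]
  congr 1
  refine List.map_congr_left fun a _ => ?_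
  rcases a with ⟨i, _ | _⟩ <;> simp [letterValue]

lemma wordProd_paddedWord_inr {H : Type} [_root_.Group H] (y : Option (Fin P.numGenerators) → H)
    (b : Bool) : wordProd y (fun l => P.paddedWord (.inr b) (l % P.wordLength)) P.wordLength =
      y none := by
  rw [wordProd_congr (w' := P.paddedWord (.inr b)) fun l hl => by rw [Nat.mod_eq_of_lt hl]]
  exact wordProd_alternating y none _

theorem isPresented (hP : P.IsGood) (n : ℕ) (hn : 2 ≤ n) :
    (P.wordSystem hP n hn).IsPresented P.generator where
  rel j := by
    rcases j with j | b
    · refine (P.wordProd_paddedWord P.generator rfl j).trans ?_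
      have : FreeGroup.lift (fun i => P.generator (some i)) (FreeGroup.mk (P.relator j)) =
          PresentedGroup.mk _ (FreeGroup.mk (P.relator j)) := by
        congr 1
        ext i
        simp [generator]; rfl
      rw [this]
      exact PresentedGroup.one_of_mem ⟨j, rfl⟩
    · exact P.wordProd_paddedWord_inr P.generator b
  closure := by
    rw [eq_top_iff, ← PresentedGroup.closure_range_of]
    refine Subgroup.closure_mono ?_
    rintro _ ⟨i, rfl⟩
    exact ⟨some i, rfl⟩
  lift H _ y hy := by
    -- The alternating relator kills the extra generator, so the padded relators have the values of
    -- the original ones.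
    have h0 : y none = 1 := (P.wordProd_paddedWord_inr y true).symm.trans (hy (.inr true))
    have hrel : ∀ r ∈ range fun j => FreeGroup.mk (P.relator j),
        FreeGroup.lift (fun i => y (some i)) r = 1 := by
      rintro _ ⟨j, rfl⟩
      exact (P.wordProd_paddedWord y h0 j).symm.trans (hy (.inl j))
    refine ⟨PresentedGroup.toGroup hrel, fun i => ?_⟩
    cases i with
    | none => rw [h0]; exact map_one _
    | some i => exact PresentedGroup.toGroup.of hrel

end FinitePresentation

/-! ### The comparison of the two complexity functions -/

/-- A rational class on a group generated by finitely many elements has an integral multiple. -/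
lemma exists_integral_multiple {G ι : Type} [Group G] [Fintype ι] (x : ι → G)
    (hx : Subgroup.closure (range x) = ⊤) (φ : G →* Multiplicative ℚ) :
    ∃ k : ℕ, 0 < k ∧ ∃ ψ : G →* Multiplicative ℤ,
      ∀ g, (k : ℚ) * (φ g).toAdd = (((ψ g).toAdd : ℤ) : ℚ) := by
  classical
  -- The product of the denominators on generators clears all denominators.
  let k : ℕ := ∏ i, (φ (x i)).toAdd.den
  have hz : ∀ g : G, ∃ z : ℤ, (k : ℚ) * (φ g).toAdd = z := by
    intro g
    have hg : g ∈ Subgroup.closure (range x) := hx ▸ Subgroup.mem_top g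
    induction hg using Subgroup.closure_induction with
    | mem y hy =>
      obtain ⟨i, rfl⟩ := hy
      obtain ⟨c, hc⟩ := Finset.dvd_prod_of_mem (fun i => (φ (x i)).toAdd.den) (Finset.mem_univ i)
      refine ⟨c * (φ (x i)).toAdd.num, ?_⟩
      have hk : (k : ℚ) = (φ (x i)).toAdd.den * c := by exact_mod_cast hc
      rw [hk, Int.cast_mul, Int.cast_natCast, mul_right_comm, Rat.den_mul_eq_num, mul_comm]
    | one => exact ⟨0, by simp⟩
    | mul a b _ _ ha hb =>
      obtain ⟨z, hz⟩ := ha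
      obtain ⟨w, hw⟩ := hb
      exact ⟨z + w, by rw [map_mul, toAdd_mul, mul_add, hz, hw, Int.cast_add]⟩
    | inv a _ ha =>
      obtain ⟨z, hz⟩ := ha
      exact ⟨-z, by rw [map_inv, toAdd_inv, mul_neg, hz, Int.cast_neg]⟩
  choose z hz using hz
  refine ⟨k, Finset.prod_pos fun i _ => Rat.den_pos _,
    { toFun := fun g => Multiplicative.ofAdd (z g), map_one' := ?_, map_mul' := fun a b => ?_ }, hz⟩
  · have h := hz 1
    rw [map_one, toAdd_one, mul_zero] at h
    exact congrArg Multiplicative.ofAdd (Int.cast_eq_zero.1 h.symm)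
  · have h := hz (a * b)
    rw [map_mul, toAdd_mul, mul_add, hz, hz, ← Int.cast_add] at h
    exact congrArg Multiplicative.ofAdd (Int.cast_injective h.symm)

variable {Y : Type} [TopologicalSpace Y] {y₀ : Y}

/-- An upper bound for the Turaev norm of a rational class which is pulled back along an
isomorphism. -/
lemma turaevNorm_comp_le {G : Type} [Group G] (f : FundamentalGroup Y y₀ ≃* G)
    {φ : G →* Multiplicative ℚ} {n : ℕ}
    (hn : IsLeast {k : ℕ | 0 < k ∧ ∃ ψ : G →* Multiplicative ℤ,
      ∀ g, (k : ℚ) * (φ g).toAdd = (((ψ g).toAdd : ℤ) : ℚ)} n) {ψ : G →* Multiplicative ℤ}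
    (hψ : ∀ g, (n : ℚ) * (φ g).toAdd = (((ψ g).toAdd : ℤ) : ℚ)) :
    turaevNorm (φ.comp f.toMonoidHom : RationalClass Y y₀) ≤
      turaevNormInt (ψ.comp f.toMonoidHom : IntegralClass Y y₀) / n := by
  -- An isomorphism transports integral multiples in both directions, so the least multiplier is
  -- unchanged.
  have hset : IsLeast {k : ℕ | 0 < k ∧ ∃ ψ : IntegralClass Y y₀,
      IsIntegralMultiple k (φ.comp f.toMonoidHom : RationalClass Y y₀) ψ} n := by
    refine ⟨⟨hn.1.1, ψ.comp f.toMonoidHom, fun g => hψ (f g)⟩, ?_⟩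
    rintro k ⟨hk, χ, hχ⟩
    refine hn.2 ⟨hk, χ.comp f.symm.toMonoidHom, fun g => ?_⟩
    have h := hχ (f.symm g)
    change (k : ℚ) * (φ (f (f.symm g))).toAdd = _ at h
    rw [f.apply_symm_apply] at h
    exact h
  exact iInf₂_le_of_le n hset (iInf₂_le (ψ.comp f.toMonoidHom) fun g => hψ (f g))

lemma ENNReal_natCast_div_le_ofReal {m n : ℕ} (hn : 0 < n) {q : ℚ} (h : (m : ℚ) ≤ n * q) :
    (m : ℝ≥0∞) / n ≤ ENNReal.ofReal (q : ℝ) := by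
  have hn' : (0 : ℝ) < n := Nat.cast_pos.2 hn
  have h1 : (m : ℝ) / n ≤ q := by
    rw [div_le_iff₀' hn']
    exact_mod_cast h
  refine le_trans ?_ (ENNReal.ofReal_le_ofReal h1)
  rw [ENNReal.ofReal_div_of_pos hn', ENNReal.ofReal_natCast, ENNReal.ofReal_natCast]

/-- For a good presentation `P` of a group there is a finite 2-complex whose fundamental group is
the group of `P`, and whose Turaev norm is bounded by the complexity of `P`. -/
theorem exists_turaevNorm_le {π : Type*} [Group π] (φ : π →* Multiplicative ℚ)
    {P : FinitePresentation} (hP : P.IsGood) (e : P.Group ≃* π) :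
    ∃ (Y : Type) (_ : TopologicalSpace Y) (_ : IsFiniteTwoComplex Y) (_ : twoBoundary Y = ∅)
      (y₀ : Y) (f : FundamentalGroup Y y₀ ≃* π),
      turaevNorm (φ.comp f.toMonoidHom : RationalClass Y y₀) ≤
        ENNReal.ofReal (P.complexity e φ : ℝ) := by
  classical
  obtain ⟨n, hn⟩ : ∃ n, IsLeast {k : ℕ | 0 < k ∧ ∃ ψ : P.Group →* Multiplicative ℤ,
      ∀ g, (k : ℚ) * ((φ.comp e.toMonoidHom) g).toAdd = (((ψ g).toAdd : ℤ) : ℚ)} n := by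
    have hne := exists_integral_multiple (PresentedGroup.of (rels := range fun j =>
      FreeGroup.mk (P.relator j))) (PresentedGroup.closure_range_of _) (φ.comp e.toMonoidHom)
    exact ⟨Nat.find hne, Nat.find_spec hne, fun k hk => Nat.find_min' hne hk⟩
  obtain ⟨hn0, ψ, hψ⟩ := hn.1
  -- Each circle needs at least as many interior vertices as the height it must gain, and at least
  -- two to be simplicial.
  let N : ℕ := 2 + ∑ i, (ψ (P.generator i)).toAdd.natAbs
  have hN : 2 ≤ N := Nat.le_add_right _ _
  have hb : ∀ i, |(ψ (P.generator i)).toAdd| ≤ ((P.wordSystem hP N hN).n : ℤ) := by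
    intro i
    have h := Finset.single_le_sum (f := fun i => (ψ (P.generator i)).toAdd.natAbs)
      (fun _ _ => Nat.zero_le _) (Finset.mem_univ i)
    rw [Int.abs_eq_natAbs]
    exact Int.ofNat_le.2 (h.trans (Nat.le_add_left _ _))
  obtain ⟨f, m, hm, hle⟩ := WordSystem.exists_mulEquiv (P.isPresented hP N hN) ψ hb
  refine ⟨_, _, (P.wordSystem hP N hN).isFiniteTwoComplex_space,
    (P.wordSystem hP N hN).twoBoundary_space, _, f.trans e, ?_⟩
  refine (turaevNorm_comp_le f hn hψ).trans ((ENNReal.div_le_div_right hm _).trans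
    (ENNReal_natCast_div_le_ofReal hn0 ?_))
  have hsum : ∑ i, (((P.wordSystem hP N hN).occ i : ℤ) - 2) * |(ψ (P.generator i)).toAdd| =
      ∑ i, ((P.occurrences i : ℤ) - 2) * |(ψ (PresentedGroup.of i)).toAdd| := by
    -- The extra generator is trivial, so its term vanishes however often it occurs.
    refine (Fintype.sum_option _).trans ?_
    have h0 : (ψ (P.generator none)).toAdd = 0 := congrArg Multiplicative.toAdd (map_one ψ)
    rw [h0, abs_zero, mul_zero, zero_add]
    exact Finset.sum_congr rfl fun i _ => by rw [P.occ_wordSystem hP N hN i]; rfl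
  have hle' := hle.trans_eq hsum
  have hq : 2 * (m : ℚ) ≤ ∑ i, ((P.occurrences i : ℚ) - 2) *
      |(((ψ (PresentedGroup.of i)).toAdd : ℤ) : ℚ)| := by exact_mod_cast hle'
  have heq : ∑ i, ((P.occurrences i : ℚ) - 2) * |(((ψ (PresentedGroup.of i)).toAdd : ℤ) : ℚ)| =
      2 * (n * P.complexity e φ) := by
    rw [FinitePresentation.complexity, Finset.mul_sum, Finset.mul_sum]
    refine Finset.sum_congr rfl fun i _ => ?_
    rw [← hψ, abs_mul, Nat.abs_cast]
    change ((P.occurrences i : ℚ) - 2) * (n * |(φ (e (PresentedGroup.of i))).toAdd|) = _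
    ring
  linarith

end TuraevComplexity

end

theorem mainTheorem9 {X : Type*} [TopologicalSpace X]
    (hX : TuraevComplexity.IsFiniteTwoComplex X) (hbd : TuraevComplexity.twoBoundary X = ∅)
    (x₀ : X) (φ : FundamentalGroup X x₀ →* Multiplicative ℚ) :
    TuraevComplexity.turaevComplexity φ ≤ TuraevComplexity.presentationComplexity φ := by
  refine le_iInf fun P => le_iInf fun hP => le_iInf fun e => ?_
  obtain ⟨Y, hY, hY2, hYb, y₀, f, hf⟩ := TuraevComplexity.exists_turaevNorm_le φ hP e
  exact iInf_le_of_le Y (iInf_le_of_le hY (iInf_le_of_le hY2 (iInf_le_of_le hYb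
    (iInf_le_of_le y₀ (iInf_le_of_le f hf)))))
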